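/- **Setting.** Let $\varepsilon>0$, $e_*=1/\varepsilon$, $a=(2\varepsilon)^{-1/2}$. The regularized Stark problem is the mechanical Hamiltonian $H=\tfrac12(y_1^2+y_2^2)+V(x)$ on $\mathbb R^4$ with $$V(x_1,x_2)=V_1(x_1)+V_2(x_2)=4(x_1^2-\varepsilon x_1^4)+4(x_2^2+\varepsilon x_2^4),$$ so $H=H_1+H_2$ with $H_i=\tfrac12y_i^2+V_i(x_i)$. The saddles of $V$ are $(\pm a,0)$, with critical value $e_*$; they give the saddle-centers $p_1=(-a,0,0,0)$, $p_2=(a,0,0,0)$ of $H$. For $E>e_*$ let $$K_E=\{x: V(x)\le E,\ |x_1|\le a\},\qquad S_E=\{(x,y)\in H^{-1}(E): x\in K_E\},$$ and let the Lyapunov orbits around $p_1,p_2$ be the periodic orbits $P_2^1,P_2^2$ with traces $H^{-1}(E)\cap\{x_1=\mp a,\ y_1=0\}$. **Index.** For a periodic orbit $P=(w,T)$ (here always simple, with least period $T$) in $H^{-1}(E)$ let $X_0=\nabla H/|\nabla H|$ and let $X_1,X_2,X_3$ be the images of $X_0$ under the maps $(a_1,a_2,b_1,b_2)\mapsto(b_2,-b_1,a_2,-a_1)$,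 $(a_2,-a_1,-b_2,b_1)$, $(b_1,b_2,-a_1,-a_2)$. Let $I$ be the set of numbers $(\theta(T)-\theta(0))/2\pi$, where $\theta$ is a continuous argument of $\alpha_1+i\alpha_2\ne0$ and $\alpha_1X_1+\alpha_2X_2+\alpha_3X_3$ is a solution, tangent to $H^{-1}(E)$, of the flow linearized along $w$. The index of $P$ is $2k+1$ if $I-\delta\subset(k,k+1)$, and $2k$ if $k\in\operatorname{int}(I-\delta)$, for all small $\delta>0$. $P$ is hyperbolic if the induced transverse return map $\alpha(0)\mapsto\alpha(T)$ has a real eigenvalue of modulus $\ne1$. **Weakly convex foliation.** Let $S\subset H^{-1}(E)$ be a compact set consisting of regular points, diffeomorphic to $S^3$ with $l\ge 1$ disjoint open balls removed, whose relative boundary in $H^{-1}(E)$ is a union of smoothly embedded two-spheres $\mathcal S_1,\dots,\mathcal S_l$. A weakly convex foliation adapted to $S$ is a singular smooth foliation of $S$ such that: 1. its singular set (the binding) consists of $l+1$ disjoint periodic orbits: hyperbolic index-$2$ orbits $P_2^1,\dots,P_2^l$, and an index-$3$ orbit $P_3\subset S$ that is unknotted (bounds a smoothly embedded closed disk in $S$);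 2. the complement of the binding in $S$ is smoothly foliated by the following pairwise disjoint, properly embedded regular leaves (indices $j$ mod $l$): (a) rigid planes $U_1^j,U_2^j$, both asymptotic to $P_2^j$, with $\mathcal S_j=U_1^j\cup U_2^j\cup P_2^j$, where the flow enters $S$ through one of the two planes and leaves $S$ through the other; (b) rigid cylinders $V^j$, asymptotic to $P_3$ at one end and to $P_2^j$ at the other; (c) smooth families of planes $D^j_\tau$, $\tau\in(0,1)$, asymptotic to $P_3$, with $\overline{D^j_\tau}\to\overline{U_1^j\cup V^j}$ as $\tau\to0^+$ and $\overline{D^j_\tau}\to\overline{U_2^{j+1}\cup V^{j+1}}$ as $\tau\to1^-$, in the Hausdorff sense; 3. every regular leaf is transverse to the Hamiltonian flow. Here an end of a leaf is asymptotic to $P$ if it is parametrized by $(r,t)$, $t\in\mathbb R/\mathbb Z$, so that the loops $t\mapsto u(r,t)$ converge in $C^\infty$, as the end is approached, to a regular parametrization of $P$ running through $P$ once. **Proposition.** Let $\varepsilon>0$ and $E>e_*=1/\varepsilon$. Then $K_E$ is homeomorphic to a closed disk, its boundary is the union of the projections of the two Lyapunov orbits and of $\{V=E,\ |x_1|\le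 a\}$, and $S_E$ projects onto $K_E$. The set $S_E\subset H^{-1}(E)$ admits a weakly convex foliation with $l=2$ adapted to it. Its index-$2$ binding orbits $P_2^1,P_2^2$ are the Lyapunov orbits around $p_1,p_2$, and its index-$3$ binding orbit is the orbit with trace $H^{-1}(E)\cap\{x_1=y_1=0\}$, which projects into $K_E$. The regular leaves project to the gradient flow lines of $H_1$: for every regular leaf $L$ there is a non-constant solution $c:\mathbb R\to\mathbb R^2$ of $\dot c=\nabla H_1(c)$ such that, $\pi$ denoting the projection to the $x_1y_1$-plane, $L=S_E\cap\pi^{-1}(c(\mathbb R))$ and $\pi(L)=c(\mathbb R)\cap\{H_1\le E\}$. -/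

import Mathlib

open Set Filter Topology
open scoped ContDiff

noncomputable section

namespace Stark

/-- The phase space `ℝ⁴` with coordinates `(x₁, x₂, y₁, y₂) = (p 0, p 1, p 2, p 3)`. -/
abbrev Phase := EuclideanSpace ℝ (Fin 4)

/-- The Euclidean plane. -/
abbrev Plane := EuclideanSpace ℝ (Fin 2)

/-! ### Hamiltonian dynamics, the quaternion frame and the index of a periodic orbit -/

/-- The quaternionic map `j₁ (a₁,a₂,b₁,b₂) = (b₂,-b₁,a₂,-a₁)`. -/
def j₁ (v : Phase) : Phase := !₂[v 3, -v 2, v 1, -v 0]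

/-- The quaternionic map `j₂ (a₁,a₂,b₁,b₂) = (a₂,-a₁,-b₂,b₁)`. -/
def j₂ (v : Phase) : Phase := !₂[v 1, -v 0, -v 3, v 2]

/-- The quaternionic map `j₃ (a₁,a₂,b₁,b₂) = (b₁,b₂,-a₁,-a₂)`. -/
def j₃ (v : Phase) : Phase := !₂[v 2, v 3, -v 0, -v 1]

/-- The Hamiltonian vector field: `ẋ = ∂H/∂y`, `ẏ = -∂H/∂x`. -/
def hamVec (H : Phase → ℝ) (p : Phase) : Phase := j₃ (gradient H p)

/-- The unit normal `X₀ = ∇H / |∇H|` of the energy surface. -/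
def normal (H : Phase → ℝ) (p : Phase) : Phase := ‖gradient H p‖⁻¹ • gradient H p

/-- A simple (in particular non-constant) periodic orbit `P = (w, T)` of the Hamiltonian flow in
`H⁻¹(E)`; `T` is the least period. -/
structure PeriodicOrbit (H : Phase → ℝ) (E : ℝ) where
  w : ℝ → Phase
  T : ℝ
  T_pos : 0 < T
  solution : ∀ t, HasDerivAt w (hamVec H (w t)) t
  energy : ∀ t, H (w t) = E
  periodic : ∀ t, w (t + T) = w t
  simple : InjOn w (Ico 0 T)

namespace PeriodicOrbit

variable {H : Phase → ℝ} {E : ℝ}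

/-- The trace of the orbit in phase space. -/
def trace (P : PeriodicOrbit H E) : Set Phase := range P.w

/-- `u` is a solution of the linearized flow along `P`, tangent to the energy surface. -/
def IsLinearized (P : PeriodicOrbit H E) (u : ℝ → Phase) : Prop :=
  (∀ t, HasDerivAt u (j₃ (fderiv ℝ (gradient H) (P.w t) (u t))) t) ∧
    ∀ t, inner ℝ (normal H (P.w t)) (u t) = 0

/-- The transverse part `α₁ + i α₂` of `u = α₁ X₁ + α₂ X₂ + α₃ X₃`, where `Xᵢ = jᵢ X₀`
(the vectors `X₁, X₂, X₃` are orthonormal). -/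
def transverse (P : PeriodicOrbit H E) (u : ℝ → Phase) (t : ℝ) : ℂ :=
  ⟨inner ℝ (j₁ (normal H (P.w t))) (u t), inner ℝ (j₂ (normal H (P.w t))) (u t)⟩

/-- The set `I` of all `(θ(T) - θ(0)) / 2π`, where `θ` is a continuous argument of a non-vanishing
transverse linearized solution. -/
def rotationSet (P : PeriodicOrbit H E) : Set ℝ :=
  {ρ | ∃ (u : ℝ → Phase) (θ : ℝ → ℝ), P.IsLinearized u ∧ P.transverse u 0 ≠ 0 ∧ Continuous θ ∧
    (∀ t, P.transverse u t = ‖P.transverse u t‖ * Complex.exp (θ t * Complex.I)) ∧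
    ρ = (θ P.T - θ 0) / (2 * Real.pi)}

/-- `P` has (generalized Conley-Zehnder) index `n`: for all small `δ > 0`, either `n = 2k+1` and
`I - δ ⊆ (k, k+1)`, or `n = 2k` and `k` is interior to `I - δ`. -/
def HasIndex (P : PeriodicOrbit H E) (n : ℤ) : Prop :=
  P.rotationSet.Nonempty ∧
  ∀ᶠ δ in 𝓝[>] (0 : ℝ),
    (∃ k : ℤ, n = 2 * k + 1 ∧ (fun ρ => ρ - δ) '' P.rotationSet ⊆ Ioo (k : ℝ) (k + 1)) ∨
    (∃ k : ℤ, n = 2 * k ∧ (k : ℝ) ∈ interior ((fun ρ => ρ - δ) '' P.rotationSet))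

/-- The (two-dimensional, area preserving) transverse monodromy has a real eigenvalue off the unit
circle. -/
def IsHyperbolic (P : PeriodicOrbit H E) : Prop :=
  ∃ u : ℝ → Phase, P.IsLinearized u ∧ P.transverse u 0 ≠ 0 ∧
    ∃ c : ℝ, |c| ≠ 1 ∧ P.transverse u P.T = c * P.transverse u 0

/-- `P` is unknotted in `S`: it bounds a smoothly embedded closed disk contained in `S`. -/
def IsUnknottedIn (P : PeriodicOrbit H E) (S : Set Phase) : Prop :=
  ∃ f : ℂ → Phase, ContDiff ℝ ∞ f ∧ InjOn f (Metric.closedBall 0 1) ∧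
    (∀ z ∈ Metric.closedBall (0 : ℂ) 1, Function.Injective (fderiv ℝ f z)) ∧
    f '' Metric.closedBall 0 1 ⊆ S ∧ f '' Metric.sphere 0 1 = P.trace

/-- `γ` is a regular parametrization of the trace of `P` by `ℝ/ℤ`, running through it once. -/
def IsParametrization (P : PeriodicOrbit H E) (γ : ℝ → Phase) : Prop :=
  ContDiff ℝ ∞ γ ∧ (∀ t, γ (t + 1) = γ t) ∧ InjOn γ (Ico 0 1) ∧ (∀ t, deriv γ t ≠ 0) ∧
    range γ = P.trace

end PeriodicOrbit

/-! ### Surfaces -/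

/-- `f` restricts to a smooth embedding of the open set `Ω ⊆ ℂ`. -/
def IsSmoothEmbeddingOn (f : ℂ → Phase) (Ω : Set ℂ) : Prop :=
  ContDiffOn ℝ ∞ f Ω ∧ (∀ z ∈ Ω, Function.Injective (fderiv ℝ f z)) ∧ IsEmbedding (Ω.domRestrict f)

/-- The end `|z| → F` (with `F` the filter `r → ∞` or `r → 0⁺`) of the surface `f` is asymptotic to
`P`: the loops `t ↦ f (r e^{2πit})` converge in `C^∞(ℝ/ℤ)` to a parametrization of `P`. -/
def IsAsymptotic {H : Phase → ℝ} {E : ℝ} (f : ℂ → Phase) (F : Filter ℝ)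
    (P : PeriodicOrbit H E) : Prop :=
  ∃ γ : ℝ → Phase, P.IsParametrization γ ∧
    ∀ k : ℕ, TendstoUniformly
      (fun (r : ℝ) (t : ℝ) =>
        iteratedDeriv k (fun s : ℝ => f (r * Complex.exp (2 * Real.pi * s * Complex.I))) t)
      (iteratedDeriv k γ) F

/-- `A` is a smoothly embedded two-sphere. -/
def IsEmbeddedSphere (A : Set Phase) : Prop :=
  ∃ (g : EuclideanSpace ℝ (Fin 3) → Phase) (O : Set (EuclideanSpace ℝ (Fin 3))),
    IsOpen O ∧ Metric.sphere 0 1 ⊆ O ∧ ContDiffOn ℝ ∞ g O ∧ InjOn g (Metric.sphere 0 1) ∧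
    (∀ p ∈ Metric.sphere (0 : EuclideanSpace ℝ (Fin 3)) 1, ∀ v,
      inner ℝ p v = 0 → fderiv ℝ g p v = 0 → v = 0) ∧
    g '' Metric.sphere 0 1 = A

/-- `A` and `B` are diffeomorphic: there are mutually inverse bijections which are restrictions of
smooth maps defined on open neighbourhoods. -/
def AreDiffeomorphic (A B : Set Phase) : Prop :=
  ∃ (f g : Phase → Phase) (O O' : Set Phase), IsOpen O ∧ IsOpen O' ∧ A ⊆ O ∧ B ⊆ O' ∧
    ContDiffOn ℝ ∞ f O ∧ ContDiffOn ℝ ∞ g O' ∧ MapsTo f A B ∧ MapsTo g B A ∧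
    LeftInvOn g f A ∧ LeftInvOn f g B

/-- `S` is diffeomorphic to the three-sphere with `l` disjoint open balls removed. -/
def IsPuncturedThreeSphere (S : Set Phase) (l : ℕ) : Prop :=
  ∃ (c : Fin l → Phase) (r : Fin l → ℝ),
    (∀ j, c j ∈ Metric.sphere 0 1 ∧ 0 < r j ∧ r j < 2) ∧
    (Pairwise fun i j => Disjoint (Metric.sphere 0 1 ∩ Metric.closedBall (c i) (r i))
      (Metric.sphere 0 1 ∩ Metric.closedBall (c j) (r j))) ∧
    AreDiffeomorphic S (Metric.sphere 0 1 \ ⋃ j, Metric.ball (c j) (r j))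

/-- The flow enters `S` at `p`. -/
def EntersAt (H : Phase → ℝ) (S : Set Phase) (p : Phase) : Prop :=
  ∀ c : ℝ → Phase, (∀ᶠ t in 𝓝 0, HasDerivAt c (hamVec H (c t)) t) → c 0 = p →
    (∀ᶠ t in 𝓝[>] (0 : ℝ), c t ∈ S) ∧ ∀ᶠ t in 𝓝[<] (0 : ℝ), c t ∉ S

/-- The flow leaves `S` at `p`. -/
def LeavesAt (H : Phase → ℝ) (S : Set Phase) (p : Phase) : Prop :=
  ∀ c : ℝ → Phase, (∀ᶠ t in 𝓝 0, HasDerivAt c (hamVec H (c t)) t) → c 0 = p →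
    (∀ᶠ t in 𝓝[>] (0 : ℝ), c t ∉ S) ∧ ∀ᶠ t in 𝓝[<] (0 : ℝ), c t ∈ S

/-! ### Weakly convex foliations -/

/-- Labels of the regular leaves: `l` pairs of rigid planes `U₁ʲ` (`b = 0`) and `U₂ʲ` (`b = 1`),
`l` rigid cylinders `Vʲ`, and `l` families of planes `D_τʲ`, `τ ∈ (0,1)`. -/
inductive LeafIndex (l : ℕ) : Type
  | rigid (j : Fin l) (b : Fin 2) : LeafIndex l
  | cylinder (j : Fin l) : LeafIndex l
  | plane (j : Fin l) (τ : Ioo (0 : ℝ) 1) : LeafIndex l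

/-- Planes are parametrized by `ℂ`, cylinders by `ℂ \ {0}`. -/
def LeafIndex.domain {l : ℕ} : LeafIndex l → Set ℂ
  | .rigid _ _ => univ
  | .cylinder _ => {0}ᶜ
  | .plane _ _ => univ

/-- The binding orbits and the parametrized regular leaves of a singular foliation of the
combinatorial type of a weakly convex foliation. -/
structure FoliationData (H : Phase → ℝ) (E : ℝ) (l : ℕ) where
  /-- The index-2 binding orbits. -/
  P₂ : Fin l → PeriodicOrbit H E
  /-- The index-3 binding orbit. -/
  P₃ : PeriodicOrbit H E
  /-- Parametrizations of the regular leaves. -/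
  param : LeafIndex l → ℂ → Phase

namespace FoliationData

variable {H : Phase → ℝ} {E : ℝ} {l : ℕ} (F : FoliationData H E l)

/-- The singular set of the foliation. -/
def binding : Set Phase := F.P₃.trace ∪ ⋃ j, (F.P₂ j).trace

/-- The regular leaf with label `i`. -/
def leaf (i : LeafIndex l) : Set Phase := F.param i '' i.domain

/-- The set `U₁ʲ ∪ U₂ʲ ∪ P₂ʲ`. -/
def sphere (j : Fin l) : Set Phase :=
  F.leaf (.rigid j 0) ∪ F.leaf (.rigid j 1) ∪ (F.P₂ j).trace

end FoliationData

/-- `F` is a weakly convex foliation adapted to the compact subset `S` of `H⁻¹(E)`. -/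
structure IsWeaklyConvexFoliation {H : Phase → ℝ} {E : ℝ} {l : ℕ} [NeZero l]
    (F : FoliationData H E l) (S : Set Phase) : Prop where
  /- `S` is a compact region of the energy surface, bounded by two-spheres that consist of a pair
  of rigid planes and the corresponding index-2 orbit. -/
  subset_energy : S ⊆ H ⁻¹' {E}
  regular : ∀ p ∈ S, gradient H p ≠ 0
  compact : IsCompact S
  punctured : IsPuncturedThreeSphere S l
  boundary : S ∩ closure (H ⁻¹' {E} \ S) = ⋃ j, F.sphere j
  sphere_embedded : ∀ j, IsEmbeddedSphere (F.sphere j)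
  opposite : ∀ j,
    ((∀ p ∈ F.leaf (.rigid j 0), EntersAt H S p) ∧ ∀ p ∈ F.leaf (.rigid j 1), LeavesAt H S p) ∨
    ((∀ p ∈ F.leaf (.rigid j 0), LeavesAt H S p) ∧ ∀ p ∈ F.leaf (.rigid j 1), EntersAt H S p)
  /- The binding orbits. -/
  index_two : ∀ j, (F.P₂ j).HasIndex 2
  hyperbolic : ∀ j, (F.P₂ j).IsHyperbolic
  index_three : F.P₃.HasIndex 3
  unknotted : F.P₃.IsUnknottedIn S
  binding_subset : F.binding ⊆ S
  disjoint_two : Pairwise fun i j => Disjoint (F.P₂ i).trace (F.P₂ j).trace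
  disjoint_three : ∀ j, Disjoint (F.P₂ j).trace F.P₃.trace
  /- The regular leaves foliate the complement of the binding: they partition it, and near each of
  its points they are the level sets of a submersion on the energy surface. -/
  union_leaf : ⋃ i, F.leaf i = S \ F.binding
  disjoint_leaf : Pairwise fun i i' => Disjoint (F.leaf i) (F.leaf i')
  chart : ∀ p ∈ S \ F.binding, ∃ (O : Set Phase) (g : Phase → ℝ), IsOpen O ∧ p ∈ O ∧
    ContDiffOn ℝ ∞ g O ∧
    (∀ q ∈ O ∩ H ⁻¹' {E}, ∃ v, fderiv ℝ H q v = 0 ∧ fderiv ℝ g q v ≠ 0) ∧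
    ∀ i i' q q', q ∈ O ∩ F.leaf i → q' ∈ O ∩ F.leaf i' → (i = i' ↔ g q = g q')
  /- The regular leaves are properly embedded planes and cylinders with the required ends. -/
  embedded : ∀ i, IsSmoothEmbeddingOn (F.param i) i.domain
  proper : ∀ i, closure (F.leaf i) ∩ (S \ F.binding) ⊆ F.leaf i
  asymptotic_rigid : ∀ j b, IsAsymptotic (F.param (.rigid j b)) atTop (F.P₂ j)
  asymptotic_cylinder_three : ∀ j, IsAsymptotic (F.param (.cylinder j)) atTop F.P₃
  asymptotic_cylinder_two : ∀ j, IsAsymptotic (F.param (.cylinder j)) (𝓝[>] 0) (F.P₂ j)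
  asymptotic_plane : ∀ j τ, IsAsymptotic (F.param (.plane j τ)) atTop F.P₃
  /- `D_τʲ`, `τ ∈ (0,1)`, is a smooth family: the planes are the level sets `{G = τ}` of a submersion
  on an open part of `S`. -/
  family : ∀ j, ∃ (O : Set Phase) (G : Phase → ℝ), IsOpen O ∧
    O ∩ S = ⋃ τ, F.leaf (.plane j τ) ∧ ContDiffOn ℝ ∞ G O ∧
    (∀ τ : Ioo (0 : ℝ) 1, ∀ p ∈ F.leaf (.plane j τ), G p = τ) ∧
    ∀ q ∈ O ∩ S, ∃ v, fderiv ℝ H q v = 0 ∧ fderiv ℝ G q v ≠ 0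
  /- Breaking of the families, in the Hausdorff sense; the superscript `j + 1` is cyclic. -/
  breaks_zero : ∀ j, ∀ η > (0 : ℝ), ∃ δ > (0 : ℝ), ∀ τ : Ioo (0 : ℝ) 1, (τ : ℝ) < δ →
    Metric.hausdorffEDist (closure (F.leaf (.plane j τ)))
      (closure (F.leaf (.rigid j 0) ∪ F.leaf (.cylinder j))) < ENNReal.ofReal η
  breaks_one : ∀ j, ∀ η > (0 : ℝ), ∃ δ > (0 : ℝ), ∀ τ : Ioo (0 : ℝ) 1, 1 - δ < (τ : ℝ) →
    Metric.hausdorffEDist (closure (F.leaf (.plane j τ)))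
      (closure (F.leaf (.rigid (j + 1) 1) ∪ F.leaf (.cylinder (j + 1)))) < ENNReal.ofReal η
  /- All regular leaves are transverse to the flow. -/
  transverse : ∀ i, ∀ z ∈ i.domain, hamVec H (F.param i z) ∉ range (fderiv ℝ (F.param i) z)

/-! ### The regularized Stark problem -/

/-- `V₁(x₁) = 4 (x₁² - ε x₁⁴)`. -/
def V₁ (ε s : ℝ) : ℝ := 4 * (s ^ 2 - ε * s ^ 4)

/-- `V₂(x₂) = 4 (x₂² + ε x₂⁴)`. -/
def V₂ (ε s : ℝ) : ℝ := 4 * (s ^ 2 + ε * s ^ 4)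

/-- The potential `V(x) = V₁(x₁) + V₂(x₂) = 4 |x|² (1 - ε Re (x₁ + i x₂)²)`. -/
def potential (ε : ℝ) (x : Plane) : ℝ := V₁ ε (x 0) + V₂ ε (x 1)

/-- The subsystem `H₁(x₁, y₁) = y₁²/2 + V₁(x₁)`. -/
def H₁ (ε : ℝ) (z : Plane) : ℝ := z 1 ^ 2 / 2 + V₁ ε (z 0)

/-- The regularized Stark Hamiltonian `H(x, y) = |y|²/2 + V(x)`. -/
def starkH (ε : ℝ) (p : Phase) : ℝ := (p 2 ^ 2 + p 3 ^ 2) / 2 + potential ε !₂[p 0, p 1]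

/-- The saddles of `V` are `(± a, 0)` with `a = (2ε)^{-1/2}`. -/
def saddle (ε : ℝ) : ℝ := (√(2 * ε))⁻¹

/-- The projection to the `x`-plane. -/
def projX (p : Phase) : Plane := !₂[p 0, p 1]

/-- The projection to the `x₁y₁`-plane. -/
def projOne (p : Phase) : Plane := !₂[p 0, p 2]

/-- The part `K_E` of the Hill region `{V ≤ E}` between the two saddles. -/
def regionK (ε E : ℝ) : Set Plane := {x | potential ε x ≤ E ∧ |x 0| ≤ saddle ε}

/-- The subset `S_E` of `H⁻¹(E)` projecting to `K_E`. -/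
def regionS (ε E : ℝ) : Set Phase := {p | starkH ε p = E ∧ projX p ∈ regionK ε E}

/-- The part of `H⁻¹(E)` over the point `(x₁, y₁) = (s, 0)`. For `s = ± a` this is the Lyapunov orbit
around the saddle-center `(± a, 0, 0, 0)`. -/
def fiber (ε E s : ℝ) : Set Phase := {p | starkH ε p = E ∧ p 0 = s ∧ p 2 = 0}

/-- `c` is a (non-constant) gradient flow line of `h`. -/
def IsGradientFlowLine (h : Plane → ℝ) (c : ℝ → Plane) : Prop :=
  (∀ t, HasDerivAt c (gradient h (c t)) t) ∧ ∀ t, gradient h (c t) ≠ 0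

end Stark

end

/-! In the coordinate `Q` with `V₂ = Q²/2` the energy is `H = H₁(x₁, y₁) + (Q² + y₂²)/2`. The level
`H = E` therefore projects to the region `{H₁ ≤ E}` of the `x₁y₁`-plane, with circles in the `(Q,
y₂)`-plane as fibres that shrink to points over `{H₁ = E}`. Since `V₁ ≤ 1/ε < E` (`V₁_le`), the
circles over the three critical points of `H₁`, the minimum at the origin and the saddles `(±a, 0)`,
are genuine; they are invariant and form the binding (`exists_orbit`).

The Hamiltonian flow projects to that of `H₁`, whose vector field is `∇H₁` rotated by a quarter
turn. Hence the preimages of gradient lines of `H₁` are transverse to the flow. These lines are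
explicit: along the gradient flow `W = x₁/√(1 - 2εx₁²)` grows like `exp (8t)` and `y₁` like `exp t`.
In `|x₁| ≤ a` they are the half-lines of `x₁ = ±a`, the segments of `y₁ = 0` between the origin and
the saddles, and the curves `W = C y₁⁸`. A line off the axis meets `{H₁ = E}` once, so its preimage
is a plane (`CapProfile`); on the axis `H₁ < E`, so the preimage is a cylinder. The limits of a line
at critical points give the asymptotic orbits, and `|C| → ∞` gives the breaking
(`planeSet_tendsto`). Three functions of `W` and `y₁` serve as foliation charts near the planes, the
rigid planes and the cylinders (`exists_leafChart`).

For the indices, the frame `X₁, X₂` makes exactly one turn relative to the `x₁y₁`-coordinates along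
each binding orbit. A rotation number is thus `1` plus the rotation of the linearized `H₁`-flow. At
a saddle this flow is hyperbolic with rotations of both signs, so `1` is interior to `I - δ` and the
index is `2` (`hasIndex_two_saddle`). At the origin it is an oscillator of period `2π/√8`, while the
orbit has period at most `2π/√8`; so `I ⊆ (1, 2]` and the index is `3` (`rotation_center_bounds`).

For the topology, the slice of the energy surface at fixed `x₁` is a round two-sphere in `(Q, y₁,
y₂)` of radius `width`. Rescaling these spheres identifies `S_E` with the three-sphere without two
caps, and rescaling `Q` alone identifies `K_E` with a rectangle. -/

namespace Stark

/-! ### Derivatives of the Stark Hamiltonian -/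

/-- The derivative of `V₁`. -/
noncomputable def dV₁ (ε s : ℝ) : ℝ := 8 * s - 16 * ε * s ^ 3

/-- The derivative of `V₂`. -/
noncomputable def dV₂ (ε s : ℝ) : ℝ := 8 * s + 16 * ε * s ^ 3

theorem hasDerivAt_V₁ (ε s : ℝ) : HasDerivAt (V₁ ε) (dV₁ ε s) s := by
  have h := (((hasDerivAt_id s).pow 2).sub (((hasDerivAt_id s).pow 4).const_mul ε)).const_mul 4
  refine h.congr_deriv ?_
  simp [dV₁]; ring

theorem hasDerivAt_V₂ (ε s : ℝ) : HasDerivAt (V₂ ε) (dV₂ ε s) s := by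
  have h := (((hasDerivAt_id s).pow 2).add (((hasDerivAt_id s).pow 4).const_mul ε)).const_mul 4
  refine h.congr_deriv ?_
  simp [dV₂]; ring

theorem hasDerivAt_dV₁ (ε s : ℝ) : HasDerivAt (dV₁ ε) (8 - 48 * ε * s ^ 2) s := by
  have h := ((hasDerivAt_id s).const_mul 8).sub (((hasDerivAt_id s).pow 3).const_mul (16 * ε))
  refine h.congr_deriv ?_
  simp; ring

theorem hasDerivAt_dV₂ (ε s : ℝ) : HasDerivAt (dV₂ ε) (8 + 48 * ε * s ^ 2) s := by
  have h := ((hasDerivAt_id s).const_mul 8).add (((hasDerivAt_id s).pow 3).const_mul (16 * ε))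
  refine h.congr_deriv ?_
  simp; ring

theorem contDiff_V₁ (ε : ℝ) : ContDiff ℝ ∞ (V₁ ε) := by unfold V₁; fun_prop

theorem continuous_V₁ (ε : ℝ) : Continuous (V₁ ε) := (contDiff_V₁ ε).continuous

theorem hasFDerivAt_phase {A : Type*} [NormedAddCommGroup A] [NormedSpace ℝ A] {f : A → Phase}
    {f' : A →L[ℝ] Phase} {a : A} :
    HasFDerivAt f f' a ↔ ∀ i, HasFDerivAt (fun s => f s i) (PiLp.proj 2 _ i ∘L f') a := by
  simp only [← hasFDerivWithinAt_univ]
  exact hasFDerivWithinAt_euclidean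

theorem hasDerivAt_phase {f : ℝ → Phase} {f' : Phase} {t : ℝ} :
    HasDerivAt f f' t ↔ ∀ i, HasDerivAt (fun s => f s i) (f' i) t := by
  rw [hasDerivAt_iff_hasFDerivAt, hasFDerivAt_phase]
  rfl

theorem hasFDerivAt_coord (i : Fin 4) (p : Phase) :
    HasFDerivAt (fun q : Phase => q i) (EuclideanSpace.proj i : Phase →L[ℝ] ℝ) p :=
  (EuclideanSpace.proj i : Phase →L[ℝ] ℝ).hasFDerivAt

theorem hasFDerivAt_plane_coord (i : Fin 2) (p : Plane) :
    HasFDerivAt (fun q : Plane => q i) (EuclideanSpace.proj i : Plane →L[ℝ] ℝ) p :=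
  (EuclideanSpace.proj i : Plane →L[ℝ] ℝ).hasFDerivAt

theorem starkH_eq (ε : ℝ) (p : Phase) :
    starkH ε p = (p 2 ^ 2 + p 3 ^ 2) / 2 + V₁ ε (p 0) + V₂ ε (p 1) := by
  simp [starkH, potential]; ring

theorem hasGradientAt_starkH (ε : ℝ) (p : Phase) :
    HasGradientAt (starkH ε) !₂[dV₁ ε (p 0), dV₂ ε (p 1), p 2, p 3] p := by
  rw [hasGradientAt_iff_hasFDerivAt]
  have h := (((((hasFDerivAt_coord 2 p).pow 2).add ((hasFDerivAt_coord 3 p).pow 2)).mul_const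
    (2⁻¹ : ℝ)).add ((hasDerivAt_V₁ ε (p 0)).comp_hasFDerivAt p (hasFDerivAt_coord 0 p))).add
    ((hasDerivAt_V₂ ε (p 1)).comp_hasFDerivAt p (hasFDerivAt_coord 1 p))
  refine (h.congr_fderiv ?_).congr_of_eventuallyEq (Eventually.of_forall fun q => ?_)
  · ext v
    simp [PiLp.inner_apply, Fin.sum_univ_four]
    ring
  · simp [starkH_eq]; ring

theorem gradient_starkH (ε : ℝ) (p : Phase) :
    gradient (starkH ε) p = !₂[dV₁ ε (p 0), dV₂ ε (p 1), p 2, p 3] :=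
  (hasGradientAt_starkH ε p).gradient

theorem hamVec_starkH (ε : ℝ) (p : Phase) :
    hamVec (starkH ε) p = !₂[p 2, p 3, -dV₁ ε (p 0), -dV₂ ε (p 1)] := by
  ext i; fin_cases i <;> simp [hamVec, j₃, gradient_starkH]

theorem fderiv_starkH_apply (ε : ℝ) (p v : Phase) :
    fderiv ℝ (starkH ε) p v =
      dV₁ ε (p 0) * v 0 + dV₂ ε (p 1) * v 1 + p 2 * v 2 + p 3 * v 3 := by
  rw [(hasGradientAt_iff_hasFDerivAt.1 (hasGradientAt_starkH ε p)).fderiv]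
  simp [PiLp.inner_apply, Fin.sum_univ_four]
  ring

theorem fderiv_starkH_hamVec (ε : ℝ) (p : Phase) :
    fderiv ℝ (starkH ε) p (hamVec (starkH ε) p) = 0 := by
  rw [fderiv_starkH_apply, hamVec_starkH]; simp; ring

theorem fderiv_gradient_starkH (ε : ℝ) (p v : Phase) :
    fderiv ℝ (gradient (starkH ε)) p v =
      !₂[(8 - 48 * ε * p 0 ^ 2) * v 0, (8 + 48 * ε * p 1 ^ 2) * v 1, v 2, v 3] := by
  have h : HasFDerivAt (gradient (starkH ε)) (fderiv ℝ (gradient (starkH ε)) p) p := by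
    refine DifferentiableAt.hasFDerivAt ?_
    rw [show gradient (starkH ε) = fun p => !₂[dV₁ ε (p 0), dV₂ ε (p 1), p 2, p 3] from
      funext (gradient_starkH ε), differentiableAt_piLp]
    intro i
    fin_cases i <;> simp [dV₁, dV₂] <;> fun_prop
  rw [hasFDerivAt_phase] at h
  ext i
  have hi := h i
  simp only [gradient_starkH] at hi
  fin_cases i
  · have h0 := (hasDerivAt_dV₁ ε (p 0)).comp_hasFDerivAt p (hasFDerivAt_coord 0 p)
    have := HasFDerivAt.unique hi h0
    simpa using congrArg (fun L : Phase →L[ℝ] ℝ => L v) this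
  · have h1 := (hasDerivAt_dV₂ ε (p 1)).comp_hasFDerivAt p (hasFDerivAt_coord 1 p)
    have := HasFDerivAt.unique hi h1
    simpa using congrArg (fun L : Phase →L[ℝ] ℝ => L v) this
  · have := hi.unique (hasFDerivAt_coord 2 p)
    simpa using congrArg (fun L : Phase →L[ℝ] ℝ => L v) this
  · have := hi.unique (hasFDerivAt_coord 3 p)
    simpa using congrArg (fun L : Phase →L[ℝ] ℝ => L v) this

theorem hasGradientAt_H₁ (ε : ℝ) (z : Plane) :
    HasGradientAt (H₁ ε) !₂[dV₁ ε (z 0), z 1] z := by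
  rw [hasGradientAt_iff_hasFDerivAt]
  have h := (((hasFDerivAt_plane_coord 1 z).pow 2).mul_const (2⁻¹ : ℝ)).add
    ((hasDerivAt_V₁ ε (z 0)).comp_hasFDerivAt z (hasFDerivAt_plane_coord 0 z))
  refine (h.congr_fderiv ?_).congr_of_eventuallyEq (Eventually.of_forall fun q => ?_)
  · ext v
    simp [PiLp.inner_apply, Fin.sum_univ_two]
    ring
  · simp [H₁]; ring

theorem gradient_H₁ (ε : ℝ) (z : Plane) : gradient (H₁ ε) z = !₂[dV₁ ε (z 0), z 1] :=
  (hasGradientAt_H₁ ε z).gradient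

/-! ### The normalizing coordinate `Q` with `V₂ = Q² / 2` -/

/-- The coordinate `Q` with `V₂ = Q² / 2`. -/
noncomputable def coordQ (ε x : ℝ) : ℝ := x * √(8 * (1 + ε * x ^ 2))

/-- The inverse of `coordQ`. -/
noncomputable def invQ (ε q : ℝ) : ℝ := q / √(4 + √(16 + 8 * ε * q ^ 2))

/-- The derivative of `coordQ`. -/
noncomputable def dQ (ε x : ℝ) : ℝ := √8 * (1 + 2 * ε * x ^ 2) / √(1 + ε * x ^ 2)

section
variable {ε : ℝ}

theorem V₂_eq_coordQ (hε : 0 < ε) (x : ℝ) : V₂ ε x = coordQ ε x ^ 2 / 2 := by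
  rw [coordQ, mul_pow, Real.sq_sqrt (by positivity), V₂]; ring

/-- Solving `ε x⁴ + x² = q²/8` for `x²` and rationalizing gives `x² = q²/(4 + √(16 + 8εq²))`; in
this form the inverse is visibly smooth at `q = 0`. -/
theorem coordQ_invQ (hε : 0 < ε) (q : ℝ) : coordQ ε (invQ ε q) = q := by
  set r := √(16 + 8 * ε * q ^ 2) with hr
  have hr2 : r ^ 2 = 16 + 8 * ε * q ^ 2 := Real.sq_sqrt (by positivity)
  have hr0 : 0 ≤ r := Real.sqrt_nonneg _
  have h4 : (0 : ℝ) < 4 + r := by positivity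
  have hx2 : invQ ε q ^ 2 = q ^ 2 / (4 + r) := by
    rw [invQ, div_pow, ← hr, Real.sq_sqrt h4.le]
  have key : 8 * (1 + ε * invQ ε q ^ 2) = 4 + r := by
    rw [hx2]; field_simp; nlinarith
  rw [coordQ, key, invQ, ← hr, div_mul_cancel₀ _ (Real.sqrt_pos.2 h4).ne']

theorem hasDerivAt_coordQ (hε : 0 < ε) (x : ℝ) : HasDerivAt (coordQ ε) (dQ ε x) x := by
  have h1 : 0 < 1 + ε * x ^ 2 := by positivity
  have h := (hasDerivAt_id x).mul
    (((((hasDerivAt_id x).pow 2).const_mul ε).const_add 1).sqrt (by simpa using h1.ne'))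
  have h2 := h.const_mul (√8)
  refine (h2.congr_deriv ?_).congr_of_eventuallyEq (Eventually.of_forall fun y => ?_)
  · simp [dQ]
    have := Real.sqrt_pos.2 h1
    field_simp
    rw [Real.sq_sqrt h1.le]; ring
  · simp [coordQ]; ring

/-- `dQ` is the angular speed of the flow in the `(Q, y₂)`-plane. The bound limits the period of the
binding orbits by `2π/√8`, which is what the index of the center orbit depends on. -/
theorem sqrt_eight_le_dQ (hε : 0 < ε) (x : ℝ) : √8 ≤ dQ ε x := by
  have h1 : 0 < 1 + ε * x ^ 2 := by positivity
  rw [dQ, le_div_iff₀ (Real.sqrt_pos.2 h1)]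
  gcongr
  rw [Real.sqrt_le_left (by positivity)]
  nlinarith [mul_nonneg hε.le (sq_nonneg x), sq_nonneg (ε * x ^ 2)]

theorem dQ_pos (hε : 0 < ε) (x : ℝ) : 0 < dQ ε x :=
  lt_of_lt_of_le (by positivity) (sqrt_eight_le_dQ hε x)

theorem coordQ_strictMono (hε : 0 < ε) : StrictMono (coordQ ε) :=
  strictMono_of_deriv_pos fun x => by rw [(hasDerivAt_coordQ hε x).deriv]; exact dQ_pos hε x

theorem invQ_coordQ (hε : 0 < ε) (x : ℝ) : invQ ε (coordQ ε x) = x :=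
  (coordQ_strictMono hε).injective (coordQ_invQ hε _)

/-- Differentiate `V₂ = Q²/2`. Hamilton's equations for `(x₂, y₂)` thereby become `Q' = dQ · y₂`,
`y₂' = -dQ · Q`, a rotation of variable speed. -/
theorem coordQ_mul_dQ (hε : 0 < ε) (x : ℝ) : coordQ ε x * dQ ε x = dV₂ ε x := by
  have h1 : HasDerivAt (V₂ ε) (coordQ ε x * dQ ε x) x := by
    have h := ((hasDerivAt_coordQ hε x).pow 2).div_const 2
    refine (h.congr_deriv ?_).congr_of_eventuallyEq
      (Eventually.of_forall fun y => V₂_eq_coordQ hε y)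
    simp; ring
  exact h1.unique (hasDerivAt_V₂ ε x)

theorem contDiff_coordQ (hε : 0 < ε) : ContDiff ℝ ∞ (coordQ ε) := by
  refine contDiff_id.mul (ContDiff.sqrt (by fun_prop) fun x => ?_)
  positivity

theorem contDiff_invQ (hε : 0 < ε) : ContDiff ℝ ∞ (invQ ε) := by
  refine contDiff_id.div (ContDiff.sqrt (contDiff_const.add (ContDiff.sqrt (by fun_prop)
    fun x => ?_)) fun x => ?_) fun x => ?_ <;> positivity

theorem continuous_coordQ (hε : 0 < ε) : Continuous (coordQ ε) := (contDiff_coordQ hε).continuous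

theorem continuous_invQ (hε : 0 < ε) : Continuous (invQ ε) := (contDiff_invQ hε).continuous

theorem hasDerivAt_invQ (hε : 0 < ε) (q : ℝ) : HasDerivAt (invQ ε) (dQ ε (invQ ε q))⁻¹ q :=
  HasDerivAt.of_local_left_inverse (continuous_invQ hε).continuousAt
    (hasDerivAt_coordQ hε _) (dQ_pos hε _).ne' (Eventually.of_forall (coordQ_invQ hε))

theorem continuous_dQ (hε : 0 < ε) : Continuous (dQ ε) := by
  refine Continuous.div (by fun_prop) (by fun_prop) fun x => ?_
  positivity

/-- The energy in the normalizing coordinate. -/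
theorem starkH_eq_coordQ (hε : 0 < ε) (p : Phase) :
    starkH ε p = V₁ ε (p 0) + (coordQ ε (p 1) ^ 2 + p 2 ^ 2 + p 3 ^ 2) / 2 := by
  rw [starkH_eq, V₂_eq_coordQ hε]; ring

/-- The point with first position `x`, first momentum `y` and `(Q, y₂) = (u, v)`. -/
noncomputable def mkPhase (ε x y u v : ℝ) : Phase := !₂[x, invQ ε u, y, v]

@[simp] theorem mkPhase_zero (x y u v : ℝ) : mkPhase ε x y u v 0 = x := rfl
@[simp] theorem mkPhase_one (x y u v : ℝ) : mkPhase ε x y u v 1 = invQ ε u := rfl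
@[simp] theorem mkPhase_two (x y u v : ℝ) : mkPhase ε x y u v 2 = y := rfl
@[simp] theorem mkPhase_three (x y u v : ℝ) : mkPhase ε x y u v 3 = v := rfl

theorem mkPhase_self (hε : 0 < ε) (p : Phase) :
    mkPhase ε (p 0) (p 2) (coordQ ε (p 1)) (p 3) = p := by
  ext i; fin_cases i <;> simp [mkPhase, invQ_coordQ hε]

theorem starkH_mkPhase (hε : 0 < ε) (x y u v : ℝ) :
    starkH ε (mkPhase ε x y u v) = V₁ ε x + (u ^ 2 + y ^ 2 + v ^ 2) / 2 := by
  rw [starkH_eq_coordQ hε]; simp [coordQ_invQ hε]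

theorem ContDiffOn.mkPhase (hε : 0 < ε) {A : Type*} [NormedAddCommGroup A] [NormedSpace ℝ A]
    {x y u v : A → ℝ} {s : Set A} (hx : ContDiffOn ℝ ∞ x s) (hy : ContDiffOn ℝ ∞ y s)
    (hu : ContDiffOn ℝ ∞ u s) (hv : ContDiffOn ℝ ∞ v s) :
    ContDiffOn ℝ ∞ (fun a => mkPhase ε (x a) (y a) (u a) (v a)) s := by
  rw [contDiffOn_euclidean]
  intro i
  fin_cases i
  · exact hx
  · exact (contDiff_invQ hε).comp_contDiffOn hu
  · exact hy
  · exact hv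

theorem ContDiff.mkPhase (hε : 0 < ε) {A : Type*} [NormedAddCommGroup A] [NormedSpace ℝ A]
    {x y u v : A → ℝ} (hx : ContDiff ℝ ∞ x) (hy : ContDiff ℝ ∞ y)
    (hu : ContDiff ℝ ∞ u) (hv : ContDiff ℝ ∞ v) :
    ContDiff ℝ ∞ (fun a => mkPhase ε (x a) (y a) (u a) (v a)) := by
  rw [← contDiffOn_univ] at *
  exact ContDiffOn.mkPhase hε hx hy hu hv

theorem continuous_mkPhase (hε : 0 < ε) :
    Continuous fun q : ℝ × ℝ × ℝ × ℝ => mkPhase ε q.1 q.2.1 q.2.2.1 q.2.2.2 :=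
  (ContDiff.mkPhase hε contDiff_fst (by fun_prop) (by fun_prop) (by fun_prop)).continuous

/-! ### The saddles -/

theorem saddle_pos (hε : 0 < ε) : 0 < saddle ε := by unfold saddle; positivity

theorem saddle_sq (hε : 0 < ε) : saddle ε ^ 2 = 1 / (2 * ε) := by
  rw [saddle, inv_pow, Real.sq_sqrt (by positivity), one_div]

theorem dV₁_eq (hε : 0 < ε) (s : ℝ) : dV₁ ε s = 16 * ε * s * (saddle ε ^ 2 - s ^ 2) := by
  rw [saddle_sq hε, dV₁]; field_simp; ring

/-- Completing the square shows the maximum `1/ε` at `±a`. Consequently `E - V₁` is positive for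
every `x₁`, also beyond the saddles. -/
theorem V₁_eq (hε : 0 < ε) (s : ℝ) :
    V₁ ε s = 1 / ε - 4 * ε * (saddle ε ^ 2 - s ^ 2) ^ 2 := by
  rw [saddle_sq hε, V₁]; field_simp; ring

theorem V₁_le (hε : 0 < ε) (s : ℝ) : V₁ ε s ≤ 1 / ε := by
  rw [V₁_eq hε]; have : 0 ≤ 4 * ε * (saddle ε ^ 2 - s ^ 2) ^ 2 := by positivity
  linarith

theorem V₁_saddle (hε : 0 < ε) {s : ℝ} (hs : s ^ 2 = saddle ε ^ 2) : V₁ ε s = 1 / ε := by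
  rw [V₁_eq hε, hs]; ring

theorem mem_regionS_iff {E : ℝ} {p : Phase} :
    p ∈ regionS ε E ↔ starkH ε p = E ∧ |p 0| ≤ saddle ε := by
  have h : projX p = !₂[p 0, p 1] := rfl
  simp only [regionS, regionK, mem_ofPred_eq, potential, h]
  refine ⟨fun h => ⟨h.1, by simpa using h.2.2⟩, fun h => ⟨h.1, ?_, by simpa using h.2⟩⟩
  have := h.1
  rw [starkH_eq] at this
  simp
  nlinarith [sq_nonneg (p 2), sq_nonneg (p 3)]

end

/-! ### Periodic orbits over critical points of `V₁` -/

/-- An autonomous equation on the circle without equilibria has a periodic solution. -/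
theorem exists_circle_flow {g : ℝ → ℝ} (hg : Continuous g) {m M : ℝ} (hm : 0 < m)
    (hgm : ∀ x, m ≤ g x) (hgM : ∀ x, g x ≤ M) (hper : ∀ x, g (x + 2 * Real.pi) = g x) :
    ∃ (φ : ℝ → ℝ) (T : ℝ), 0 < T ∧ T ≤ 2 * Real.pi / m ∧ φ 0 = 0 ∧
      (∀ t, HasDerivAt φ (g (φ t)) t) ∧ (∀ t, φ (t + T) = φ t + 2 * Real.pi) ∧
      Function.Surjective φ ∧ StrictMono φ := by
  have hpos : ∀ x, 0 < g x := fun x => hm.trans_le (hgm x)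
  have hM : 0 < M := (hpos 0).trans_le (hgM 0)
  have hc : Continuous fun x => (g x)⁻¹ := hg.inv₀ fun x => (hpos x).ne'
  -- `G x` is the time needed to reach the angle `x`, so the solution is the inverse of `G`. The
  -- bounds on `g` make `G` surjective and estimate the period `G (2π)`.
  set G : ℝ → ℝ := fun x => ∫ y in (0 : ℝ)..x, (g y)⁻¹ with hG
  have hG0 : G 0 = 0 := by simp [hG]
  have hd : ∀ x, HasDerivAt G (g x)⁻¹ x := fun x => (hc.integral_hasStrictDerivAt 0 x).hasDerivAt
  have hmono : StrictMono G := strictMono_of_deriv_pos fun x => by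
    rw [(hd x).deriv]; exact inv_pos.2 (hpos x)
  have hlow : Monotone fun x => G x - x / M := by
    have h : ∀ x, HasDerivAt (fun x => G x - x / M) ((g x)⁻¹ - 1 / M) x := fun x =>
      (hd x).sub ((hasDerivAt_id x).div_const M)
    refine monotone_of_deriv_nonneg (fun x => (h x).differentiableAt) fun x => ?_
    rw [(h x).deriv, sub_nonneg, one_div]
    exact inv_anti₀ (hpos x) (hgM x)
  have hup : Antitone fun x => G x - x / m := by
    have h : ∀ x, HasDerivAt (fun x => G x - x / m) ((g x)⁻¹ - 1 / m) x := fun x =>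
      (hd x).sub ((hasDerivAt_id x).div_const m)
    refine antitone_of_deriv_nonpos (fun x => (h x).differentiableAt) fun x => ?_
    rw [(h x).deriv, sub_nonpos, one_div]
    exact inv_anti₀ hm (hgm x)
  have hsurj : Function.Surjective G := by
    refine Continuous.surjective (continuous_iff_continuousAt.2 fun x => (hd x).continuousAt) ?_ ?_
    · refine tendsto_atTop_mono' _ ?_ (tendsto_id.atTop_div_const hM)
      filter_upwards [eventually_ge_atTop 0] with x hx
      have := hlow hx
      simp [hG0] at this
      exact this
    · refine tendsto_atBot_mono' _ ?_ (tendsto_id.atBot_div_const hM)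
      filter_upwards [eventually_le_atBot 0] with x hx
      have := hlow hx
      simp [hG0] at this
      exact this
  have hshift : ∀ x, G (x + 2 * Real.pi) = G x + G (2 * Real.pi) := by
    have h : ∀ x, HasDerivAt (fun x => G (x + 2 * Real.pi) - G x) 0 x := fun x => by
      refine (((hd (x + 2 * Real.pi)).comp_add_const x _).sub (hd x)).congr_deriv ?_
      rw [hper, sub_self]
    intro x
    have := is_const_of_deriv_eq_zero (fun x => (h x).differentiableAt) (fun x => (h x).deriv) x 0
    simp [hG0] at this
    linarith
  let e := hmono.orderIsoOfSurjective G hsurj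
  have he : ∀ x, e x = G x := fun _ => rfl
  have hes : ∀ t, G (e.symm t) = t := fun t => by rw [← he, e.apply_symm_apply]
  refine ⟨e.symm, G (2 * Real.pi), ?_, ?_, ?_, fun t => ?_, fun t => ?_, e.symm.surjective,
    e.symm.strictMono⟩
  · rw [← hG0]; exact hmono (by positivity)
  · have := hup (show (0 : ℝ) ≤ 2 * Real.pi by positivity)
    simp [hG0] at this
    exact this
  · rw [e.symm_apply_eq, he, hG0]
  · have := HasDerivAt.of_local_left_inverse e.symm.toHomeomorph.continuous.continuousAt
      (hd (e.symm t)) (inv_pos.2 (hpos _)).ne' (Eventually.of_forall hes)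
    simpa using this
  · rw [e.symm_apply_eq, he, hshift, hes]

/-- A continuous argument of `cos φ + i g sin φ`, `g > 0`, obtained by correcting `φ`. -/
theorem cos_add_sin_mul_I_eq_exp {g : ℝ} (hg : 0 < g) (φ : ℝ) :
    0 < (((Real.cos φ : ℂ) + g * Real.sin φ * Complex.I) *
      Complex.exp (-(φ * Complex.I))).re := by
  -- The real part equals `cos² φ + g sin² φ`.
  rw [← neg_mul, ← Complex.ofReal_neg, Complex.exp_mul_I, ← Complex.ofReal_cos,
    ← Complex.ofReal_sin, Real.cos_neg, Real.sin_neg]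
  simp only [Complex.mul_re, Complex.add_re, Complex.add_im, Complex.ofReal_re, Complex.ofReal_im,
    Complex.mul_im, Complex.I_re, Complex.I_im]
  rcases eq_or_ne (Real.cos φ) 0 with h | h
  · have := Real.sin_sq_add_cos_sq φ
    rw [h] at this ⊢
    nlinarith
  · nlinarith [sq_nonneg (Real.sin φ), pow_pos (abs_pos.2 h) 2, sq_abs (Real.cos φ),
      mul_nonneg hg.le (sq_nonneg (Real.sin φ))]

/-- The plane `x₁ = s`, `y₁ = 0` is invariant, and on it the flow runs along the circle `Q² + y₂² =
R²` with angular speed `dQ`. There `∇H = R (0, g sin φ, 0, cos φ)`, so the transverse part of `u` is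
a positive multiple of `(cos φ + i g sin φ)(u₀ - i u₂)`. The first factor has argument `φ` plus a
periodic correction, which is why `χ` gains exactly `2π`. -/
theorem exists_orbit {ε E s : ℝ} (hε : 0 < ε) (hs : dV₁ ε s = 0) (hE : V₁ ε s < E) :
    ∃ P : PeriodicOrbit (starkH ε) E, P.trace = fiber ε E s ∧ P.T ≤ 2 * Real.pi / √8 ∧
      (∀ t, P.w t 0 = s ∧ P.w t 2 = 0) ∧
      ∃ χ N : ℝ → ℝ, Continuous χ ∧ χ P.T = χ 0 + 2 * Real.pi ∧ (∀ t, 0 < N t) ∧ N P.T = N 0 ∧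
        ∀ u t, P.transverse u t =
          N t * Complex.exp (χ t * Complex.I) * ((u t 0 : ℂ) - u t 2 * Complex.I) := by
  set R := √(2 * (E - V₁ ε s)) with hR
  have hR2 : R ^ 2 = 2 * (E - V₁ ε s) := Real.sq_sqrt (by linarith)
  have hR0 : 0 < R := Real.sqrt_pos.2 (by linarith)
  set g : ℝ → ℝ := fun φ => dQ ε (invQ ε (R * Real.sin φ)) with hgdef
  have hgc : Continuous g :=
    (continuous_dQ hε).comp ((continuous_invQ hε).comp (by fun_prop))
  have hgper : ∀ x, g (x + 2 * Real.pi) = g x := fun x => by simp [hgdef]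
  obtain ⟨M, hM⟩ : ∃ M, ∀ x, g x ≤ M := by
    obtain ⟨M, hM⟩ := (isCompact_Icc (a := (-R : ℝ)) (b := R)).bddAbove_image
      (f := fun q => dQ ε (invQ ε q)) ((continuous_dQ hε).comp (continuous_invQ hε)).continuousOn
    refine ⟨M, fun x => hM (mem_image_of_mem _ ⟨?_, ?_⟩)⟩ <;>
    nlinarith [Real.neg_one_le_sin x, Real.sin_le_one x]
  obtain ⟨φ, T, hT, hTle, hφ0, hφ, hφT, hsurj, hmono⟩ := exists_circle_flow hgc
    (m := √8) (by positivity) (fun x => sqrt_eight_le_dQ hε _) hM hgper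
  let w : ℝ → Phase := fun t => mkPhase ε s 0 (R * Real.sin (φ t)) (R * Real.cos (φ t))
  have hdV₂ : ∀ x, dV₂ ε (invQ ε (R * Real.sin x)) = R * Real.sin x * g x := fun x => by
    rw [← coordQ_mul_dQ hε, coordQ_invQ hε]
  have hgrad : ∀ t, gradient (starkH ε) (w t) =
      !₂[0, R * (g (φ t) * Real.sin (φ t)), 0, R * Real.cos (φ t)] := fun t => by
    rw [gradient_starkH]
    simp only [w, mkPhase_zero, mkPhase_one, mkPhase_two, mkPhase_three, hs, hdV₂]
    ext i; fin_cases i <;> simp; ring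
  have hwT : ∀ t, w (t + T) = w t := fun t => by simp [w, hφT]
  let P : PeriodicOrbit (starkH ε) E :=
    { w := w
      T := T
      T_pos := hT
      solution := fun t => by
        rw [hamVec_starkH, hasDerivAt_phase]
        have hsin := ((Real.hasDerivAt_sin _).comp t (hφ t)).const_mul R
        have hcos := ((Real.hasDerivAt_cos _).comp t (hφ t)).const_mul R
        intro i
        fin_cases i
        · simpa [w] using hasDerivAt_const t s
        · refine (((hasDerivAt_invQ hε _).comp t hsin).congr_deriv ?_)
          have := (dQ_pos hε (invQ ε (R * Real.sin (φ t)))).ne'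
          simp [w, hgdef]
          field_simp
        · simpa [w, hs] using hasDerivAt_const t (0 : ℝ)
        · refine hcos.congr_deriv ?_
          simp [w, hdV₂]; ring
      energy := fun t => by
        rw [starkH_mkPhase hε]
        nlinarith [Real.sin_sq_add_cos_sq (φ t)]
      periodic := hwT
      simple := fun t ht t' ht' h => by
        have h1 : R * Real.sin (φ t) = R * Real.sin (φ t') := by
          have := congrArg (fun p : Phase => coordQ ε (p 1)) h
          simpa [w, coordQ_invQ hε] using this
        have h2 : R * Real.cos (φ t) = R * Real.cos (φ t') := by
          simpa [w] using congrArg (fun p : Phase => p 3) h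
        -- On one period the angle stays in `[0, 2π)`, where sine and cosine determine it.
        have hb : ∀ r ∈ Ico 0 T, φ r ∈ Ico (0 : ℝ) (2 * Real.pi) := fun r hr => by
          refine ⟨by rw [← hφ0]; exact hmono.monotone hr.1, ?_⟩
          have := hφT 0
          rw [zero_add, hφ0, zero_add] at this
          rw [← this]; exact hmono hr.2
        have ha : (φ t : Real.Angle) = φ t' :=
          Real.Angle.cos_sin_inj (mul_left_cancel₀ hR0.ne' h2) (mul_left_cancel₀ hR0.ne' h1)
        obtain ⟨k, hk⟩ := Real.Angle.angle_eq_iff_two_pi_dvd_sub.1 ha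
        have hpi := Real.pi_pos
        have b1 := hb t ht
        have b2 := hb t' ht'
        have hk1 : (k : ℝ) < 1 := by
          by_contra! hcon
          nlinarith [b1.1, b1.2, b2.1, b2.2]
        have hk2 : (-1 : ℝ) < k := by
          by_contra! hcon
          nlinarith [b1.1, b1.2, b2.1, b2.2]
        have hk0 : k = 0 := by
          have h1 : k < 1 := by exact_mod_cast hk1
          have h2 : -1 < k := by exact_mod_cast hk2
          omega
        apply hmono.injective
        rw [hk0] at hk
        simp at hk
        linarith }
  -- `c` is the frame factor and `m` is `c` turned back by `φ`. Since `m` stays in the right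
  -- half-plane, its principal argument is continuous, and `φ + arg m` is a continuous argument of
  -- `c`.
  let c : ℝ → ℂ := fun t => (Real.cos (φ t) : ℂ) + g (φ t) * Real.sin (φ t) * Complex.I
  let m : ℝ → ℂ := fun t => c t * Complex.exp (-(φ t * Complex.I))
  have hm : ∀ t, 0 < (m t).re := fun t => cos_add_sin_mul_I_eq_exp (dQ_pos hε _) _
  have hφc : Continuous φ := continuous_iff_continuousAt.2 fun t => (hφ t).continuousAt
  have hmc : Continuous m := by
    have : Continuous fun t => g (φ t) := hgc.comp hφc
    fun_prop
  have hexp : ∀ x : ℝ, Complex.exp (-(((x + 2 * Real.pi : ℝ) : ℂ) * Complex.I)) =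
      Complex.exp (-(x * Complex.I)) := fun x => by
    push_cast
    rw [show -((x + 2 * Real.pi : ℂ) * Complex.I) = -(x * Complex.I) - 2 * Real.pi * Complex.I by
      ring, Complex.exp_sub, Complex.exp_two_pi_mul_I, div_one]
  have hmT : m T = m 0 := by
    have h0 := hφT 0
    rw [zero_add] at h0
    simp only [m, c, h0, hgper, hexp, Real.cos_add_two_pi, Real.sin_add_two_pi]
  refine ⟨P, ?_, hTle, fun t => ⟨rfl, rfl⟩, fun t => φ t + Complex.arg (m t),
    fun t => ‖gradient (starkH ε) (w t)‖⁻¹ * R * ‖m t‖, ?_, ?_, ?_, ?_, ?_⟩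
  · ext p
    constructor
    · rintro ⟨t, rfl⟩
      exact ⟨P.energy t, rfl, rfl⟩
    · rintro ⟨h1, h2, h3⟩
      rw [starkH_eq_coordQ hε, h2, h3] at h1
      set z : ℂ := ⟨p 3, coordQ ε (p 1)⟩ with hz
      have hzn : ‖z‖ = R := by
        rw [← sq_eq_sq₀ (norm_nonneg _) hR0.le, ← Complex.normSq_eq_norm_sq, hR2,
          Complex.normSq_apply]
        simp [hz]; linarith
      obtain ⟨t, ht⟩ := hsurj (Complex.arg z)
      refine ⟨t, ?_⟩
      have e1 : R * Real.cos (φ t) = p 3 := by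
        rw [ht, ← hzn, Complex.norm_mul_cos_arg]
      have e2 : R * Real.sin (φ t) = coordQ ε (p 1) := by
        rw [ht, ← hzn, Complex.norm_mul_sin_arg]
      change mkPhase ε s 0 (R * Real.sin (φ t)) (R * Real.cos (φ t)) = p
      rw [e1, e2, ← h2, ← h3, mkPhase_self hε]
  · refine hφc.add (continuous_iff_continuousAt.2 fun t => ?_)
    exact (Complex.continuousAt_arg (Or.inl (hm t))).comp hmc.continuousAt
  · change φ T + Complex.arg (m T) = φ 0 + Complex.arg (m 0) + 2 * Real.pi
    rw [hmT, ← zero_add T, hφT]; ring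
  · intro t
    have : 0 < ‖m t‖ := norm_pos_iff.2 fun h => by simpa [h] using hm t
    have h2 : 0 < ‖gradient (starkH ε) (w t)‖ := norm_pos_iff.2 fun h => by
      have h1 := congrArg (fun p : Phase => p 1) h
      have h3 := congrArg (fun p : Phase => p 3) h
      rw [hgrad] at h1 h3
      have := (dQ_pos hε (invQ ε (R * Real.sin (φ t)))).ne'
      simp [hR0.ne', hgdef, this] at h1 h3
      have := Real.sin_sq_add_cos_sq (φ t)
      rw [h1, h3] at this
      norm_num at this
    positivity
  · change ‖gradient (starkH ε) (w T)‖⁻¹ * R * ‖m T‖ = ‖gradient (starkH ε) (w 0)‖⁻¹ * R * ‖m 0‖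
    rw [hmT, ← zero_add T, hwT]
  · intro u t
    have hmarg : (‖m t‖ : ℂ) * Complex.exp (Complex.arg (m t) * Complex.I) = m t :=
      Complex.norm_mul_exp_arg_mul_I _
    have hc : Complex.exp (φ t * Complex.I) * m t = c t := by
      simp only [m]
      rw [mul_comm, mul_assoc, ← Complex.exp_add]; simp
    have key : (((‖gradient (starkH ε) (w t)‖⁻¹ * R * ‖m t‖ : ℝ) : ℂ) *
        Complex.exp (((φ t + Complex.arg (m t) : ℝ) : ℂ) * Complex.I)) =
        ((‖gradient (starkH ε) (w t)‖⁻¹ * R : ℝ) : ℂ) * c t := by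
      calc _ = ((‖gradient (starkH ε) (w t)‖⁻¹ * R : ℝ) : ℂ) * (Complex.exp (φ t * Complex.I) *
            ((‖m t‖ : ℂ) * Complex.exp (Complex.arg (m t) * Complex.I))) := by
            push_cast
            rw [add_mul, Complex.exp_add]; ring
        _ = _ := by rw [hmarg, hc]
    rw [key, PeriodicOrbit.transverse]
    change (⟨inner ℝ (j₁ (‖gradient (starkH ε) (w t)‖⁻¹ • gradient (starkH ε) (w t))) (u t),
      inner ℝ (j₂ (‖gradient (starkH ε) (w t)‖⁻¹ • gradient (starkH ε) (w t))) (u t)⟩ : ℂ) = _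
    generalize ‖gradient (starkH ε) (w t)‖⁻¹ = n
    rw [hgrad]
    apply Complex.ext <;>
      simp [PiLp.inner_apply, Fin.sum_univ_four, j₁, j₂, c, -Complex.ofReal_cos,
        -Complex.ofReal_sin] <;> ring

/-! ### The index of the binding orbits -/

theorem eq_norm_mul_exp {z : ℂ} {r θ : ℝ} (hr : 0 ≤ r) (h : z = r * Complex.exp (θ * Complex.I)) :
    z = ‖z‖ * Complex.exp (θ * Complex.I) := by
  have : ‖z‖ = r := by
    rw [h, norm_mul, Complex.norm_exp_ofReal_mul_I, Complex.norm_real, Real.norm_of_nonneg hr,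
      mul_one]
  rw [this, ← h]

/-- A continuous argument of a differentiable curve is differentiable. -/
theorem hasDerivAt_argument {z : ℝ → ℂ} {θ : ℝ → ℝ} (hθ : Continuous θ)
    (h : ∀ t, z t = ‖z t‖ * Complex.exp (θ t * Complex.I)) {z' : ℂ} {t₀ : ℝ}
    (hz : HasDerivAt z z' t₀) (h0 : z t₀ ≠ 0) : HasDerivAt θ (z' / z t₀).im t₀ := by
  -- Near `t₀` the quotient `z t / z t₀` avoids the branch cut, and `θ t - θ t₀` is the imaginary
  -- part of its logarithm.
  have hq : HasDerivAt (fun t => z t / z t₀) (z' / z t₀) t₀ := hz.div_const _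
  have hlog := hq.clog_real (by simp [div_self h0])
  have him : HasDerivAt (fun t => (Complex.log (z t / z t₀)).im) (z' / z t₀).im t₀ := by
    have := Complex.imCLM.hasFDerivAt.comp_hasDerivAt t₀ hlog
    simpa [Function.comp_def, div_self h0] using this
  refine (him.add_const (θ t₀)).congr_of_eventuallyEq ?_
  have h1 : ∀ᶠ t in 𝓝 t₀, z t ≠ 0 := hz.continuousAt.eventually_ne h0
  have h2 : ∀ᶠ t in 𝓝 t₀, θ t - θ t₀ ∈ Ioo (-Real.pi) Real.pi := by
    have : ContinuousAt (fun t => θ t - θ t₀) t₀ := by fun_prop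
    refine this.eventually_mem (isOpen_Ioo.mem_nhds ?_)
    simp [Real.pi_pos]
  filter_upwards [h1, h2] with t ht1 ht2
  have hq : z t / z t₀ = ((‖z t‖ / ‖z t₀‖ : ℝ) : ℂ) *
      (Complex.cos ((θ t - θ t₀ : ℝ) : ℂ) + Complex.sin ((θ t - θ t₀ : ℝ) : ℂ) * Complex.I) := by
    rw [← Complex.exp_mul_I]
    conv_lhs => rw [h t, h t₀]
    push_cast
    rw [sub_mul, Complex.exp_sub]
    field_simp
  rw [Complex.log_im, hq, Complex.arg_mul_cos_add_sin_mul_I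
    (div_pos (norm_pos_iff.2 ht1) (norm_pos_iff.2 h0)) ⟨ht2.1, ht2.2.le⟩]
  ring

section
variable {ε E s : ℝ} {P : PeriodicOrbit (starkH ε) E}

/-- Because `H` splits, the `x₁y₁`-part of a linearized solution satisfies a closed equation; its
coefficients are constant since `x₁ = s` along the orbit. -/
theorem linearized_hasDerivAt (hP : ∀ t, P.w t 0 = s ∧ P.w t 2 = 0) {u : ℝ → Phase}
    (hu : P.IsLinearized u) (t : ℝ) :
    HasDerivAt (fun t => u t 0) (u t 2) t ∧
      HasDerivAt (fun t => u t 2) (-((8 - 48 * ε * s ^ 2) * u t 0)) t := by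
  have h := hasDerivAt_phase.1 (hu.1 t)
  rw [fderiv_gradient_starkH, (hP t).1] at h
  exact ⟨by simpa [j₃] using h 0, by simpa [j₃] using h 2⟩

/-- Over a critical point of `H₁` the normal has no `x₁y₁`-components, so variations in these
directions are automatically tangent to the energy surface. -/
theorem isLinearized_mk (hs : dV₁ ε s = 0) (hP : ∀ t, P.w t 0 = s ∧ P.w t 2 = 0) {a b : ℝ → ℝ}
    (ha : ∀ t, HasDerivAt a (b t) t)
    (hb : ∀ t, HasDerivAt b (-((8 - 48 * ε * s ^ 2) * a t)) t) :
    P.IsLinearized fun t => !₂[a t, 0, b t, 0] := by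
  refine ⟨fun t => ?_, fun t => ?_⟩
  · rw [hasDerivAt_phase, fderiv_gradient_starkH, (hP t).1]
    intro i
    fin_cases i
    · simpa [j₃] using ha t
    · simpa [j₃] using hasDerivAt_const t (0 : ℝ)
    · simpa [j₃] using hb t
    · simpa [j₃] using hasDerivAt_const t (0 : ℝ)
  · rw [normal, gradient_starkH, (hP t).1, (hP t).2, hs]
    simp [PiLp.inner_apply, Fin.sum_univ_four]

/-- The frame of an orbit over a critical point of `V₁` makes one full turn `χ` relative to the
`x₁y₁`-coordinates. -/
def HasFrameTurn (P : PeriodicOrbit (starkH ε) E) (χ N : ℝ → ℝ) : Prop :=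
  Continuous χ ∧ χ P.T = χ 0 + 2 * Real.pi ∧ (∀ t, 0 < N t) ∧ N P.T = N 0 ∧
    ∀ u t, P.transverse u t =
      N t * Complex.exp (χ t * Complex.I) * ((u t 0 : ℂ) - u t 2 * Complex.I)

theorem transverse_ne_zero {χ N : ℝ → ℝ} (hF : HasFrameTurn P χ N) {u : ℝ → Phase} {t : ℝ} :
    P.transverse u t ≠ 0 ↔ ¬ (u t 0 = 0 ∧ u t 2 = 0) := by
  rw [hF.2.2.2.2, Ne, mul_eq_zero, mul_eq_zero, not_iff_not]
  simp only [Complex.ofReal_eq_zero, (hF.2.2.1 t).ne', Complex.exp_ne_zero, false_or]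
  simp [Complex.ext_iff]

/-! ### Saddle orbits: hyperbolicity and index two. -/

theorem hasDerivAt_exp_four (t : ℝ) :
    HasDerivAt (fun t => Real.exp (4 * t)) (4 * Real.exp (4 * t)) t := by
  have := ((hasDerivAt_id t).const_mul 4).exp
  simpa [mul_comm] using this

theorem hasDerivAt_exp_neg_four (t : ℝ) :
    HasDerivAt (fun t => Real.exp (-4 * t)) (-4 * Real.exp (-4 * t)) t := by
  have := ((hasDerivAt_id t).const_mul (-4)).exp
  simpa [mul_comm] using this

theorem saddle_linearized (hε : 0 < ε) (hs : s ^ 2 = saddle ε ^ 2)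
    (hP : ∀ t, P.w t 0 = s ∧ P.w t 2 = 0) (κ : ℝ) :
    P.IsLinearized fun t => !₂[(Real.exp (4 * t) - κ * Real.exp (-4 * t)) / 8, 0,
      (Real.exp (4 * t) + κ * Real.exp (-4 * t)) / 2, 0] := by
  -- `V₁'' = -16` at the saddles, so the equation is `a'' = 16 a` with exponents `±4`.
  have hk : 8 - 48 * ε * s ^ 2 = -16 := by
    rw [hs, saddle_sq hε]; field_simp; norm_num
  refine isLinearized_mk (by rw [dV₁_eq hε, hs]; ring) hP (fun t => ?_) (fun t => ?_)
  · refine (((hasDerivAt_exp_four t).sub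
      ((hasDerivAt_exp_neg_four t).const_mul κ)).div_const 8).congr_deriv ?_
    ring
  · refine (((hasDerivAt_exp_four t).add
      ((hasDerivAt_exp_neg_four t).const_mul κ)).div_const 2).congr_deriv ?_
    rw [hk]; ring

/-- The solution with `κ = 0` is purely expanding. The frame closes up after one period, so its
multiplier is `exp (4T)`. -/
theorem isHyperbolic_saddle (hε : 0 < ε) (hs : s ^ 2 = saddle ε ^ 2)
    (hP : ∀ t, P.w t 0 = s ∧ P.w t 2 = 0) {χ N : ℝ → ℝ} (hF : HasFrameTurn P χ N) :
    P.IsHyperbolic := by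
  refine ⟨_, saddle_linearized hε hs hP 0, ?_, Real.exp (4 * P.T), ?_, ?_⟩
  · rw [transverse_ne_zero hF]; simp
  · rw [abs_of_pos (Real.exp_pos _)]
    have := Real.one_lt_exp_iff.2 (show 0 < 4 * P.T by linarith [P.T_pos])
    exact this.ne'
  · rw [hF.2.2.2.2, hF.2.2.2.2, hF.2.1, hF.2.2.2.1]
    push_cast
    rw [add_mul, Complex.exp_add, Complex.exp_two_pi_mul_I]
    simp; ring

/-- The rotation number of the linearized solution with parameter `κ` at a saddle. -/
theorem saddle_mem_rotationSet (hε : 0 < ε) (hs : s ^ 2 = saddle ε ^ 2)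
    (hP : ∀ t, P.w t 0 = s ∧ P.w t 2 = 0) {χ N : ℝ → ℝ} (hF : HasFrameTurn P χ N) (κ : ℝ) :
    1 + (Real.arctan (-15 / 8 - 17 / 8 * κ * Real.exp (-8 * P.T)) -
      Real.arctan (-15 / 8 - 17 / 8 * κ)) / (2 * Real.pi) ∈ P.rotationSet := by
  -- Multiplying `a - i b` by `4 + i` makes its real part `4a + b = exp (4t) > 0`. The solution then
  -- stays in a half-plane and its argument is the arctangent of the slope `X`; the constant `arg (4
  -- + i)` cancels in differences.
  set X : ℝ → ℝ := fun t => -15 / 8 - 17 / 8 * κ * Real.exp (-8 * t) with hX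
  have hXc : Continuous X := by fun_prop
  refine ⟨_, fun t => χ t + Real.arctan (X t) - Complex.arg (4 + Complex.I),
    saddle_linearized hε hs hP κ, ?_, ?_, fun t => ?_, ?_⟩
  · rw [transverse_ne_zero hF]
    simp; intro h h'; linarith
  · have := Real.continuous_arctan.comp hXc
    exact (hF.1.add this).sub continuous_const
  · have h4 : (4 + Complex.I : ℂ) ≠ 0 := fun h => by simpa using congrArg Complex.im h
    have h4n : 0 < ‖(4 + Complex.I : ℂ)‖ := norm_pos_iff.2 h4
    have hE : Complex.exp (Real.arctan (X t) * Complex.I) =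
        ((√(1 + X t ^ 2))⁻¹ : ℝ) * (1 + X t * Complex.I) := by
      rw [Complex.exp_mul_I, ← Complex.ofReal_cos, ← Complex.ofReal_sin, Real.cos_arctan,
        Real.sin_arctan]
      push_cast; ring
    have hS : 0 < √(1 + X t ^ 2) := by positivity
    refine eq_norm_mul_exp (r := N t * Real.exp (4 * t) * √(1 + X t ^ 2) /
      ‖(4 + Complex.I : ℂ)‖) (by have := hF.2.2.1 t; positivity) ?_
    have harg := Complex.norm_mul_exp_arg_mul_I (4 + Complex.I)
    have hz : (4 + Complex.I) * ((((Real.exp (4 * t) - κ * Real.exp (-4 * t)) / 8 : ℝ) : ℂ) -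
        ((Real.exp (4 * t) + κ * Real.exp (-4 * t)) / 2 : ℝ) * Complex.I) =
        Real.exp (4 * t) * (1 + X t * Complex.I) := by
      have he : Real.exp (-8 * t) * Real.exp (4 * t) = Real.exp (-4 * t) := by
        rw [← Real.exp_add]; ring_nf
      apply Complex.ext
      · simp only [Complex.mul_re, Complex.add_re, Complex.sub_re, Complex.ofReal_re,
          Complex.ofReal_im, Complex.I_re, Complex.I_im, Complex.mul_im, Complex.add_im,
          Complex.sub_im, Complex.re_ofNat, Complex.im_ofNat, Complex.one_re, Complex.one_im]
        ring
      · simp only [Complex.mul_re, Complex.add_re, Complex.sub_re, Complex.ofReal_re,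
          Complex.ofReal_im, Complex.I_re, Complex.I_im, Complex.mul_im, Complex.add_im,
          Complex.sub_im, Complex.re_ofNat, Complex.im_ofNat, Complex.one_re, Complex.one_im, hX]
        linear_combination (17 / 8 * κ) * he
    rw [hF.2.2.2.2]
    apply mul_left_cancel₀ h4
    simp only [Matrix.cons_val_zero, Matrix.cons_val]
    rw [mul_left_comm, hz]
    clear_value X
    rw [Complex.ofReal_sub, Complex.ofReal_add, sub_mul, add_mul (χ t : ℂ),
      Complex.exp_sub, Complex.exp_add, hE]
    have hc : Complex.exp (Complex.arg (4 + Complex.I) * Complex.I) ≠ 0 := Complex.exp_ne_zero _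
    have hn : (‖(4 + Complex.I : ℂ)‖ : ℂ) ≠ 0 := by exact_mod_cast h4n.ne'
    have hS' : ((√(1 + X t ^ 2) : ℝ) : ℂ) ≠ 0 := by exact_mod_cast hS.ne'
    push_cast
    generalize (‖(4 + Complex.I : ℂ)‖ : ℂ) = n at *
    generalize Complex.exp (Complex.arg (4 + Complex.I) * Complex.I) = d at *
    rw [← harg]
    field_simp
  · simp only [hX, hF.2.1]
    have := Real.pi_ne_zero
    simp
    field_simp
    ring

/-- The solutions with `κ = -1` and `κ = 1` have rotation numbers below and above `1`. By continuity
in `κ` the rotation set contains an interval around `1`, and `1` stays interior under small shifts.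
-/
theorem hasIndex_two_saddle (hε : 0 < ε) (hs : s ^ 2 = saddle ε ^ 2)
    (hP : ∀ t, P.w t 0 = s ∧ P.w t 2 = 0) {χ N : ℝ → ℝ} (hF : HasFrameTurn P χ N) :
    P.HasIndex 2 := by
  set m := Real.exp (-8 * P.T) with hm
  have hm1 : m < 1 := by
    rw [hm, Real.exp_lt_one_iff]; linarith [P.T_pos]
  set ρ : ℝ → ℝ := fun κ => 1 + (Real.arctan (-15 / 8 - 17 / 8 * κ * m) -
      Real.arctan (-15 / 8 - 17 / 8 * κ)) / (2 * Real.pi) with hρ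
  have hmem : ∀ κ, ρ κ ∈ P.rotationSet := saddle_mem_rotationSet hε hs hP hF
  have hc : Continuous ρ := by
    have h1 : Continuous fun κ : ℝ => Real.arctan (-15 / 8 - 17 / 8 * κ * m) :=
      Real.continuous_arctan.comp (by fun_prop)
    have h2 : Continuous fun κ : ℝ => Real.arctan (-15 / 8 - 17 / 8 * κ) :=
      Real.continuous_arctan.comp (by fun_prop)
    exact continuous_const.add ((h1.sub h2).div_const _)
  have h2pi : 0 < 2 * Real.pi := by positivity
  have hneg : ρ (-1) < 1 := by
    have : Real.arctan (-15 / 8 - 17 / 8 * (-1) * m) < Real.arctan (-15 / 8 - 17 / 8 * (-1)) :=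
      Real.arctan_strictMono (by linarith)
    have := div_neg_of_neg_of_pos (sub_neg.2 this) h2pi
    simp only [hρ]; linarith
  have hpos : 1 < ρ 1 := by
    have : Real.arctan (-15 / 8 - 17 / 8 * 1) < Real.arctan (-15 / 8 - 17 / 8 * 1 * m) :=
      Real.arctan_strictMono (by linarith)
    have := div_pos (sub_pos.2 this) h2pi
    simp only [hρ]; linarith
  have hsub : Icc (ρ (-1)) (ρ 1) ⊆ P.rotationSet := fun x hx => by
    obtain ⟨κ, -, rfl⟩ := intermediate_value_Icc (by norm_num : (-1 : ℝ) ≤ 1) hc.continuousOn hx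
    exact hmem κ
  refine ⟨⟨_, hmem 0⟩, ?_⟩
  filter_upwards [Ioo_mem_nhdsGT (sub_pos.2 hpos)] with δ hδ
  refine Or.inr ⟨1, by norm_num, mem_interior.2
    ⟨Ioo (ρ (-1) - δ) (ρ 1 - δ), fun x hx => ?_, isOpen_Ioo, ?_⟩⟩
  · exact ⟨x + δ, hsub ⟨by linarith [hx.1], by linarith [hx.2]⟩, by simp⟩
  · simp only [Int.cast_one, mem_Ioo]
    constructor <;> linarith [hδ.1, hδ.2]

/-! ### The center orbit: index three. -/

theorem rotationSet_center_nonempty (hP : ∀ t, P.w t 0 = 0 ∧ P.w t 2 = 0) {χ N : ℝ → ℝ}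
    (hF : HasFrameTurn P χ N) : P.rotationSet.Nonempty := by
  set ν := √8 with hν
  have hν2 : ν ^ 2 = 8 := Real.sq_sqrt (by norm_num)
  have hν0 : 0 < ν := by positivity
  have hcos : ∀ t, HasDerivAt (fun t => Real.cos (ν * t)) (-(ν * Real.sin (ν * t))) t := fun t =>
    ((Real.hasDerivAt_cos _).comp t ((hasDerivAt_id t).const_mul ν)).congr_deriv (by simp; ring)
  have hsin : ∀ t, HasDerivAt (fun t => -(ν * Real.sin (ν * t))) (-(ν ^ 2 * Real.cos (ν * t))) t :=
    fun t => (((Real.hasDerivAt_sin _).comp t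
      ((hasDerivAt_id t).const_mul ν)).const_mul ν).neg.congr_deriv (by simp; ring)
  -- Here `a - i b = cos νt + i ν sin νt`, so `cos_add_sin_mul_I_eq_exp` supplies a continuous
  -- argument.
  have hlin := isLinearized_mk (by simp [dV₁]) hP hcos (fun t => (hsin t).congr_deriv (by
    rw [hν2]; ring))
  let m : ℝ → ℂ := fun t => ((Real.cos (ν * t) : ℂ) + ν * Real.sin (ν * t) * Complex.I) *
      Complex.exp (-((ν * t : ℝ) * Complex.I))
  have hm : ∀ t, 0 < (m t).re := fun t => cos_add_sin_mul_I_eq_exp hν0 _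
  have hmc : Continuous m := by fun_prop
  refine ⟨_, _, fun t => χ t + (ν * t + Complex.arg (m t)), hlin, ?_, ?_, fun t => ?_, rfl⟩
  · rw [transverse_ne_zero hF]; simp
  · refine hF.1.add ((by fun_prop : Continuous fun t => ν * t).add ?_)
    exact continuous_iff_continuousAt.2 fun t =>
      (Complex.continuousAt_arg (Or.inl (hm t))).comp hmc.continuousAt
  · refine eq_norm_mul_exp (r := N t * ‖m t‖) (by have := hF.2.2.1 t; positivity) ?_
    have hmarg : (‖m t‖ : ℂ) * Complex.exp (Complex.arg (m t) * Complex.I) = m t :=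
      Complex.norm_mul_exp_arg_mul_I _
    rw [hF.2.2.2.2]
    calc _ = N t * Complex.exp (χ t * Complex.I) *
          (Complex.exp ((ν * t : ℝ) * Complex.I) * m t) := by
          have : Complex.exp ((ν * t : ℝ) * Complex.I) * m t =
              (Real.cos (ν * t) : ℂ) + ν * Real.sin (ν * t) * Complex.I := by
            simp only [m]
            rw [mul_comm, mul_assoc, ← Complex.exp_add]; simp
          rw [this]
          simp
      _ = _ := by
          rw [← hmarg]; push_cast
          rw [add_mul, add_mul, Complex.exp_add, Complex.exp_add, ← Complex.ofReal_mul, hmarg]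
          have : (‖(‖m t‖ : ℂ) * Complex.exp (Complex.arg (m t) * Complex.I)‖ : ℝ) = ‖m t‖ := by
            rw [hmarg]
          linear_combination (-(N t * Complex.exp (χ t * Complex.I) *
            Complex.exp ((ν * t : ℝ) * Complex.I))) * hmarg

/-- The equation `a'' = -8a` makes `a - i b` turn at the rate `(8a² + b²)/(a² + b²) ≥ 1`, and every
solution completes its first turn exactly at time `2π/√8 ≥ T`. The frame contributes the additional
turn. The value `2` is not excluded; the shift by `δ` takes care of it. -/
theorem rotation_center_bounds (hP : ∀ t, P.w t 0 = 0 ∧ P.w t 2 = 0)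
    (hT : P.T ≤ 2 * Real.pi / √8) {χ N : ℝ → ℝ} (hF : HasFrameTurn P χ N) {ρ : ℝ}
    (hρ : ρ ∈ P.rotationSet) : ρ ∈ Icc (1 + P.T / (2 * Real.pi)) 2 := by
  obtain ⟨u, θ, hu, hu0, hθ, hθu, rfl⟩ := hρ
  set ν := √8 with hν
  have hν2 : ν ^ 2 = 8 := Real.sq_sqrt (by norm_num)
  have hν0 : 0 < ν := by positivity
  have hT0 := P.T_pos
  set a : ℝ → ℝ := fun t => u t 0
  set b : ℝ → ℝ := fun t => u t 2
  have ha : ∀ t, HasDerivAt a (b t) t := fun t => (linearized_hasDerivAt hP hu t).1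
  have hb : ∀ t, HasDerivAt b (-(8 * a t)) t := fun t => by
    simpa using (linearized_hasDerivAt hP hu t).2
  have hcos : ∀ t, HasDerivAt (fun t => Real.cos (ν * t)) (-(ν * Real.sin (ν * t))) t := fun t =>
    ((Real.hasDerivAt_cos _).comp t ((hasDerivAt_id t).const_mul ν)).congr_deriv (by simp; ring)
  have hsin : ∀ t, HasDerivAt (fun t => Real.sin (ν * t)) (ν * Real.cos (ν * t)) t :=
    fun t => ((Real.hasDerivAt_sin _).comp t
      ((hasDerivAt_id t).const_mul ν)).congr_deriv (by simp; ring)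
  have hconst : ∀ {f : ℝ → ℝ}, (∀ t, HasDerivAt f 0 t) → ∀ t, f t = f 0 := fun hf t =>
    is_const_of_deriv_eq_zero (fun x => (hf x).differentiableAt) (fun x => (hf x).deriv) t 0
  -- `hf1` and `hf2` undo the rotation of the oscillator and so replace a uniqueness theorem; `hK`
  -- is its energy.
  have hf1 : ∀ t, ν * a t * Real.cos (ν * t) - b t * Real.sin (ν * t) = ν * a 0 := fun t => by
    have := hconst (fun t => ((((ha t).const_mul ν).mul (hcos t)).sub
      ((hb t).mul (hsin t))).congr_deriv (by
        linear_combination (-a t * Real.sin (ν * t)) * hν2)) t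
    simpa using this
  have hf2 : ∀ t, ν * a t * Real.sin (ν * t) + b t * Real.cos (ν * t) = b 0 := fun t => by
    have := hconst (fun t => ((((ha t).const_mul ν).mul (hsin t)).add
      ((hb t).mul (hcos t))).congr_deriv (by
        linear_combination (a t * Real.cos (ν * t)) * hν2)) t
    simpa using this
  have hK : ∀ t, 8 * a t ^ 2 + b t ^ 2 = 8 * a 0 ^ 2 + b 0 ^ 2 := fun t => by
    have h1 := hf1 t
    have h2 := hf2 t
    have h3 := Real.sin_sq_add_cos_sq (ν * t)
    rw [← h2, ← hν2]
    have : ν ^ 2 * a 0 ^ 2 = (ν * a 0) ^ 2 := by ring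
    rw [this, ← h1]
    linear_combination (-(ν ^ 2 * a t ^ 2 + b t ^ 2)) * h3
  have hK0 : 0 < 8 * a 0 ^ 2 + b 0 ^ 2 := by
    rw [transverse_ne_zero hF] at hu0
    by_contra! hcon
    refine hu0 ⟨?_, ?_⟩
    · have : a 0 ^ 2 = 0 := by nlinarith [sq_nonneg (a 0), sq_nonneg (b 0)]
      exact pow_eq_zero_iff two_ne_zero |>.1 this
    · have : b 0 ^ 2 = 0 := by nlinarith [sq_nonneg (a 0), sq_nonneg (b 0)]
      exact pow_eq_zero_iff two_ne_zero |>.1 this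
  set z : ℝ → ℂ := fun t => (a t : ℂ) - b t * Complex.I with hz
  have hzn : ∀ t, Complex.normSq (z t) = a t ^ 2 + b t ^ 2 := fun t => by
    simp [hz, Complex.normSq_apply]; ring
  have hz0 : ∀ t, z t ≠ 0 := fun t h => by
    have h2 := hzn t
    rw [h, map_zero] at h2
    nlinarith [hK t, sq_nonneg (a t), sq_nonneg (b t)]
  have hzd : ∀ t, HasDerivAt z ((b t : ℂ) + 8 * a t * Complex.I) t := fun t => by
    refine ((ha t).ofReal_comp.sub ((hb t).ofReal_comp.mul_const Complex.I)).congr_deriv ?_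
    push_cast; ring
  -- Removing the turning of the frame leaves a continuous argument of `a - i b`.
  set ψ : ℝ → ℝ := fun t => θ t - χ t with hψ
  have hψc : Continuous ψ := hθ.sub hF.1
  have hzψ : ∀ t, z t = ‖z t‖ * Complex.exp (ψ t * Complex.I) := fun t => by
    have hN := hF.2.2.1 t
    refine eq_norm_mul_exp (r := ‖P.transverse u t‖ / N t) (by positivity) ?_
    have h1 := hθu t
    have h2 : P.transverse u t = N t * Complex.exp (χ t * Complex.I) * z t := hF.2.2.2.2 u t
    have hc : Complex.exp (χ t * Complex.I) ≠ 0 := Complex.exp_ne_zero _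
    have hN' : (N t : ℂ) ≠ 0 := by exact_mod_cast hN.ne'
    apply mul_left_cancel₀ (mul_ne_zero hN' hc)
    rw [← h2, show ψ t = θ t - χ t from rfl, Complex.ofReal_sub, sub_mul, Complex.exp_sub]
    conv_lhs => rw [h1]
    push_cast
    field_simp
  have hψd : ∀ t, HasDerivAt ψ (((b t : ℂ) + 8 * a t * Complex.I) / z t).im t := fun t =>
    hasDerivAt_argument hψc hzψ (hzd t) (hz0 t)
  have hψ1 : ∀ t, 1 ≤ (((b t : ℂ) + 8 * a t * Complex.I) / z t).im := fun t => by
    have hpos : 0 < Complex.normSq (z t) := Complex.normSq_pos.2 (hz0 t)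
    have : (((b t : ℂ) + 8 * a t * Complex.I) / z t).im =
        (8 * a t ^ 2 + b t ^ 2) / Complex.normSq (z t) := by
      rw [Complex.div_im]; simp [hz]; ring
    rw [this, le_div_iff₀ hpos, hzn]
    nlinarith [sq_nonneg (a t)]
  have hlow : ψ 0 + P.T ≤ ψ P.T := by
    have hmono : Monotone fun t => ψ t - t := by
      have h : ∀ t, HasDerivAt (fun t => ψ t - t) _ t := fun t => (hψd t).sub (hasDerivAt_id t)
      refine monotone_of_deriv_nonneg (fun t => (h t).differentiableAt) fun t => ?_
      rw [(h t).deriv]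
      linarith [hψ1 t]
    have := hmono hT0.le
    simp at this
    linarith
  have hup : ψ P.T ≤ ψ 0 + 2 * Real.pi := by
    -- Otherwise `z` points in its initial direction at some time `t` in `(0, T)`. Energy
    -- conservation then gives `z t = z 0`, hence `cos νt = 1`, which is impossible for `0 < νt <
    -- 2π`.
    by_contra! hcon
    have hpi := Real.pi_pos
    obtain ⟨t, ht, hψt⟩ := intermediate_value_Icc hT0.le hψc.continuousOn
      (show ψ 0 + 2 * Real.pi ∈ Icc (ψ 0) (ψ P.T) from ⟨by linarith, hcon.le⟩)
    have htT : t < P.T := lt_of_le_of_ne ht.2 fun h => by rw [← h] at hcon; linarith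
    have ht0 : 0 < t := lt_of_le_of_ne ht.1 fun h => by rw [← h] at hψt; linarith
    have hexp : Complex.exp (ψ t * Complex.I) = Complex.exp (ψ 0 * Complex.I) := by
      rw [hψt]; push_cast
      rw [add_mul, Complex.exp_add, Complex.exp_two_pi_mul_I, mul_one]
    set l := ‖z t‖ / ‖z 0‖ with hl
    have hn0 : 0 < ‖z 0‖ := norm_pos_iff.2 (hz0 0)
    have hl0 : 0 < l := div_pos (norm_pos_iff.2 (hz0 t)) hn0
    have hlz : z t = l * z 0 := by
      conv_rhs => rw [hzψ 0]
      rw [hzψ t, hexp, hl]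
      have : (‖z 0‖ : ℂ) ≠ 0 := by exact_mod_cast hn0.ne'
      push_cast
      field_simp
    have hla : a t = l * a 0 := by simpa [hz] using congrArg Complex.re hlz
    have hlb : b t = l * b 0 := by simpa [hz] using congrArg Complex.im hlz
    have hl1 : l = 1 := by
      have h1 := hK t
      rw [hla, hlb] at h1
      have h2 : (l ^ 2 - 1) * (8 * a 0 ^ 2 + b 0 ^ 2) = 0 := by linear_combination h1
      have h3 : l ^ 2 - 1 = 0 := (mul_eq_zero.1 h2).resolve_right hK0.ne'
      nlinarith
    rw [hl1, one_mul] at hla hlb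
    have hc1 : Real.cos (ν * t) = 1 := by
      have h1 := hf1 t
      have h2 := hf2 t
      rw [hla, hlb] at h1 h2
      have : (8 * a 0 ^ 2 + b 0 ^ 2) * (Real.cos (ν * t) - 1) = 0 := by
        rw [← hν2]
        linear_combination (ν * a 0) * h1 + b 0 * h2
      linarith [(mul_eq_zero.1 this).resolve_left hK0.ne']
    have hlt : ν * t < 2 * Real.pi := by
      have : t < 2 * Real.pi / ν := htT.trans_le hT
      rwa [lt_div_iff₀ hν0, mul_comm] at this
    have := (Real.cos_eq_one_iff_of_lt_of_lt (by nlinarith) hlt).1 hc1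
    exact (mul_pos hν0 ht0).ne' this
  have h2pi : 0 < 2 * Real.pi := by positivity
  have hθT : θ P.T - θ 0 = ψ P.T - ψ 0 + 2 * Real.pi := by
    simp only [hψ, hF.2.1]; ring
  rw [hθT, mem_Icc, le_div_iff₀ h2pi, div_le_iff₀ h2pi, add_mul, div_mul_cancel₀ _ h2pi.ne']
  constructor <;> linarith

theorem hasIndex_three_center (hP : ∀ t, P.w t 0 = 0 ∧ P.w t 2 = 0)
    (hT : P.T ≤ 2 * Real.pi / √8) {χ N : ℝ → ℝ} (hF : HasFrameTurn P χ N) : P.HasIndex 3 := by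
  refine ⟨rotationSet_center_nonempty hP hF, ?_⟩
  have : 0 < P.T / (2 * Real.pi) := div_pos P.T_pos (by positivity)
  filter_upwards [Ioo_mem_nhdsGT this] with δ hδ
  refine Or.inl ⟨1, by norm_num, ?_⟩
  rintro _ ⟨ρ, hρ, rfl⟩
  have h := rotation_center_bounds hP hT hF hρ
  simp only [Int.cast_one, mem_Ioo]
  constructor <;> linarith [h.1, h.2, hδ.1, hδ.2]

end

/-! ### The gradient lines of `H₁` as subsets of the `x₁y₁`-plane -/

/-- The signs attached to the two saddles. -/
def sgn (j : Fin 2) : ℝ := if j = 0 then 1 else -1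

@[simp] theorem sgn_zero : sgn 0 = 1 := rfl
@[simp] theorem sgn_one : sgn 1 = -1 := rfl

theorem sgn_mul_self (j : Fin 2) : sgn j * sgn j = 1 := by fin_cases j <;> simp

theorem sgn_sq (j : Fin 2) : sgn j ^ 2 = 1 := by rw [sq, sgn_mul_self]

theorem sgn_ne_zero (j : Fin 2) : sgn j ≠ 0 := fun h => by simpa [h] using sgn_mul_self j

/-- Saddle `j` lies at `x₁ = -sgn j * a`, so the cyclic step `j + 1` exchanges the two saddles. -/
theorem sgn_add_one (j : Fin 2) : sgn (j + 1) = -sgn j := by fin_cases j <;> simp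

theorem abs_sgn (j : Fin 2) : |sgn j| = 1 := by fin_cases j <;> simp

theorem exists_sgn_mul_pos {x : ℝ} (hx : x ≠ 0) : ∃ j, 0 < sgn j * x := by
  rcases lt_or_gt_of_ne hx with h | h
  · exact ⟨1, by simpa using h⟩
  · exact ⟨0, by simpa using h⟩

theorem eq_of_sgn_mul_pos {j k : Fin 2} {x : ℝ} (hj : 0 < sgn j * x) (hk : 0 < sgn k * x) :
    j = k := by
  fin_cases j <;> fin_cases k <;> simp at * <;> linarith

/-- The parameter of a gradient line as a function of the label `τ ∈ (0, 1)`. -/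
noncomputable def lineParam (τ : ℝ) : ℝ := Real.tan (Real.pi * (τ - 1 / 2))

theorem arctan_lineParam {τ : ℝ} (hτ : τ ∈ Ioo (0 : ℝ) 1) :
    Real.arctan (lineParam τ) = Real.pi * (τ - 1 / 2) := by
  have := Real.pi_pos
  apply Real.arctan_tan <;> nlinarith [hτ.1, hτ.2]

theorem lineParam_injective {τ τ' : Ioo (0 : ℝ) 1} (h : lineParam τ = lineParam τ') : τ = τ' := by
  have h1 := arctan_lineParam τ.2
  rw [h, arctan_lineParam τ'.2] at h1
  have := mul_left_cancel₀ Real.pi_ne_zero h1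
  exact Subtype.ext (by linarith)

/-- The inverse of `lineParam`. -/
noncomputable def lineLabel (c : ℝ) : ℝ := 1 / 2 + Real.arctan c / Real.pi

theorem lineLabel_mem (c : ℝ) : lineLabel c ∈ Ioo (0 : ℝ) 1 := by
  have := Real.pi_pos
  have h1 := Real.neg_pi_div_two_lt_arctan c
  have h2 := Real.arctan_lt_pi_div_two c
  have h3 : -(1 / 2) < Real.arctan c / Real.pi := by rw [lt_div_iff₀ this]; linarith
  have h4 : Real.arctan c / Real.pi < 1 / 2 := by rw [div_lt_iff₀ this]; linarith
  constructor <;> simp only [lineLabel] <;> linarith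

theorem lineParam_lineLabel (c : ℝ) : lineParam (lineLabel c) = c := by
  rw [lineParam, lineLabel, add_sub_cancel_left, mul_div_cancel₀ _ Real.pi_ne_zero, Real.tan_arctan]

theorem lineLabel_lineParam {τ : ℝ} (hτ : τ ∈ Ioo (0 : ℝ) 1) : lineLabel (lineParam τ) = τ := by
  rw [lineLabel, arctan_lineParam hτ, mul_div_cancel_left₀ _ Real.pi_ne_zero]; ring

/-- The coordinate `W` on `|x| < a` which linearizes the gradient flow of `V₁`. -/
noncomputable def coordW (ε x : ℝ) : ℝ := x / √(1 - 2 * ε * x ^ 2)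

/-- The inverse of `coordW`. -/
noncomputable def invW (ε w : ℝ) : ℝ := w / √(1 + 2 * ε * w ^ 2)

/-- `(x, y)` lies on the gradient line of `H₁` with label `i`. -/
def OnLine (ε : ℝ) : LeafIndex 2 → ℝ → ℝ → Prop
  -- As `x₁' = y₁`, the choice `b = 0` is the half-line on which the flow moves into `|x₁| ≤ a`.
  | .rigid j b, x, y => x = -sgn j * saddle ε ∧ 0 < sgn (j + b) * y
  | .cylinder j, x, y => y = 0 ∧ 0 < -sgn j * x ∧ |x| < saddle ε
  -- The exponent `8` is the ratio of the growth rates of `W` and `y₁`; the factor `sgn j` makes `τ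
  -- → 0` tend to saddle `j` and `τ → 1` to the other one.
  | .plane j τ, x, y => |x| < saddle ε ∧ 0 < sgn j * y ∧ coordW ε x = sgn j * lineParam τ * y ^ 8

/-- The part of the energy surface over a gradient line. -/
def leafSet (ε E : ℝ) (i : LeafIndex 2) : Set Phase :=
  {p | starkH ε p = E ∧ OnLine ε i (p 0) (p 2)}

section
variable {ε : ℝ}

theorem one_sub_pos (hε : 0 < ε) {x : ℝ} (hx : |x| < saddle ε) : 0 < 1 - 2 * ε * x ^ 2 := by
  have h := sq_lt_sq' (abs_lt.1 hx).1 (abs_lt.1 hx).2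
  rw [saddle_sq hε, lt_div_iff₀ (by positivity)] at h
  linarith

theorem abs_invW_lt (hε : 0 < ε) (w : ℝ) : |invW ε w| < saddle ε := by
  have h1 : 0 < 1 + 2 * ε * w ^ 2 := by positivity
  apply abs_lt_of_sq_lt_sq _ (saddle_pos hε).le
  rw [invW, div_pow, Real.sq_sqrt h1.le, saddle_sq hε, div_lt_div_iff₀ h1 (by positivity)]
  linarith

theorem coordW_invW (hε : 0 < ε) (w : ℝ) : coordW ε (invW ε w) = w := by
  have h1 : 0 < 1 + 2 * ε * w ^ 2 := by positivity
  have : 1 - 2 * ε * invW ε w ^ 2 = (1 + 2 * ε * w ^ 2)⁻¹ := by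
    rw [invW, div_pow, Real.sq_sqrt h1.le]; field_simp; ring
  rw [coordW, this, Real.sqrt_inv, invW]
  have := Real.sqrt_pos.2 h1
  field_simp

theorem invW_coordW (hε : 0 < ε) {x : ℝ} (hx : |x| < saddle ε) : invW ε (coordW ε x) = x := by
  have h1 := one_sub_pos hε hx
  have : 1 + 2 * ε * coordW ε x ^ 2 = (1 - 2 * ε * x ^ 2)⁻¹ := by
    rw [coordW, div_pow, Real.sq_sqrt h1.le]; field_simp; ring
  rw [invW, this, Real.sqrt_inv, coordW, div_inv_eq_mul, div_mul_cancel₀ _ (Real.sqrt_pos.2 h1).ne']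

theorem contDiff_invW (hε : 0 < ε) : ContDiff ℝ ∞ (invW ε) := by
  refine contDiff_id.div (ContDiff.sqrt (by fun_prop) fun x => ?_) fun x => ?_ <;> positivity

theorem hasDerivAt_coordW (hε : 0 < ε) {x : ℝ} (hx : |x| < saddle ε) :
    HasDerivAt (coordW ε) ((√(1 - 2 * ε * x ^ 2) ^ 3)⁻¹) x := by
  have h1 := one_sub_pos hε hx
  have hs := Real.sqrt_pos.2 h1
  have h := (hasDerivAt_id x).div
    (((((hasDerivAt_id x).pow 2).const_mul (2 * ε)).const_sub 1).sqrt (by simpa using h1.ne'))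
    (by simpa using hs.ne')
  refine h.congr_deriv ?_
  simp
  have h2 := Real.sq_sqrt h1.le
  field_simp
  rw [h2]; ring

theorem contDiffAt_coordW (hε : 0 < ε) {x : ℝ} (hx : |x| < saddle ε) :
    ContDiffAt ℝ ∞ (coordW ε) x := by
  have h1 := one_sub_pos hε hx
  exact contDiffAt_id.div (ContDiffAt.sqrt (by fun_prop) h1.ne') (Real.sqrt_pos.2 h1).ne'

theorem inv_sq_sub_pos (hε : 0 < ε) {x : ℝ} (hx : |x| < saddle ε) (hx0 : x ≠ 0) :
    0 < (x ^ 2)⁻¹ - 2 * ε := by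
  have h1 := one_sub_pos hε hx
  have hx2 : 0 < x ^ 2 := by positivity
  have : (x ^ 2)⁻¹ - 2 * ε = (1 - 2 * ε * x ^ 2) / x ^ 2 := by field_simp
  rw [this]; positivity

/-- The left side continues `W⁻²` smoothly across `x = ±a`, where `W` blows up; the charts near
rigid planes and cylinders rest on it. -/
theorem inv_sq_sub_eq (hε : 0 < ε) {x : ℝ} (hx : |x| < saddle ε) (hx0 : x ≠ 0) :
    (x ^ 2)⁻¹ - 2 * ε = (coordW ε x ^ 2)⁻¹ := by
  have h1 := one_sub_pos hε hx
  rw [coordW, div_pow, Real.sq_sqrt h1.le]; field_simp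

theorem coordW_mul_self_pos (hε : 0 < ε) {x : ℝ} (hx : |x| < saddle ε) {s : ℝ} :
    0 < s * coordW ε x ↔ 0 < s * x := by
  have := Real.sqrt_pos.2 (one_sub_pos hε hx)
  rw [coordW, ← mul_div_assoc, div_pos_iff_of_pos_right this]

theorem OnLine.abs_le (hε : 0 < ε) {i : LeafIndex 2} {x y : ℝ} (h : OnLine ε i x y) :
    |x| ≤ saddle ε := by
  match i, h with
  | .rigid j b, h => rw [h.1, abs_mul, abs_neg, abs_sgn, one_mul, abs_of_pos (saddle_pos hε)]
  | .cylinder j, h => exact h.2.2.le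
  | .plane j τ, h => exact h.1.le

theorem abs_sgn_mul_saddle (hε : 0 < ε) (j : Fin 2) : |(-sgn j * saddle ε)| = saddle ε := by
  rw [abs_mul, abs_neg, abs_sgn, one_mul, abs_of_pos (saddle_pos hε)]

theorem OnLine.not_binding {i : LeafIndex 2} {x y : ℝ} (h : OnLine ε i x y) :
    ¬ (y = 0 ∧ (x = 0 ∨ |x| = saddle ε)) := by
  rintro ⟨rfl, h2⟩
  match i, h with
  | .rigid j b, h => simpa using h.2
  | .cylinder j, h =>
    rcases h2 with rfl | h2
    · simpa using h.2.1
    · exact h.2.2.ne h2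
  | .plane j τ, h => simpa using h.2.1

theorem exists_onLine (hε : 0 < ε) {x y : ℝ} (hx : |x| ≤ saddle ε)
    (h : ¬ (y = 0 ∧ (x = 0 ∨ |x| = saddle ε))) : ∃ i, OnLine ε i x y := by
  rcases eq_or_ne y 0 with rfl | hy
  · have hx0 : x ≠ 0 := fun h' => h ⟨rfl, Or.inl h'⟩
    have hxa : |x| < saddle ε := lt_of_le_of_ne hx fun h' => h ⟨rfl, Or.inr h'⟩
    obtain ⟨j, hj⟩ := exists_sgn_mul_pos (neg_ne_zero.2 hx0)
    exact ⟨.cylinder j, rfl, by linarith, hxa⟩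
  · obtain ⟨j, hj⟩ := exists_sgn_mul_pos hy
    rcases hx.lt_or_eq with hxa | hxa
    · refine ⟨.plane j ⟨_, lineLabel_mem (sgn j * coordW ε x / y ^ 8)⟩, hxa, hj, ?_⟩
      rw [lineParam_lineLabel]
      have := sgn_mul_self j
      field_simp
      linear_combination (-coordW ε x) * this
    · have ha := saddle_pos hε
      obtain ⟨k, hk⟩ : ∃ k, x = -sgn k * saddle ε := by
        rcases (abs_eq ha.le).1 hxa with h | h
        · exact ⟨1, by simp [h]⟩
        · exact ⟨0, by simp [h]⟩
      exact ⟨.rigid k (j - k), hk, by rw [add_sub_cancel]; exact hj⟩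

/-! ### Foliation charts -/

theorem fderiv_mul_coord {A B : ℝ → ℝ} {A' B' : ℝ} {q : Phase} (hA : HasDerivAt A A' (q 0))
    (hB : HasDerivAt B B' (q 2)) (v : Phase) :
    fderiv ℝ (fun p : Phase => A (p 0) * B (p 2)) q v =
      A' * v 0 * B (q 2) + A (q 0) * (B' * v 2) := by
  have h1 := hA.comp_hasFDerivAt q (hasFDerivAt_coord 0 q)
  have h2 := hB.comp_hasFDerivAt q (hasFDerivAt_coord 2 q)
  have h := (h1.mul h2).fderiv
  have h' : fderiv ℝ (fun p : Phase => A (p 0) * B (p 2)) q = _ := h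
  rw [h']
  simp; ring

/-- A function `g` on the open set `O` whose level sets are the leaves meeting `O` and whose
derivative along the Hamiltonian flow does not vanish. -/
def IsLeafChart (ε E : ℝ) (O : Set Phase) (g : Phase → ℝ) : Prop :=
  IsOpen O ∧ ContDiffOn ℝ ∞ g O ∧ (∀ q ∈ O, fderiv ℝ g q (hamVec (starkH ε) q) ≠ 0) ∧
    ∀ i i' q q', q ∈ O ∩ leafSet ε E i → q' ∈ O ∩ leafSet ε E i' → (i = i' ↔ g q = g q')

/-- `R i v` stands for "leaf `i` has the value `v` in this chart"; it suffices that labels and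
values determine each other. -/
theorem isLeafChart_of_value {E : ℝ} {O : Set Phase} {g : Phase → ℝ} (hO : IsOpen O)
    (hg : ContDiffOn ℝ ∞ g O) (hX : ∀ q ∈ O, fderiv ℝ g q (hamVec (starkH ε) q) ≠ 0)
    (R : LeafIndex 2 → ℝ → Prop) (hR : ∀ i q, q ∈ O ∩ leafSet ε E i → R i (g q))
    (hR1 : ∀ i v v', R i v → R i v' → v = v') (hR2 : ∀ i i' v, R i v → R i' v → i = i') :
    IsLeafChart ε E O g := by
  refine ⟨hO, hg, hX, fun i i' q q' hq hq' => ⟨?_, fun h => ?_⟩⟩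
  · rintro rfl
    exact hR1 _ _ _ (hR _ _ hq) (hR _ _ hq')
  · exact hR2 _ _ (g q) (hR _ _ hq) (h ▸ hR _ _ hq')

theorem continuous_coord (i : Fin 4) : Continuous fun p : Phase => p i := by fun_prop

theorem contDiff_coord (i : Fin 4) : ContDiff ℝ ∞ fun p : Phase => p i := by fun_prop

/-- The union of the planes on one side of `{y₁ = 0}` and the function labelling them. -/
theorem isLeafChart_planes (hε : 0 < ε) (E : ℝ) (j : Fin 2) :
    IsLeafChart ε E {p | |p 0| < saddle ε ∧ 0 < sgn j * p 2}
      (fun p => coordW ε (p 0) * (p 2 ^ 8)⁻¹) := by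
  have hy0 : ∀ {q : Phase}, 0 < sgn j * q 2 → q 2 ≠ 0 := fun h h' => by simp [h'] at h
  refine isLeafChart_of_value ?_ ?_ ?_
    (fun i v => ∃ τ, i = .plane j τ ∧ v = sgn j * lineParam τ) ?_ ?_ ?_
  · exact (isOpen_lt (continuous_coord 0).abs continuous_const).inter
      (isOpen_lt continuous_const (continuous_const.mul (continuous_coord 2)))
  · intro q hq
    refine ContDiffAt.contDiffWithinAt (ContDiffAt.mul ?_ (ContDiffAt.inv ?_ ?_))
    · exact (contDiffAt_coordW hε hq.1).comp q (contDiff_coord 0).contDiffAt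
    · exact ((contDiff_coord 2).pow 8).contDiffAt
    · exact pow_ne_zero _ (hy0 hq.2)
  · intro q hq
    have hy := hy0 hq.2
    have h1 := one_sub_pos hε hq.1
    have hs := Real.sqrt_pos.2 h1
    have h2 := Real.sq_sqrt h1.le
    have hB : HasDerivAt (fun y : ℝ => (y ^ 8)⁻¹) (-(8 * q 2 ^ 7) / (q 2 ^ 8) ^ 2) (q 2) := by
      exact ((hasDerivAt_pow 8 (q 2)).inv (pow_ne_zero 8 hy)).congr_deriv (by simp)
    rw [fderiv_mul_coord (hasDerivAt_coordW hε hq.1) hB, hamVec_starkH]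
    set r := √(1 - 2 * ε * q 0 ^ 2) with hr
    have hd : dV₁ ε (q 0) = 8 * q 0 * r ^ 2 := by rw [h2, dV₁]; ring
    have hW : coordW ε (q 0) = q 0 / r := rfl
    -- This is `|∇H₁|²/r³`: the label is constant along `∇H₁`, and the projected flow is the quarter
    -- turn of `∇H₁`. The same factor `|∇H₁|²` appears in the other two charts.
    have hpos : 0 < q 2 ^ 2 / r ^ 3 + 64 * q 0 ^ 2 * r := by
      have : 0 < q 2 ^ 2 := by positivity
      positivity
    have : (r ^ 3)⁻¹ * (!₂[q 2, q 3, -dV₁ ε (q 0), -dV₂ ε (q 1)] : Phase) 0 * (q 2 ^ 8)⁻¹ +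
        coordW ε (q 0) * (-(8 * q 2 ^ 7) / (q 2 ^ 8) ^ 2 *
          (!₂[q 2, q 3, -dV₁ ε (q 0), -dV₂ ε (q 1)] : Phase) 2) =
        (q 2 ^ 2 / r ^ 3 + 64 * q 0 ^ 2 * r) / q 2 ^ 9 := by
      simp [hd, hW]
      field_simp
      ring
    rw [this]
    exact div_ne_zero hpos.ne' (pow_ne_zero _ hy)
  · rintro i q ⟨hq, -, h⟩
    match i, h with
    | .rigid k b, h =>
      have := hq.1
      rw [h.1, abs_sgn_mul_saddle hε] at this
      exact absurd this (lt_irrefl _)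
    | .cylinder k, h => exact absurd h.1 (hy0 hq.2)
    | .plane k τ, h =>
      obtain rfl := eq_of_sgn_mul_pos h.2.1 hq.2
      refine ⟨τ, rfl, ?_⟩
      simp only [h.2.2]
      have := hy0 hq.2
      field_simp
  · rintro i v v' ⟨τ, rfl, rfl⟩ ⟨τ', h, rfl⟩
    cases h; rfl
  · rintro i i' v ⟨τ, rfl, rfl⟩ ⟨τ', rfl, h⟩
    rw [lineParam_injective (mul_left_cancel₀ (sgn_ne_zero j) h)]

/-- A chart near a rigid plane. -/
theorem isLeafChart_rigid (hε : 0 < ε) (E : ℝ) (k j : Fin 2) :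
    IsLeafChart ε E {p | 0 < -sgn k * p 0 ∧ 0 < sgn j * p 2}
      (fun p => ((p 0 ^ 2)⁻¹ - 2 * ε) * p 2 ^ 16) := by
  have hy0 : ∀ {q : Phase}, 0 < sgn j * q 2 → q 2 ≠ 0 := fun h h' => by simp [h'] at h
  have hx0 : ∀ {q : Phase}, 0 < -sgn k * q 0 → q 0 ≠ 0 := fun h h' => by simp [h'] at h
  -- The label is `W⁻² y₁¹⁶ = C⁻²`, which vanishes on the rigid plane. Only the sign of `C` is lost,
  -- and the signs of `x₁` and `y₁` on the chart fix it.
  refine isLeafChart_of_value ?_ ?_ ?_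
    (fun i v => (i = .rigid k (j - k) ∧ v = 0) ∨ ∃ τ, i = .plane j τ ∧
      0 < (-sgn k * sgn j) * lineParam τ ∧ v = (lineParam τ ^ 2)⁻¹) ?_ ?_ ?_
  · exact (isOpen_lt continuous_const (continuous_const.mul (continuous_coord 0))).inter
      (isOpen_lt continuous_const (continuous_const.mul (continuous_coord 2)))
  · intro q hq
    refine ContDiffAt.contDiffWithinAt (ContDiffAt.mul ((ContDiffAt.inv ?_ ?_).sub contDiffAt_const)
      ((contDiff_coord 2).pow 16).contDiffAt)
    · exact ((contDiff_coord 0).pow 2).contDiffAt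
    · exact pow_ne_zero _ (hx0 hq.1)
  · intro q hq
    have hy := hy0 hq.2
    have hx := hx0 hq.1
    have hA : HasDerivAt (fun x : ℝ => (x ^ 2)⁻¹ - 2 * ε) (-(2 * q 0) / (q 0 ^ 2) ^ 2) (q 0) := by
      simpa using ((hasDerivAt_pow 2 (q 0)).inv (pow_ne_zero 2 hx)).sub_const (2 * ε)
    have hB : HasDerivAt (fun y : ℝ => y ^ 16) (16 * q 2 ^ 15) (q 2) := by
      simpa using hasDerivAt_pow 16 (q 2)
    rw [fderiv_mul_coord hA hB, hamVec_starkH]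
    set K := (q 0 ^ 2)⁻¹ - 2 * ε with hK
    have hd : dV₁ ε (q 0) = 8 * q 0 ^ 3 * K := by rw [hK, dV₁]; field_simp; ring
    have hpos : 0 < q 2 ^ 2 + 64 * q 0 ^ 6 * K ^ 2 := by
      have h1 : 0 < q 2 ^ 2 := by positivity
      have h2 : 0 ≤ q 0 ^ 6 := by positivity
      positivity
    have : -(2 * q 0) / (q 0 ^ 2) ^ 2 * (!₂[q 2, q 3, -dV₁ ε (q 0), -dV₂ ε (q 1)] : Phase) 0 *
        q 2 ^ 16 + K * (16 * q 2 ^ 15 *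
          (!₂[q 2, q 3, -dV₁ ε (q 0), -dV₂ ε (q 1)] : Phase) 2) =
        -2 * q 2 ^ 15 / q 0 ^ 3 * (q 2 ^ 2 + 64 * q 0 ^ 6 * K ^ 2) := by
      simp [hd]
      clear_value K
      field_simp
      ring
    rw [this]
    exact mul_ne_zero (div_ne_zero (mul_ne_zero (by norm_num) (pow_ne_zero _ hy))
      (pow_ne_zero _ hx)) hpos.ne'
  · rintro i q ⟨hq, -, h⟩
    match i, h with
    | .rigid k' b, h =>
      left
      have h1 : q 0 * -1 = sgn k' * saddle ε := by rw [h.1]; ring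
      have hk : k' = k := by
        apply eq_of_sgn_mul_pos (x := -q 0) _ (by linarith [hq.1])
        have : sgn k' * -q 0 = saddle ε := by
          linear_combination sgn k' * h1 + saddle ε * sgn_mul_self k'
        rw [this]; exact saddle_pos hε
      subst hk
      have hb := eq_of_sgn_mul_pos h.2 hq.2
      refine ⟨by rw [← hb, add_sub_cancel_left], ?_⟩
      simp only [h.1, mul_pow, neg_sq, sgn_sq, saddle_sq hε]
      field_simp; ring
    | .cylinder k, h => exact absurd h.1 (hy0 hq.2)
    | .plane j' τ, h =>
      obtain rfl := eq_of_sgn_mul_pos h.2.1 hq.2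
      have hy : 0 < q 2 ^ 8 := by have := hy0 hq.2; positivity
      refine Or.inr ⟨τ, rfl, ?_, ?_⟩
      · have := (coordW_mul_self_pos hε h.1).2 hq.1
        rw [h.2.2, ← mul_assoc, ← mul_assoc] at this
        exact pos_of_mul_pos_left this hy.le
      · simp only []
        rw [inv_sq_sub_eq hε h.1 (hx0 hq.1), h.2.2, mul_pow, mul_pow, sgn_sq, one_mul, mul_inv]
        have := hy0 hq.2
        field_simp
  · rintro i v v' (⟨rfl, rfl⟩ | ⟨τ, rfl, -, rfl⟩) (⟨h, rfl⟩ | ⟨τ', h, -, rfl⟩) <;> cases h <;> rfl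
  · rintro i i' v (⟨rfl, rfl⟩ | ⟨τ, rfl, h, rfl⟩) (⟨rfl, h'⟩ | ⟨τ', rfl, h', hv⟩)
    · rfl
    · have : lineParam τ' ≠ 0 := fun h => by simp [h] at h'
      exact absurd hv.symm (by positivity)
    · have : lineParam τ ≠ 0 := fun h' => by simp [h'] at h
      exact absurd h' (by positivity)
    · rcases sq_eq_sq_iff_eq_or_eq_neg.1 (inv_injective hv) with h1 | h1
      · rw [lineParam_injective h1]
      · rw [h1] at h; linarith

/-- A chart near a rigid cylinder. -/
theorem isLeafChart_cylinder (hε : 0 < ε) (E : ℝ) (k : Fin 2) :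
    IsLeafChart ε E {p | 0 < -sgn k * p 0 ∧ |p 0| < saddle ε}
      (fun p => ((p 0 ^ 2)⁻¹ - 2 * ε) ^ (1 / 16 : ℝ) * p 2) := by
  have hx0 : ∀ {q : Phase}, 0 < -sgn k * q 0 → q 0 ≠ 0 := fun h h' => by simp [h'] at h
  -- The label `|W|^(-1/8) y₁` is a signed sixteenth root of the one near rigid planes. It is linear
  -- in `y₁`, hence regular along `y₁ = 0`, and its sign tells the two families of planes apart.
  refine isLeafChart_of_value ?_ ?_ ?_
    (fun i v => (i = .cylinder k ∧ v = 0) ∨ ∃ j τ, i = .plane j τ ∧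
      0 < (-sgn k * sgn j) * lineParam τ ∧
      v = sgn j * ((lineParam τ ^ 2)⁻¹) ^ (1 / 16 : ℝ)) ?_ ?_ ?_
  · exact (isOpen_lt continuous_const (continuous_const.mul (continuous_coord 0))).inter
      (isOpen_lt (continuous_coord 0).abs continuous_const)
  · intro q hq
    refine ContDiffAt.contDiffWithinAt (ContDiffAt.mul (ContDiffAt.rpow_const_of_ne
      ((ContDiffAt.inv ?_ ?_).sub contDiffAt_const) (inv_sq_sub_pos hε hq.2 (hx0 hq.1)).ne')
      (contDiff_coord 2).contDiffAt)
    · exact ((contDiff_coord 0).pow 2).contDiffAt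
    · exact pow_ne_zero _ (hx0 hq.1)
  · intro q hq
    have hx := hx0 hq.1
    have hKpos := inv_sq_sub_pos hε hq.2 hx
    have hA := (((hasDerivAt_pow 2 (q 0)).inv (pow_ne_zero 2 hx)).sub_const (2 * ε)).rpow_const
      (p := 1 / 16) (Or.inl hKpos.ne')
    have h := fderiv_mul_coord hA (hasDerivAt_id (q 2)) (hamVec (starkH ε) q)
    simp only [id, Pi.inv_apply] at h
    rw [h, hamVec_starkH]
    set K := (q 0 ^ 2)⁻¹ - 2 * ε with hK
    have hd : dV₁ ε (q 0) = 8 * q 0 ^ 3 * K := by rw [hK, dV₁]; field_simp; ring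
    have hpos : 0 < q 2 ^ 2 + 64 * q 0 ^ 6 * K ^ 2 := by
      have h1 : 0 ≤ q 2 ^ 2 := by positivity
      have h2 : 0 < q 0 ^ 6 := by positivity
      positivity
    have hKr : 0 < K ^ (1 / 16 : ℝ) := Real.rpow_pos_of_pos hKpos _
    rw [Real.rpow_sub hKpos, Real.rpow_one, hd]
    simp only [Matrix.cons_val_zero, Matrix.cons_val]
    generalize K ^ (1 / 16 : ℝ) = r at *
    clear_value K
    have : ∀ e : ℝ, e = -(r / (8 * q 0 ^ 3 * K)) * (q 2 ^ 2 + 64 * q 0 ^ 6 * K ^ 2) → e ≠ 0 := by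
      rintro e rfl
      exact mul_ne_zero (neg_ne_zero.2 (by positivity)) hpos.ne'
    apply this
    simp
    field_simp
    ring
  · rintro i q ⟨hq, -, h⟩
    match i, h with
    | .rigid k' b, h =>
      have := hq.2
      rw [h.1, abs_sgn_mul_saddle hε] at this
      exact absurd this (lt_irrefl _)
    | .cylinder k', h =>
      left
      refine ⟨?_, by simp [h.1]⟩
      rw [eq_of_sgn_mul_pos (j := k') (k := k) (x := -q 0) (by linarith [h.2.1])
        (by linarith [hq.1])]
    | .plane j τ, h =>
      have hy0 : q 2 ≠ 0 := fun h' => by simpa [h'] using h.2.1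
      have hy : 0 < q 2 ^ 8 := by positivity
      refine Or.inr ⟨j, τ, rfl, ?_, ?_⟩
      · have := (coordW_mul_self_pos hε h.1).2 hq.1
        rw [h.2.2, ← mul_assoc, ← mul_assoc] at this
        exact pos_of_mul_pos_left this hy.le
      · simp only []
        rw [inv_sq_sub_eq hε h.1 (hx0 hq.1), h.2.2, mul_pow, mul_pow, sgn_sq, one_mul, mul_inv,
          Real.mul_rpow (by positivity) (by positivity),
          show (q 2 ^ 8) ^ 2 = (sgn j * q 2) ^ 16 by
            rw [mul_pow, show sgn j ^ 16 = (sgn j ^ 2) ^ 8 by ring, sgn_sq]; ring,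
          Real.inv_rpow (by positivity), show (1 / 16 : ℝ) = ((16 : ℕ) : ℝ)⁻¹ by norm_num,
          Real.inv_rpow (by positivity), Real.pow_rpow_inv_natCast h.2.1.le (by norm_num)]
        rw [mul_inv, inv_eq_of_mul_eq_one_left (sgn_mul_self j)]
        field_simp
  · rintro i v v' (⟨rfl, rfl⟩ | ⟨j, τ, rfl, -, rfl⟩) (⟨h, rfl⟩ | ⟨j', τ', h, -, rfl⟩) <;>
      cases h <;> rfl
  · have hp : ∀ {a l : ℝ}, 0 < a * l → 0 < ((l ^ 2)⁻¹) ^ (1 / 16 : ℝ) := fun {a l} h => by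
      have : l ≠ 0 := fun h' => by simp [h'] at h
      positivity
    rintro i i' v (⟨rfl, rfl⟩ | ⟨j, τ, rfl, h, rfl⟩) (⟨rfl, h'⟩ | ⟨j', τ', rfl, h', hv⟩)
    · rfl
    · exact absurd hv.symm (mul_ne_zero (sgn_ne_zero _) (hp h').ne')
    · exact absurd h' (mul_ne_zero (sgn_ne_zero _) (hp h).ne')
    · obtain rfl : j = j' := by
        refine eq_of_sgn_mul_pos (x := sgn j * ((lineParam τ ^ 2)⁻¹) ^ (1 / 16 : ℝ)) ?_ ?_
        · rw [← mul_assoc, sgn_mul_self, one_mul]; exact hp h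
        · rw [hv, ← mul_assoc, sgn_mul_self, one_mul]; exact hp h'
      have h2 := mul_left_cancel₀ (sgn_ne_zero j) hv
      have h3 := (Real.rpow_left_inj (by positivity) (by positivity) (by norm_num)).1 h2
      rcases sq_eq_sq_iff_eq_or_eq_neg.1 (inv_injective h3) with h1 | h1
      · rw [lineParam_injective h1]
      · rw [h1] at h; linarith

theorem exists_leafChart (hε : 0 < ε) (E : ℝ) {p : Phase} (hp : |p 0| ≤ saddle ε)
    (h : ¬ (p 2 = 0 ∧ (p 0 = 0 ∨ |p 0| = saddle ε))) :
    ∃ O g, IsLeafChart ε E O g ∧ p ∈ O := by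
  rcases eq_or_ne (p 2) 0 with hy | hy
  · have hx0 : p 0 ≠ 0 := fun h' => h ⟨hy, Or.inl h'⟩
    have hxa : |p 0| < saddle ε := lt_of_le_of_ne hp fun h' => h ⟨hy, Or.inr h'⟩
    obtain ⟨k, hk⟩ := exists_sgn_mul_pos (neg_ne_zero.2 hx0)
    exact ⟨_, _, isLeafChart_cylinder hε E k, by linarith, hxa⟩
  · obtain ⟨j, hj⟩ := exists_sgn_mul_pos hy
    rcases hp.lt_or_eq with hxa | hxa
    · exact ⟨_, _, isLeafChart_planes hε E j, hxa, hj⟩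
    · have hx0 : p 0 ≠ 0 := fun h' => by
        rw [h', abs_zero] at hxa
        exact (saddle_pos hε).ne hxa
      obtain ⟨k, hk⟩ := exists_sgn_mul_pos (neg_ne_zero.2 hx0)
      exact ⟨_, _, isLeafChart_rigid hε E k j, by linarith, hj⟩

/-- Distinct gradient lines are disjoint. -/
theorem OnLine.unique (hε : 0 < ε) {i i' : LeafIndex 2} {x y : ℝ} (h : OnLine ε i x y)
    (h' : OnLine ε i' x y) : i = i' := by
  -- Any lift of `(x, y)` will do, on its own energy level: the charts exist for all energies.
  set p := mkPhase ε x y 0 0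
  obtain ⟨O, g, hg, hp⟩ := exists_leafChart hε (starkH ε p) (p := p) (OnLine.abs_le hε h)
    (OnLine.not_binding h)
  exact (hg.2.2.2 i i' p p ⟨hp, rfl, h⟩ ⟨hp, rfl, h'⟩).2 rfl

end

/-! ### Smooth embeddings and asymptotic ends -/

theorem injective_fderiv_of_leftInverse {A B : Type*} [NormedAddCommGroup A] [NormedSpace ℝ A]
    [NormedAddCommGroup B] [NormedSpace ℝ B] {f : A → B} {G : B → A} {z : A}
    (hf : DifferentiableAt ℝ f z) (hG : DifferentiableAt ℝ G (f z))
    (hGf : ∀ᶠ w in 𝓝 z, G (f w) = w) : Function.Injective (fderiv ℝ f z) := by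
  have h1 : HasFDerivAt (G ∘ f) ((fderiv ℝ G (f z)).comp (fderiv ℝ f z)) z :=
    hG.hasFDerivAt.comp z hf.hasFDerivAt
  have h2 : HasFDerivAt (G ∘ f) (ContinuousLinearMap.id ℝ A) z :=
    (hasFDerivAt_id z).congr_of_eventuallyEq hGf
  have h3 := h1.unique h2
  intro v w hvw
  have hv := congrArg (fun L : A →L[ℝ] A => L v) h3
  have hw := congrArg (fun L : A →L[ℝ] A => L w) h3
  simp only [ContinuousLinearMap.comp_apply, ContinuousLinearMap.id_apply] at hv hw
  rw [← hv, ← hw, hvw]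

/-- A differentiable left inverse gives injectivity of the derivative by the chain rule, and
continuity of the inverse on the image. -/
theorem isSmoothEmbeddingOn_of_leftInverse {f : ℂ → Phase} {G : Phase → ℂ} {Ω : Set ℂ}
    (hΩ : IsOpen Ω) (hf : ContDiffOn ℝ ∞ f Ω) (hG : ∀ z ∈ Ω, DifferentiableAt ℝ G (f z))
    (hGf : ∀ z ∈ Ω, G (f z) = z) : IsSmoothEmbeddingOn f Ω := by
  refine ⟨hf, fun z hz => ?_, ?_⟩
  · exact injective_fderiv_of_leftInverse
      ((hf.contDiffAt (hΩ.mem_nhds hz)).differentiableAt (by simp)) (hG z hz)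
      (eventually_of_mem (hΩ.mem_nhds hz) hGf)
  · have hmem : ∀ z : Ω, Ω.domRestrict f z ∈ f '' Ω := fun z => mem_image_of_mem f z.2
    have hcf : Continuous (Ω.domRestrict f) := continuousOn_iff_continuous_domRestrict.1 hf.continuousOn
    have hGc : ContinuousOn G (f '' Ω) := by
      rintro _ ⟨z, hz, rfl⟩
      exact (hG z hz).continuousAt.continuousWithinAt
    have h1 : IsEmbedding (Set.codRestrict (Ω.domRestrict f) (f '' Ω) hmem) := by
      refine IsEmbedding.of_comp (g := fun y : f '' Ω => G y) (hcf.codRestrict hmem)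
        (continuousOn_iff_continuous_domRestrict.1 hGc) ?_
      have : (fun y : f '' Ω => G y) ∘ Set.codRestrict (Ω.domRestrict f) (f '' Ω) hmem =
          ((↑) : Ω → ℂ) := funext fun z => hGf z z.2
      rw [this]
      exact IsEmbedding.subtypeVal
    exact IsEmbedding.subtypeVal.comp h1

/-- The derivatives in the loop variable remain jointly smooth in the parameter, which reduces `C^∞`
convergence of loops to uniform convergence of continuous families. -/
theorem exists_iteratedDeriv_param {A G : Type*} [NormedAddCommGroup A] [NormedSpace ℝ A]
    [NormedAddCommGroup G] [NormedSpace ℝ G] {F : A × ℝ → G} (hF : ContDiff ℝ ∞ F) (k : ℕ) :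
    ∃ F' : A × ℝ → G, ContDiff ℝ ∞ F' ∧
      ∀ a t, iteratedDeriv k (fun s => F (a, s)) t = F' (a, t) := by
  induction k with
  | zero => exact ⟨F, hF, fun a t => by simp⟩
  | succ k ih =>
    obtain ⟨F', hF', h⟩ := ih
    refine ⟨fun p => fderiv ℝ F' p (0, 1), ?_, fun a t => ?_⟩
    · exact (hF'.fderiv_right (m := ∞) (by simp)).clm_apply contDiff_const
    · rw [iteratedDeriv_succ]
      have h1 : iteratedDeriv k (fun s => F (a, s)) = fun s => F' (a, s) := funext (h a)
      rw [h1]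
      have h2 : HasDerivAt (fun s : ℝ => (a, s)) ((0 : A), (1 : ℝ)) t :=
        (hasDerivAt_const t a).prodMk (hasDerivAt_id t)
      exact (((hF'.differentiable (by simp) (a, t)).hasFDerivAt).comp_hasDerivAt t h2).deriv

/-- Loops depending smoothly on a parameter converge in `C^∞` as the parameter converges. -/
theorem tendstoUniformly_iteratedDeriv {A G ι : Type*} [NormedAddCommGroup A] [NormedSpace ℝ A]
    [NormedAddCommGroup G] [NormedSpace ℝ G] {F : A × ℝ → G} (hF : ContDiff ℝ ∞ F)
    (hper : ∀ a t, F (a, t + 1) = F (a, t)) {l : Filter ι} {κ : ι → A} {a₀ : A}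
    (hκ : Tendsto κ l (𝓝 a₀)) (k : ℕ) :
    TendstoUniformly (fun i t => iteratedDeriv k (fun s => F (κ i, s)) t)
      (iteratedDeriv k fun s => F (a₀, s)) l := by
  obtain ⟨F', hF', h⟩ := exists_iteratedDeriv_param hF k
  -- Periodicity reduces uniformity on the line to the compact interval `[0, 1]`.
  have hper' : ∀ a t, F' (a, t) = F' (a, Int.fract t) := fun a t => by
    have h1 : Function.Periodic (fun t => F' (a, t)) 1 := fun t => by
      have h2 := congrFun (iteratedDeriv_comp_add_const k (fun s => F (a, s)) 1) t
      simp only [hper] at h2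
      simp only [← h]
      exact h2.symm
    simpa [Int.self_sub_floor] using (h1.sub_int_mul_eq (x := t) ⌊t⌋).symm
  intro u hu
  obtain ⟨v, hv, hvu⟩ := IsCompact.mem_uniformity_of_prod (f := fun a t => F' (a, t))
    (isCompact_Icc (a := (0 : ℝ)) (b := 1)) (s := univ) (q := a₀)
    (by simpa [Function.uncurry_def] using hF'.continuous.continuousOn) (mem_univ _)
    (symm_le_uniformity hu)
  rw [nhdsWithin_univ] at hv
  filter_upwards [hκ hv] with i hi t
  rw [h, h, hper' a₀ t, hper' (κ i) t]
  exact hvu _ hi _ ⟨Int.fract_nonneg t, (Int.fract_lt_one t).le⟩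

/-- The circle of radius `ρ` in the `(Q, y₂)`-plane over the point `(x, y)`. -/
noncomputable def loop (ε : ℝ) (q : (ℝ × ℝ × ℝ) × ℝ) : Phase :=
  mkPhase ε q.1.1 q.1.2.1 (q.1.2.2 * Real.cos (2 * Real.pi * q.2))
    (q.1.2.2 * Real.sin (2 * Real.pi * q.2))

section
variable {ε E : ℝ}

theorem contDiff_loop (hε : 0 < ε) : ContDiff ℝ ∞ (loop ε) := by
  refine ContDiff.mkPhase hε (by fun_prop) (by fun_prop) ?_ ?_
  · exact (by fun_prop : ContDiff ℝ ∞ fun q : (ℝ × ℝ × ℝ) × ℝ => q.1.2.2).mul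
      (Real.contDiff_cos.comp (by fun_prop))
  · exact (by fun_prop : ContDiff ℝ ∞ fun q : (ℝ × ℝ × ℝ) × ℝ => q.1.2.2).mul
      (Real.contDiff_sin.comp (by fun_prop))

theorem loop_periodic (a : ℝ × ℝ × ℝ) (t : ℝ) : loop ε (a, t + 1) = loop ε (a, t) := by
  simp only [loop, mul_add, mul_one, Real.cos_add_two_pi, Real.sin_add_two_pi]

theorem exists_polar {R : ℝ} (hR : 0 ≤ R) {u v : ℝ} (h : u ^ 2 + v ^ 2 = R ^ 2) :
    ∃ t, u = R * Real.cos (2 * Real.pi * t) ∧ v = R * Real.sin (2 * Real.pi * t) := by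
  have hn : ‖(⟨u, v⟩ : ℂ)‖ = R := by
    rw [← sq_eq_sq₀ (norm_nonneg _) hR, ← Complex.normSq_eq_norm_sq, Complex.normSq_apply]
    simp; linarith
  refine ⟨Complex.arg ⟨u, v⟩ / (2 * Real.pi), ?_, ?_⟩ <;>
    rw [mul_div_cancel₀ _ (by positivity), ← hn]
  · rw [Complex.norm_mul_cos_arg]
  · rw [Complex.norm_mul_sin_arg]

theorem isParametrization_loop (hε : 0 < ε) {s : ℝ} (hs : V₁ ε s < E)
    {P : PeriodicOrbit (starkH ε) E} (hP : P.trace = fiber ε E s) :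
    P.IsParametrization fun t => loop ε ((s, 0, √(2 * (E - V₁ ε s))), t) := by
  set R := √(2 * (E - V₁ ε s)) with hR
  have hR2 : R ^ 2 = 2 * (E - V₁ ε s) := Real.sq_sqrt (by linarith)
  have hR0 : 0 < R := Real.sqrt_pos.2 (by linarith)
  have hsm : ContDiff ℝ ∞ fun t : ℝ => loop ε ((s, 0, R), t) :=
    (contDiff_loop hε).comp (by fun_prop)
  refine ⟨hsm, loop_periodic _, fun t ht t' ht' h => ?_, fun t h => ?_, ?_⟩
  · have h1 : R * Real.cos (2 * Real.pi * t) = R * Real.cos (2 * Real.pi * t') := by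
      have := congrArg (fun p : Phase => coordQ ε (p 1)) h
      simpa [loop, coordQ_invQ hε] using this
    have h2 : R * Real.sin (2 * Real.pi * t) = R * Real.sin (2 * Real.pi * t') :=
      congrArg (fun p : Phase => p 3) h
    have ha : ((2 * Real.pi * t : ℝ) : Real.Angle) = (2 * Real.pi * t' : ℝ) :=
      Real.Angle.cos_sin_inj (mul_left_cancel₀ hR0.ne' h1) (mul_left_cancel₀ hR0.ne' h2)
    obtain ⟨k, hk⟩ := Real.Angle.angle_eq_iff_two_pi_dvd_sub.1 ha
    have hk' : t - t' = k := by
      apply mul_left_cancel₀ (show 2 * Real.pi ≠ 0 by positivity)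
      linarith
    have hk0 : k = 0 := by
      have h1 : (k : ℝ) < 1 := by linarith [ht.2, ht'.1]
      have h2 : (-1 : ℝ) < k := by linarith [ht.1, ht'.2]
      have h3 : k < 1 := by exact_mod_cast h1
      have h4 : -1 < k := by exact_mod_cast h2
      omega
    rw [hk0, Int.cast_zero] at hk'
    linarith
  · have hd := (hsm.differentiable (by simp) t).hasDerivAt
    rw [h, hasDerivAt_phase] at hd
    have hlin : HasDerivAt (fun t : ℝ => 2 * Real.pi * t) (2 * Real.pi) t := by
      simpa using (hasDerivAt_id t).const_mul (2 * Real.pi)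
    have hc := ((Real.hasDerivAt_cos _).comp t hlin).const_mul R
    have hs' := ((Real.hasDerivAt_sin _).comp t hlin).const_mul R
    have h1 : HasDerivAt (fun t => R * Real.cos (2 * Real.pi * t)) 0 t := by
      have := (hasDerivAt_coordQ hε _).comp t (hd 1)
      simp only [PiLp.zero_apply, mul_zero] at this
      refine this.congr_of_eventuallyEq (Eventually.of_forall fun r => ?_)
      simp [loop, coordQ_invQ hε]
    have e1 := HasDerivAt.unique hc h1
    have e2 := HasDerivAt.unique hs' (hd 3)
    have hpi := Real.pi_ne_zero
    simp [hR0.ne', hpi] at e1 e2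
    have := Real.sin_sq_add_cos_sq (2 * Real.pi * t)
    rw [e1, e2] at this
    norm_num at this
  · rw [hP]
    ext p
    constructor
    · rintro ⟨t, rfl⟩
      refine ⟨?_, rfl, rfl⟩
      simp only [loop]
      rw [starkH_mkPhase hε]
      nlinarith [Real.sin_sq_add_cos_sq (2 * Real.pi * t)]
    · rintro ⟨h1, h2, h3⟩
      rw [starkH_eq_coordQ hε, h2, h3] at h1
      obtain ⟨t, e1, e2⟩ := exists_polar hR0.le (u := coordQ ε (p 1)) (v := p 3)
        (by rw [hR2]; linarith)
      refine ⟨t, ?_⟩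
      change mkPhase ε s 0 (R * Real.cos (2 * Real.pi * t)) (R * Real.sin (2 * Real.pi * t)) = p
      rw [← e1, ← e2, ← h2, ← h3, mkPhase_self hε]

/-- Smoothness of `loop` in its parameters does the work, so `κ` only has to converge; this allows
parameters such as `√Y` at `Y = 0`. -/
theorem isAsymptotic_of_loop (hε : 0 < ε) {s : ℝ} (hs : V₁ ε s < E)
    {P : PeriodicOrbit (starkH ε) E} (hP : P.trace = fiber ε E s) {f : ℂ → Phase} {l : Filter ℝ}
    {κ : ℝ → ℝ × ℝ × ℝ} (hκ : Tendsto κ l (𝓝 (s, 0, √(2 * (E - V₁ ε s)))))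
    (hf : ∀ᶠ r : ℝ in l, ∀ t : ℝ,
      f (r * Complex.exp (2 * Real.pi * t * Complex.I)) = loop ε (κ r, t)) :
    IsAsymptotic f l P := by
  refine ⟨_, isParametrization_loop hε hs hP, fun k => ?_⟩
  have h := tendstoUniformly_iteratedDeriv (contDiff_loop hε) loop_periodic hκ k
  intro u hu
  filter_upwards [hf, h u hu] with r hr hu t
  simpa only [hr] using hu t

theorem real_mul_exp_re (r t : ℝ) :
    ((r : ℂ) * Complex.exp (2 * Real.pi * t * Complex.I)).re = r * Real.cos (2 * Real.pi * t) := by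
  rw [Complex.re_ofReal_mul, show (2 * Real.pi * t * Complex.I : ℂ) =
    ((2 * Real.pi * t : ℝ) : ℂ) * Complex.I by push_cast; ring, Complex.exp_ofReal_mul_I_re]

theorem real_mul_exp_im (r t : ℝ) :
    ((r : ℂ) * Complex.exp (2 * Real.pi * t * Complex.I)).im = r * Real.sin (2 * Real.pi * t) := by
  rw [Complex.im_ofReal_mul, show (2 * Real.pi * t * Complex.I : ℂ) =
    ((2 * Real.pi * t : ℝ) : ℂ) * Complex.I by push_cast; ring, Complex.exp_ofReal_mul_I_im]

theorem real_mul_exp_normSq (r t : ℝ) :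
    Complex.normSq ((r : ℂ) * Complex.exp (2 * Real.pi * t * Complex.I)) = r ^ 2 := by
  rw [Complex.normSq_apply, real_mul_exp_re, real_mul_exp_im]
  linear_combination r ^ 2 * Real.sin_sq_add_cos_sq (2 * Real.pi * t)

/-! ### Parametrization of planes -/

/-- The data of a graph `x₁ = X (y₁²)` over a half-line `σ y₁ > 0` which caps off the energy surface
at `y₁² = M`; `q` is the divided difference of the remaining energy. -/
structure CapProfile (ε E : ℝ) where
  X : ℝ → ℝ
  q : ℝ → ℝ
  M : ℝ
  M_pos : 0 < M
  X_smooth : ContDiff ℝ ∞ X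
  q_smooth : ContDiff ℝ ∞ q
  q_pos : ∀ Y, 0 ≤ Y → 0 < q Y
  -- The left side is the squared radius of the `(Q, y₂)`-circle; its simple zero at the cap is
  -- split off.
  energy : ∀ Y, 2 * (E - V₁ ε (X Y)) - Y = (M - Y) * q Y

theorem contDiff_normSq : ContDiff ℝ ∞ fun z : ℂ => Complex.normSq z := by
  simp only [Complex.normSq_apply]
  have h1 : ContDiff ℝ ∞ fun z : ℂ => z.re := Complex.reCLM.contDiff
  have h2 : ContDiff ℝ ∞ fun z : ℂ => z.im := Complex.imCLM.contDiff
  exact (h1.mul h1).add (h2.mul h2)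

namespace CapProfile

variable (c : CapProfile ε E)

/-- The value of `y₁²` at the parameter `z`. -/
noncomputable def height (z : ℂ) : ℝ := c.M / (1 + Complex.normSq z)

/-- The parametrization of the cap by the complex plane. -/
noncomputable def param (σ : ℝ) (z : ℂ) : Phase :=
  mkPhase ε (c.X (c.height z)) (σ * √(c.height z)) (z.re * √(c.height z * c.q (c.height z)))
    (z.im * √(c.height z * c.q (c.height z)))

theorem one_add_normSq_pos (z : ℂ) : 0 < 1 + Complex.normSq z := by
  linarith [Complex.normSq_nonneg z]

theorem height_pos (z : ℂ) : 0 < c.height z := div_pos c.M_pos (one_add_normSq_pos z)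

/-- For `Y = M/(1 + |z|²)` this turns the squared radius `(M - Y) q` into `|z|² Y q`. Hence `(Q, y₂)
= z √(Y q)` is smooth even at the tip `z = 0`. -/
theorem normSq_mul_height (z : ℂ) : Complex.normSq z * c.height z = c.M - c.height z := by
  have := (one_add_normSq_pos z).ne'
  rw [height]; field_simp; ring

theorem contDiff_height : ContDiff ℝ ∞ c.height :=
  contDiff_const.div (contDiff_const.add contDiff_normSq) fun z => (one_add_normSq_pos z).ne'

theorem mul_q_pos {Y : ℝ} (hY : 0 < Y) : 0 < Y * c.q Y := mul_pos hY (c.q_pos Y hY.le)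

theorem contDiff_param (hε : 0 < ε) (σ : ℝ) : ContDiff ℝ ∞ (c.param σ) := by
  have hh := c.contDiff_height
  have hs : ContDiff ℝ ∞ fun z => √(c.height z * c.q (c.height z)) :=
    (hh.mul (c.q_smooth.comp hh)).sqrt fun z => (c.mul_q_pos (c.height_pos z)).ne'
  exact ContDiff.mkPhase hε (c.X_smooth.comp hh)
    (contDiff_const.mul (hh.sqrt fun z => (c.height_pos z).ne'))
    (ContDiff.mul Complex.reCLM.contDiff hs) (ContDiff.mul Complex.imCLM.contDiff hs)

theorem starkH_param (hε : 0 < ε) {σ : ℝ} (hσ : σ ^ 2 = 1) (z : ℂ) :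
    starkH ε (c.param σ z) = E := by
  have hY := c.height_pos z
  rw [param, starkH_mkPhase hε, mul_pow, mul_pow, mul_pow, hσ, Real.sq_sqrt hY.le,
    Real.sq_sqrt (c.mul_q_pos hY).le]
  have h1 := c.energy (c.height z)
  have h2 := c.normSq_mul_height z
  rw [Complex.normSq_apply] at h2
  linear_combination (1 / 2 : ℝ) * (c.q (c.height z)) * h2 - (1 / 2 : ℝ) * h1

/-- The left inverse of the parametrization. -/
noncomputable def coord (p : Phase) : ℂ :=
  ((√(p 2 ^ 2 * c.q (p 2 ^ 2)))⁻¹ : ℝ) * ((coordQ ε (p 1) : ℂ) + p 3 * Complex.I)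

theorem coord_param (hε : 0 < ε) {σ : ℝ} (hσ : σ ^ 2 = 1) (z : ℂ) :
    c.coord (c.param σ z) = z := by
  have hY := c.height_pos z
  have h2 : (c.param σ z) 2 ^ 2 = c.height z := by
    simp only [param, mkPhase_two]
    rw [mul_pow, hσ, Real.sq_sqrt hY.le, one_mul]
  have hs := Real.sqrt_pos.2 (c.mul_q_pos hY)
  rw [coord, h2]
  simp only [param, mkPhase_one, mkPhase_three, coordQ_invQ hε]
  apply Complex.ext <;> simp <;> field_simp

theorem differentiableAt_coord (hε : 0 < ε) {p : Phase} (hp : p 2 ≠ 0) :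
    DifferentiableAt ℝ c.coord p := by
  have h0 : 0 < p 2 ^ 2 := by positivity
  have h1 : DifferentiableAt ℝ (fun p : Phase => p 2 ^ 2 * c.q (p 2 ^ 2)) p := by
    have : DifferentiableAt ℝ (fun p : Phase => c.q (p 2 ^ 2)) p :=
      (c.q_smooth.differentiable (by simp) _).comp p (by fun_prop)
    fun_prop
  have h2 := (h1.sqrt (c.mul_q_pos h0).ne').inv (Real.sqrt_pos.2 (c.mul_q_pos h0)).ne'
  have h3 : DifferentiableAt ℝ (fun p : Phase => coordQ ε (p 1)) p :=
    ((contDiff_coordQ hε).differentiable (by simp) _).comp p (by fun_prop)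
  have h4 : DifferentiableAt ℝ (fun p : Phase => p 3) p := by fun_prop
  exact (Complex.ofRealCLM.differentiableAt.comp p h2).mul
    ((Complex.ofRealCLM.differentiableAt.comp p h3).add
      ((Complex.ofRealCLM.differentiableAt.comp p h4).mul_const Complex.I))

theorem isSmoothEmbeddingOn_param (hε : 0 < ε) {σ : ℝ} (hσ : σ ^ 2 = 1) :
    IsSmoothEmbeddingOn (c.param σ) univ := by
  refine isSmoothEmbeddingOn_of_leftInverse isOpen_univ (c.contDiff_param hε σ).contDiffOn
    (fun z _ => c.differentiableAt_coord hε ?_) (fun z _ => c.coord_param hε hσ z)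
  have h : σ ≠ 0 := fun h => by simp [h] at hσ
  exact mul_ne_zero h (Real.sqrt_pos.2 (c.height_pos z)).ne'

theorem image_param (hε : 0 < ε) {σ : ℝ} (hσ : σ ^ 2 = 1) :
    c.param σ '' univ = {p | starkH ε p = E ∧ p 0 = c.X (p 2 ^ 2) ∧ 0 < σ * p 2} := by
  ext p
  constructor
  · rintro ⟨z, -, rfl⟩
    have hY := c.height_pos z
    refine ⟨c.starkH_param hε hσ z, ?_, ?_⟩
    · simp only [param, mkPhase_two, mkPhase_zero]
      rw [mul_pow, hσ, Real.sq_sqrt hY.le, one_mul]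
    · simp only [param, mkPhase_two]
      rw [← mul_assoc, ← sq, hσ, one_mul]
      exact Real.sqrt_pos.2 hY
  · rintro ⟨h1, h2, h3⟩
    have hp2 : p 2 ≠ 0 := fun h => by simp [h] at h3
    have hY : 0 < p 2 ^ 2 := by positivity
    have hYq := c.mul_q_pos hY
    have hs := Real.sqrt_pos.2 hYq
    have hq := c.q_pos _ hY.le
    rw [starkH_eq_coordQ hε, h2] at h1
    have he := c.energy (p 2 ^ 2)
    have hre : (c.coord p).re = (√(p 2 ^ 2 * c.q (p 2 ^ 2)))⁻¹ * coordQ ε (p 1) := by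
      simp [coord]
    have him : (c.coord p).im = (√(p 2 ^ 2 * c.q (p 2 ^ 2)))⁻¹ * p 3 := by
      simp [coord]
    have hn : Complex.normSq (c.coord p) = (c.M - p 2 ^ 2) / p 2 ^ 2 := by
      rw [Complex.normSq_apply, hre, him]
      have hsq := Real.sq_sqrt hYq.le
      set r := √(p 2 ^ 2 * c.q (p 2 ^ 2))
      have : r⁻¹ * coordQ ε (p 1) * (r⁻¹ * coordQ ε (p 1)) + r⁻¹ * p 3 * (r⁻¹ * p 3) =
          (coordQ ε (p 1) ^ 2 + p 3 ^ 2) / r ^ 2 := by field_simp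
      rw [this, hsq, div_eq_div_iff hYq.ne' hY.ne']
      linear_combination (p 2 ^ 2) * (2 * h1) + (p 2 ^ 2) * he
    have hh : c.height (c.coord p) = p 2 ^ 2 := by
      rw [height, hn, show 1 + (c.M - p 2 ^ 2) / p 2 ^ 2 = c.M / p 2 ^ 2 by field_simp; ring,
        div_div_cancel₀ c.M_pos.ne']
    refine ⟨c.coord p, mem_univ _, ?_⟩
    rw [param, hh, hre, him, ← h2]
    have e1 : σ * √(p 2 ^ 2) = p 2 := by
      have : p 2 ^ 2 = (σ * p 2) ^ 2 := by rw [mul_pow, hσ, one_mul]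
      rw [this, Real.sqrt_sq h3.le]
      linear_combination (p 2) * hσ
    have e2 : ∀ x : ℝ, (√(p 2 ^ 2 * c.q (p 2 ^ 2)))⁻¹ * x * √(p 2 ^ 2 * c.q (p 2 ^ 2)) = x :=
      fun x => by field_simp
    rw [e1, e2, e2, mkPhase_self hε]

theorem isAsymptotic_param (hε : 0 < ε) (σ : ℝ) (hs : V₁ ε (c.X 0) < E)
    {P : PeriodicOrbit (starkH ε) E} (hP : P.trace = fiber ε E (c.X 0)) :
    IsAsymptotic (c.param σ) atTop P := by
  let Y : ℝ → ℝ := fun r => c.M / (1 + r ^ 2)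
  have hY : Tendsto Y atTop (𝓝 0) := by
    refine tendsto_const_nhds.div_atTop ?_
    exact tendsto_atTop_add_const_left _ _ (tendsto_pow_atTop two_ne_zero)
  have hk : Continuous fun y : ℝ => (c.X y, σ * √y, √((c.M - y) * c.q y)) := by
    have h1 := c.X_smooth.continuous
    have h2 := c.q_smooth.continuous
    fun_prop
  refine isAsymptotic_of_loop hε hs hP
    (κ := fun r => (c.X (Y r), σ * √(Y r), √((c.M - Y r) * c.q (Y r)))) ?_ ?_
  · have := (hk.tendsto 0).comp hY
    have he := c.energy 0
    simp only [sub_zero] at he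
    simpa [Function.comp_def, he] using this
  · filter_upwards [eventually_ge_atTop 0] with r hr t
    have hh : c.height (r * Complex.exp (2 * Real.pi * t * Complex.I)) = Y r := by
      rw [height, real_mul_exp_normSq]
    have hY1 : c.M - Y r = r ^ 2 * Y r := by
      have : 1 + r ^ 2 ≠ 0 := by positivity
      simp only [Y]
      field_simp
      ring
    have hρ : √((c.M - Y r) * c.q (Y r)) = r * √(Y r * c.q (Y r)) := by
      rw [hY1, mul_assoc, Real.sqrt_mul (by positivity), Real.sqrt_sq hr]
    rw [param, hh, real_mul_exp_re, real_mul_exp_im, loop]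
    simp only [hρ]
    congr 1 <;> ring

end CapProfile

/-- The profile of a rigid plane. -/
noncomputable def rigidProfile {s : ℝ} (hs : V₁ ε s < E) : CapProfile ε E where
  X := fun _ => s
  q := fun _ => 1
  M := 2 * (E - V₁ ε s)
  M_pos := by linarith
  X_smooth := contDiff_const
  q_smooth := contDiff_const
  q_pos := fun _ _ => one_pos
  energy := fun Y => by ring

theorem V₁_invW (hε : 0 < ε) (w : ℝ) :
    V₁ ε (invW ε w) = (1 - ((1 + 2 * ε * w ^ 2) ^ 2)⁻¹) / ε := by
  have h1 : 0 < 1 + 2 * ε * w ^ 2 := by positivity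
  have h2 : invW ε w ^ 2 = w ^ 2 / (1 + 2 * ε * w ^ 2) := by
    rw [invW, div_pow, Real.sq_sqrt h1.le]
  have h4 : invW ε w ^ 4 = (invW ε w ^ 2) ^ 2 := by ring
  rw [V₁, h4, h2]
  field_simp
  ring

/-- On `W = C y₁⁸` one has `W = C Y⁴` with `Y = y₁²`. The value `M`, where the line meets `{H₁ =
E}`, comes from the intermediate value theorem, and `q` from `V₁_invW` and the factorization of `M⁸
- Y⁸`. All terms of `q` beyond the leading `1` are nonnegative for `Y ≥ 0`, so the crossing is
unique. -/
theorem exists_planeProfile (hε : 0 < ε) (hE : 0 < E) (C : ℝ) :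
    ∃ c : CapProfile ε E, c.X = fun Y => invW ε (C * Y ^ 4) := by
  have hcX : ContDiff ℝ ∞ fun Y => invW ε (C * Y ^ 4) := (contDiff_invW hε).comp (by fun_prop)
  have hV : ∀ w, 0 ≤ V₁ ε (invW ε w) := fun w => by
    rw [V₁_invW hε]
    refine div_nonneg (sub_nonneg.2 (inv_le_one_of_one_le₀ (one_le_pow₀ ?_))) hε.le
    nlinarith [mul_nonneg hε.le (sq_nonneg w)]
  obtain ⟨M, hM, hME⟩ : ∃ M ∈ Icc 0 (2 * E), M + 2 * V₁ ε (invW ε (C * M ^ 4)) = 2 * E := by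
    have hc : Continuous fun Y => Y + 2 * V₁ ε (invW ε (C * Y ^ 4)) :=
      continuous_id.add (continuous_const.mul ((continuous_V₁ ε).comp hcX.continuous))
    refine intermediate_value_Icc (by positivity) hc.continuousOn ⟨?_, ?_⟩
    · simp [invW, V₁, hE.le]
    · linarith [hV (C * (2 * E) ^ 4)]
  have hM0 : 0 < M := lt_of_le_of_ne hM.1 fun h => by
    rw [← h] at hME
    simp [invW, V₁] at hME
    linarith
  have hp : ∀ Y : ℝ, 0 < 1 + 2 * ε * (C * Y ^ 4) ^ 2 := fun Y => by positivity
  refine ⟨⟨fun Y => invW ε (C * Y ^ 4), fun Y => 1 + 4 * C ^ 2 * ((M + Y) * (M ^ 2 + Y ^ 2) *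
    (M ^ 4 + Y ^ 4)) * ((1 + 2 * ε * (C * M ^ 4) ^ 2) + (1 + 2 * ε * (C * Y ^ 4) ^ 2)) /
    ((1 + 2 * ε * (C * Y ^ 4) ^ 2) ^ 2 * (1 + 2 * ε * (C * M ^ 4) ^ 2) ^ 2), M, hM0, hcX, ?_,
    fun Y hY => ?_, fun Y => ?_⟩, rfl⟩
  · exact contDiff_const.add (ContDiff.div (by fun_prop) (by fun_prop) fun Y =>
      (mul_pos (pow_pos (hp Y) 2) (pow_pos (hp M) 2)).ne')
  · positivity
  · rw [V₁_invW hε] at hME ⊢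
    have h1 := hp M
    have h2 := hp Y
    have h3 : 2 * E - Y = M - Y + 2 * ((1 - ((1 + 2 * ε * (C * M ^ 4) ^ 2) ^ 2)⁻¹) / ε) := by
      linarith
    have h4 : 2 * (E - (1 - ((1 + 2 * ε * (C * Y ^ 4) ^ 2) ^ 2)⁻¹) / ε) - Y =
      M - Y + 2 * ((1 - ((1 + 2 * ε * (C * M ^ 4) ^ 2) ^ 2)⁻¹) / ε) -
        2 * ((1 - ((1 + 2 * ε * (C * Y ^ 4) ^ 2) ^ 2)⁻¹) / ε) := by linarith
    rw [h4]
    have h5 : (1 + 2 * ε * (C * M ^ 4) ^ 2) - (1 + 2 * ε * (C * Y ^ 4) ^ 2) =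
      2 * ε * C ^ 2 * ((M - Y) * ((M + Y) * (M ^ 2 + Y ^ 2) * (M ^ 4 + Y ^ 4))) := by ring
    generalize 1 + 2 * ε * (C * M ^ 4) ^ 2 = P at *
    generalize 1 + 2 * ε * (C * Y ^ 4) ^ 2 = p at *
    generalize (M + Y) * (M ^ 2 + Y ^ 2) * (M ^ 4 + Y ^ 4) = S at *
    field_simp
    linear_combination 2 * (P + p) * h5

/-! ### Parametrization of cylinders -/

/-- The parametrization of a rigid cylinder by the punctured plane. -/
noncomputable def cylinderParam (ε E s : ℝ) (z : ℂ) : Phase :=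
  mkPhase ε (s / √(Complex.normSq z + 2 * ε)) 0
    (z.re * (√(2 * (E - V₁ ε (s / √(Complex.normSq z + 2 * ε)))) / √(Complex.normSq z)))
    (z.im * (√(2 * (E - V₁ ε (s / √(Complex.normSq z + 2 * ε)))) / √(Complex.normSq z)))

/-- The left inverse of `cylinderParam`. -/
noncomputable def cylinderCoord (ε : ℝ) (p : Phase) : ℂ :=
  ((√((p 0 ^ 2)⁻¹ - 2 * ε) / √(coordQ ε (p 1) ^ 2 + p 3 ^ 2) : ℝ) : ℂ) *
    ((coordQ ε (p 1) : ℂ) + p 3 * Complex.I)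

/-- The parameter is chosen so that `|z|² = x₁⁻² - 2ε = W⁻²`: the end `z → 0` lies over the saddle
and `z → ∞` over the origin. -/
theorem cylinder_sq (hε : 0 < ε) {s : ℝ} (hs : s ^ 2 = 1) (z : ℂ) :
    (s / √(Complex.normSq z + 2 * ε)) ^ 2 = (Complex.normSq z + 2 * ε)⁻¹ := by
  rw [div_pow, hs, Real.sq_sqrt (by linarith [Complex.normSq_nonneg z]), one_div]

theorem contDiffOn_cylinderParam (hε : 0 < ε) (hE : 1 / ε < E) (s : ℝ) :
    ContDiffOn ℝ ∞ (cylinderParam ε E s) {0}ᶜ := by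
  have hx : ContDiff ℝ ∞ fun z : ℂ => s / √(Complex.normSq z + 2 * ε) := by
    refine contDiff_const.div ((contDiff_normSq.add contDiff_const).sqrt fun z => ?_) fun z => ?_
    · linarith [Complex.normSq_nonneg z]
    · exact (Real.sqrt_pos.2 (by linarith [Complex.normSq_nonneg z])).ne'
  have hn : ∀ z ∈ ({0}ᶜ : Set ℂ), Complex.normSq z ≠ 0 := fun z hz => by simpa using hz
  have hρ : ContDiffOn ℝ ∞ (fun z : ℂ =>
      √(2 * (E - V₁ ε (s / √(Complex.normSq z + 2 * ε)))) / √(Complex.normSq z)) {0}ᶜ := by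
    refine ContDiffOn.div (ContDiff.contDiffOn (ContDiff.sqrt (contDiff_const.mul
      (contDiff_const.sub ((contDiff_V₁ ε).comp hx))) fun z => ?_))
      (contDiff_normSq.contDiffOn.sqrt hn) fun z hz => ?_
    · have := V₁_le hε (s / √(Complex.normSq z + 2 * ε))
      linarith
    · exact (Real.sqrt_pos.2 (Complex.normSq_pos.2 hz)).ne'
  exact ContDiffOn.mkPhase hε hx.contDiffOn contDiffOn_const
    (ContDiffOn.mul Complex.reCLM.contDiff.contDiffOn hρ)
    (ContDiffOn.mul Complex.imCLM.contDiff.contDiffOn hρ)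

theorem cylinder_sum_sq (hε : 0 < ε) (hE : 1 / ε < E) {s : ℝ} {z : ℂ} (hz : z ≠ 0) :
    coordQ ε (cylinderParam ε E s z 1) ^ 2 + cylinderParam ε E s z 3 ^ 2 =
      2 * (E - V₁ ε (s / √(Complex.normSq z + 2 * ε))) := by
  have hn := Complex.normSq_pos.2 hz
  have hρ : 0 < 2 * (E - V₁ ε (s / √(Complex.normSq z + 2 * ε))) := by
    have := V₁_le hε (s / √(Complex.normSq z + 2 * ε))
    linarith
  simp only [cylinderParam, mkPhase_one, mkPhase_three, coordQ_invQ hε]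
  rw [mul_pow, mul_pow, div_pow, Real.sq_sqrt hn.le, Real.sq_sqrt hρ.le]
  generalize 2 * (E - V₁ ε (s / √(Complex.normSq z + 2 * ε))) = r
  have h : Complex.normSq z = z.re ^ 2 + z.im ^ 2 := by rw [Complex.normSq_apply]; ring
  rw [← add_mul, ← h]
  field_simp

theorem starkH_cylinderParam (hε : 0 < ε) (hE : 1 / ε < E) {s : ℝ} {z : ℂ} (hz : z ≠ 0) :
    starkH ε (cylinderParam ε E s z) = E := by
  have h := cylinder_sum_sq hε hE (s := s) hz
  rw [starkH_eq_coordQ hε]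
  have h0 : cylinderParam ε E s z 0 = s / √(Complex.normSq z + 2 * ε) := rfl
  have h2 : cylinderParam ε E s z 2 = 0 := rfl
  rw [h0, h2]
  linear_combination (1 / 2 : ℝ) * h

theorem cylinderCoord_cylinderParam (hε : 0 < ε) (hE : 1 / ε < E) {s : ℝ} (hs : s ^ 2 = 1) {z : ℂ}
    (hz : z ≠ 0) : cylinderCoord ε (cylinderParam ε E s z) = z := by
  have hn := Real.sqrt_pos.2 (Complex.normSq_pos.2 hz)
  have hρ : 0 < √(2 * (E - V₁ ε (s / √(Complex.normSq z + 2 * ε)))) := by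
    have := V₁_le hε (s / √(Complex.normSq z + 2 * ε))
    exact Real.sqrt_pos.2 (by linarith)
  have h0 : cylinderParam ε E s z 0 = s / √(Complex.normSq z + 2 * ε) := rfl
  rw [cylinderCoord, cylinder_sum_sq hε hE hz, h0, cylinder_sq hε hs, inv_inv, add_sub_cancel_right]
  simp only [cylinderParam, mkPhase_one, mkPhase_three, coordQ_invQ hε]
  generalize √(2 * (E - V₁ ε (s / √(Complex.normSq z + 2 * ε)))) = ρ at *
  generalize √(Complex.normSq z) = m at *
  apply Complex.ext
  · rw [Complex.re_ofReal_mul]; simp; field_simp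
  · rw [Complex.im_ofReal_mul]; simp; field_simp

theorem differentiableAt_cylinderCoord (hε : 0 < ε) {p : Phase} (h0 : p 0 ≠ 0)
    (h1 : 0 < (p 0 ^ 2)⁻¹ - 2 * ε) (h2 : 0 < coordQ ε (p 1) ^ 2 + p 3 ^ 2) :
    DifferentiableAt ℝ (cylinderCoord ε) p := by
  have h3 : DifferentiableAt ℝ (fun p : Phase => coordQ ε (p 1)) p :=
    ((contDiff_coordQ hε).differentiable (by simp) _).comp p (by fun_prop)
  have h4 : DifferentiableAt ℝ (fun p : Phase => p 3) p := by fun_prop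
  have h5 : DifferentiableAt ℝ (fun p : Phase => p 0) p := by fun_prop
  have h6 : DifferentiableAt ℝ (fun p : Phase => √((p 0 ^ 2)⁻¹ - 2 * ε)) p :=
    (((h5.pow 2).inv (pow_ne_zero 2 h0)).sub_const (2 * ε)).sqrt h1.ne'
  have h7 : DifferentiableAt ℝ (fun p : Phase => √(coordQ ε (p 1) ^ 2 + p 3 ^ 2)) p :=
    ((h3.pow 2).add (h4.pow 2)).sqrt h2.ne'
  have h8 : DifferentiableAt ℝ (fun p : Phase =>
      √((p 0 ^ 2)⁻¹ - 2 * ε) / √(coordQ ε (p 1) ^ 2 + p 3 ^ 2)) p := by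
    simp only [div_eq_mul_inv]
    exact h6.mul (h7.inv (Real.sqrt_pos.2 h2).ne')
  exact (Complex.ofRealCLM.differentiableAt.comp p h8).mul
    ((Complex.ofRealCLM.differentiableAt.comp p h3).add
      ((Complex.ofRealCLM.differentiableAt.comp p h4).mul_const Complex.I))

theorem isSmoothEmbeddingOn_cylinderParam (hε : 0 < ε) (hE : 1 / ε < E) {s : ℝ} (hs : s ^ 2 = 1) :
    IsSmoothEmbeddingOn (cylinderParam ε E s) {0}ᶜ := by
  refine isSmoothEmbeddingOn_of_leftInverse isOpen_compl_singleton
    (contDiffOn_cylinderParam hε hE s) (fun z hz => differentiableAt_cylinderCoord hε ?_ ?_ ?_)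
    (fun z hz => cylinderCoord_cylinderParam hε hE hs hz)
  · have h : s ≠ 0 := fun h => by simp [h] at hs
    exact div_ne_zero h (Real.sqrt_pos.2 (by linarith [Complex.normSq_nonneg z])).ne'
  · have h0 : cylinderParam ε E s z 0 = s / √(Complex.normSq z + 2 * ε) := rfl
    rw [h0, cylinder_sq hε hs, inv_inv, add_sub_cancel_right]
    exact Complex.normSq_pos.2 hz
  · rw [cylinder_sum_sq hε hE hz]
    have := V₁_le hε (s / √(Complex.normSq z + 2 * ε))
    linarith

theorem image_cylinderParam (hε : 0 < ε) (hE : 1 / ε < E) {s : ℝ} (hs : s ^ 2 = 1) :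
    cylinderParam ε E s '' {0}ᶜ =
      {p | starkH ε p = E ∧ p 2 = 0 ∧ 0 < s * p 0 ∧ |p 0| < saddle ε} := by
  ext p
  constructor
  · rintro ⟨z, hz, rfl⟩
    have hn := Complex.normSq_pos.2 hz
    have h0 : cylinderParam ε E s z 0 = s / √(Complex.normSq z + 2 * ε) := rfl
    refine ⟨starkH_cylinderParam hε hE hz, rfl, ?_, ?_⟩
    · rw [h0, ← mul_div_assoc, ← sq, hs]
      exact one_div_pos.2 (Real.sqrt_pos.2 (by linarith))
    · apply abs_lt_of_sq_lt_sq _ (saddle_pos hε).le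
      rw [h0, cylinder_sq hε hs, saddle_sq hε, one_div]
      exact inv_strictAnti₀ (by positivity) (by linarith)
  · rintro ⟨h1, h2, h3, h4⟩
    have hp0 : p 0 ≠ 0 := fun h => by simp [h] at h3
    have hn := inv_sq_sub_pos hε h4 hp0
    have hV := V₁_le hε (p 0)
    rw [starkH_eq_coordQ hε, h2] at h1
    have hζ : coordQ ε (p 1) ^ 2 + p 3 ^ 2 = 2 * (E - V₁ ε (p 0)) := by linarith
    have hζ0 : 0 < coordQ ε (p 1) ^ 2 + p 3 ^ 2 := by rw [hζ]; linarith
    set a := √((p 0 ^ 2)⁻¹ - 2 * ε) with ha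
    set b := √(coordQ ε (p 1) ^ 2 + p 3 ^ 2) with hb
    have ha0 : 0 < a := Real.sqrt_pos.2 hn
    have hb0 : 0 < b := Real.sqrt_pos.2 hζ0
    have hre : (cylinderCoord ε p).re = a / b * coordQ ε (p 1) := by simp [cylinderCoord, ha, hb]
    have him : (cylinderCoord ε p).im = a / b * p 3 := by simp [cylinderCoord, ha, hb]
    have hnorm : Complex.normSq (cylinderCoord ε p) = (p 0 ^ 2)⁻¹ - 2 * ε := by
      rw [Complex.normSq_apply, hre, him, ← Real.sq_sqrt hn.le, ← ha]
      have hb2 : coordQ ε (p 1) ^ 2 + p 3 ^ 2 = b ^ 2 := (Real.sq_sqrt hζ0.le).symm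
      have : a / b * coordQ ε (p 1) * (a / b * coordQ ε (p 1)) + a / b * p 3 * (a / b * p 3) =
        a ^ 2 * (coordQ ε (p 1) ^ 2 + p 3 ^ 2) / b ^ 2 := by field_simp
      rw [this, hb2]
      field_simp
    have hx : s / √(Complex.normSq (cylinderCoord ε p) + 2 * ε) = p 0 := by
      rw [hnorm, sub_add_cancel, Real.sqrt_inv, div_inv_eq_mul]
      have : p 0 ^ 2 = (s * p 0) ^ 2 := by rw [mul_pow, hs, one_mul]
      rw [this, Real.sqrt_sq h3.le]
      linear_combination p 0 * hs
    refine ⟨cylinderCoord ε p, ?_, ?_⟩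
    · rw [mem_compl_iff, mem_singleton_iff, ← Complex.normSq_eq_zero, hnorm]
      exact hn.ne'
    · rw [cylinderParam, hx, hnorm, ← hζ, ← ha, ← hb, hre, him]
      have e : ∀ x : ℝ, a / b * x * (b / a) = x := fun x => by field_simp
      rw [e, e]
      conv_rhs => rw [← mkPhase_self hε p]
      rw [h2]

theorem isAsymptotic_cylinderParam (hε : 0 < ε) (hE : 1 / ε < E) {s x₀ : ℝ} {l : Filter ℝ}
    (hl : ∀ᶠ r in l, 0 < r) (hx : Tendsto (fun r : ℝ => s / √(r ^ 2 + 2 * ε)) l (𝓝 x₀))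
    {P : PeriodicOrbit (starkH ε) E} (hP : P.trace = fiber ε E x₀) :
    IsAsymptotic (cylinderParam ε E s) l P := by
  have hk : Continuous fun x : ℝ => (x, (0 : ℝ), √(2 * (E - V₁ ε x))) := by
    have := continuous_V₁ ε
    fun_prop
  refine isAsymptotic_of_loop hε ((V₁_le hε x₀).trans_lt hE) hP ((hk.tendsto x₀).comp hx) ?_
  filter_upwards [hl] with r hr t
  rw [cylinderParam, real_mul_exp_normSq, real_mul_exp_re, real_mul_exp_im, Real.sqrt_sq hr.le, loop]
  simp only [Function.comp_apply]
  congr 1 <;> field_simp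

end

/-! ### Gradient flow lines -/

/-- The gradient flow line of `H₁` with label `i`. -/
noncomputable def lineCurve (ε : ℝ) : LeafIndex 2 → ℝ → Plane
  | .rigid j b, t => !₂[-sgn j * saddle ε, sgn (j + b) * Real.exp t]
  | .cylinder j, t => !₂[invW ε (-sgn j * Real.exp (8 * t)), 0]
  | .plane j τ, t => !₂[invW ε (sgn j * lineParam τ * Real.exp (8 * t)), sgn j * Real.exp t]

section
variable {ε E : ℝ}

/-- The identity `W' V₁' = 8 W` linearizes the equation `x' = V₁'(x)`. -/
theorem hasDerivAt_invW_exp (hε : 0 < ε) (C t : ℝ) :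
    HasDerivAt (fun t => invW ε (C * Real.exp (8 * t))) (dV₁ ε (invW ε (C * Real.exp (8 * t)))) t := by
  set w := C * Real.exp (8 * t) with hw
  have hx := abs_invW_lt hε w
  have h1 := one_sub_pos hε hx
  have h2 : HasDerivAt (invW ε) (((√(1 - 2 * ε * invW ε w ^ 2) ^ 3)⁻¹)⁻¹) w :=
    HasDerivAt.of_local_left_inverse (contDiff_invW hε).continuous.continuousAt
      (hasDerivAt_coordW hε hx) (inv_pos.2 (pow_pos (Real.sqrt_pos.2 h1) 3)).ne'
      (Eventually.of_forall (coordW_invW hε))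
  have h3 : HasDerivAt (fun t => C * Real.exp (8 * t)) (8 * w) t := by
    refine ((((hasDerivAt_id t).const_mul 8).exp).const_mul C).congr_deriv ?_
    simp [hw]; ring
  refine (h2.comp t h3).congr_deriv ?_
  have h4 := coordW_invW hε w
  rw [coordW, div_eq_iff (Real.sqrt_pos.2 h1).ne'] at h4
  have h5 := Real.sq_sqrt h1.le
  set r := √(1 - 2 * ε * invW ε w ^ 2)
  have h6 : dV₁ ε (invW ε w) = 8 * invW ε w * r ^ 2 := by rw [h5, dV₁]; ring
  rw [h6, inv_inv]
  conv_rhs => rw [h4]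
  ring

theorem hasDerivAt_plane {f : ℝ → Plane} {f' : Plane} {t : ℝ}
    (h : ∀ i, HasDerivAt (fun s => f s i) (f' i) t) : HasDerivAt f f' t := by
  rw [hasDerivAt_iff_hasFDerivAt, ← hasFDerivWithinAt_univ, hasFDerivWithinAt_euclidean]
  intro i
  rw [hasFDerivWithinAt_univ]
  exact h i

theorem isGradientFlowLine_lineCurve (hε : 0 < ε) (i : LeafIndex 2) :
    IsGradientFlowLine (H₁ ε) (lineCurve ε i) := by
  have hs : ∀ j : Fin 2, dV₁ ε (-sgn j * saddle ε) = 0 := fun j => by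
    rw [dV₁_eq hε, mul_pow, neg_sq, sgn_sq]; ring
  have hexp : ∀ (σ t : ℝ), HasDerivAt (fun t => σ * Real.exp t) (σ * Real.exp t) t :=
    fun σ t => (Real.hasDerivAt_exp t).const_mul σ
  refine ⟨fun t => ?_, fun t h => ?_⟩
  · rw [gradient_H₁]
    refine hasDerivAt_plane fun k => ?_
    match i with
    | .rigid j b =>
      fin_cases k
      · simpa [lineCurve, neg_mul, ← neg_mul, hs] using hasDerivAt_const t (-sgn j * saddle ε)
      · exact hexp (sgn (j + b)) t
    | .cylinder j =>
      fin_cases k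
      · exact hasDerivAt_invW_exp hε (-sgn j) t
      · exact hasDerivAt_const t (0 : ℝ)
    | .plane j τ =>
      fin_cases k
      · exact hasDerivAt_invW_exp hε (sgn j * lineParam τ) t
      · exact hexp (sgn j) t
  · rw [gradient_H₁] at h
    have h0 := congrArg (fun z : Plane => z 0) h
    have h1 := congrArg (fun z : Plane => z 1) h
    match i with
    | .rigid j b => simp [lineCurve, sgn_ne_zero] at h1
    | .plane j τ => simp [lineCurve, sgn_ne_zero] at h1
    | .cylinder j =>
      have hx := abs_invW_lt hε (-sgn j * Real.exp (8 * t))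
      have h2 := one_sub_pos hε hx
      have h3 : dV₁ ε (invW ε (-sgn j * Real.exp (8 * t))) = 0 := h0
      have h4 := coordW_invW hε (-sgn j * Real.exp (8 * t))
      have h5 : invW ε (-sgn j * Real.exp (8 * t)) ≠ 0 := fun h => by
        rw [h] at h4
        simp [coordW, sgn_ne_zero] at h4
      have h6 : dV₁ ε (invW ε (-sgn j * Real.exp (8 * t))) = 8 * invW ε (-sgn j * Real.exp (8 * t)) *
        (1 - 2 * ε * invW ε (-sgn j * Real.exp (8 * t)) ^ 2) := by rw [dV₁]; ring
      rw [h6] at h3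
      exact mul_ne_zero (mul_ne_zero (by norm_num) h5) h2.ne' h3

theorem exp_log_sgn {j : Fin 2} {y : ℝ} (h : 0 < sgn j * y) :
    sgn j * Real.exp (Real.log (sgn j * y)) = y := by
  rw [Real.exp_log h, ← mul_assoc, sgn_mul_self, one_mul]

theorem mem_range_lineCurve (hε : 0 < ε) {i : LeafIndex 2} {z : Plane} :
    z ∈ range (lineCurve ε i) ↔ OnLine ε i (z 0) (z 1) := by
  have hpos : ∀ (j : Fin 2) (t : ℝ), 0 < sgn j * (sgn j * Real.exp t) := fun j t => by
    rw [← mul_assoc, sgn_mul_self, one_mul]; exact Real.exp_pos t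
  have h8 : ∀ t : ℝ, Real.exp (8 * t) = Real.exp t ^ 8 := fun t => by
    rw [← Real.exp_nat_mul]; norm_num
  have hs8 : ∀ j : Fin 2, sgn j ^ 8 = 1 := fun j => by
    rw [show sgn j ^ 8 = (sgn j ^ 2) ^ 4 by ring, sgn_sq, one_pow]
  match i with
  | .rigid j b =>
    constructor
    · rintro ⟨t, rfl⟩
      exact ⟨rfl, hpos _ t⟩
    · rintro ⟨h1, h2⟩
      refine ⟨Real.log (sgn (j + b) * z 1), ?_⟩
      ext k; fin_cases k
      · exact h1.symm
      · exact exp_log_sgn h2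
  | .cylinder j =>
    constructor
    · rintro ⟨t, rfl⟩
      have hx := abs_invW_lt hε (-sgn j * Real.exp (8 * t))
      refine ⟨rfl, (coordW_mul_self_pos hε hx).1 ?_, hx⟩
      rw [coordW_invW hε, ← mul_assoc, neg_mul_neg, sgn_mul_self, one_mul]
      exact Real.exp_pos _
    · rintro ⟨h1, h2, h3⟩
      have h4 := (coordW_mul_self_pos hε h3).2 h2
      refine ⟨Real.log (-sgn j * coordW ε (z 0)) / 8, ?_⟩
      ext k; fin_cases k
      · change invW ε (-sgn j * Real.exp (8 * (Real.log (-sgn j * coordW ε (z 0)) / 8))) = z 0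
        rw [mul_div_cancel₀ _ (by norm_num), Real.exp_log h4, ← mul_assoc, neg_mul_neg, sgn_mul_self,
          one_mul, invW_coordW hε h3]
      · exact h1.symm
  | .plane j τ =>
    constructor
    · rintro ⟨t, rfl⟩
      refine ⟨abs_invW_lt hε _, hpos _ t, ?_⟩
      change coordW ε (invW ε (sgn j * lineParam τ * Real.exp (8 * t))) =
        sgn j * lineParam τ * (sgn j * Real.exp t) ^ 8
      rw [coordW_invW hε, mul_pow, hs8, h8, one_mul]
    · rintro ⟨h1, h2, h3⟩
      refine ⟨Real.log (sgn j * z 1), ?_⟩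
      ext k; fin_cases k
      · change invW ε (sgn j * lineParam τ * Real.exp (8 * Real.log (sgn j * z 1))) = z 0
        rw [h8, Real.exp_log h2, mul_pow, hs8, one_mul, ← h3, invW_coordW hε h1]
      · exact exp_log_sgn h2

/-! ### The leaves -/

theorem V₁_saddle_lt (hε : 0 < ε) (hE : 1 / ε < E) (j : Fin 2) : V₁ ε (-sgn j * saddle ε) < E := by
  rwa [V₁_saddle hε]
  rw [mul_pow, neg_sq, sgn_sq, one_mul]

theorem energy_pos (hε : 0 < ε) (hE : 1 / ε < E) : 0 < E := lt_trans (by positivity) hE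

/-- The parametrizations of the leaves. -/
noncomputable def leafParam (hε : 0 < ε) (hE : 1 / ε < E) : LeafIndex 2 → ℂ → Phase
  | .rigid j b => (rigidProfile (V₁_saddle_lt hε hE j)).param (sgn (j + b))
  | .cylinder j => cylinderParam ε E (-sgn j)
  | .plane j τ => (Classical.choose
      (exists_planeProfile hε (energy_pos hε hE) (sgn j * lineParam τ))).param (sgn j)

theorem image_leafParam (hε : 0 < ε) (hE : 1 / ε < E) (i : LeafIndex 2) :
    leafParam hε hE i '' i.domain = leafSet ε E i := by
  match i with
  | .rigid j b =>
    exact (CapProfile.image_param _ hε (sgn_sq _)).trans rfl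
  | .cylinder j =>
    refine (image_cylinderParam hε hE (by rw [neg_sq, sgn_sq])).trans rfl
  | .plane j τ =>
    refine (CapProfile.image_param _ hε (sgn_sq _)).trans ?_
    rw [Classical.choose_spec (exists_planeProfile hε (energy_pos hε hE) (sgn j * lineParam τ))]
    ext p
    refine and_congr_right fun _ => ⟨fun h => ?_, fun h => ⟨?_, h.2.1⟩⟩
    · refine ⟨?_, h.2, ?_⟩
      · rw [h.1]; exact abs_invW_lt hε _
      · rw [h.1, coordW_invW hε]; ring
    · beta_reduce
      rw [show (sgn j * lineParam τ * (p 2 ^ 2) ^ 4) = sgn j * lineParam τ * p 2 ^ 8 by ring,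
        ← h.2.2, invW_coordW hε h.1]

theorem isSmoothEmbeddingOn_leafParam (hε : 0 < ε) (hE : 1 / ε < E) (i : LeafIndex 2) :
    IsSmoothEmbeddingOn (leafParam hε hE i) i.domain := by
  match i with
  | .rigid j b => exact CapProfile.isSmoothEmbeddingOn_param _ hε (sgn_sq _)
  | .cylinder j => exact isSmoothEmbeddingOn_cylinderParam hε hE (by rw [neg_sq, sgn_sq])
  | .plane j τ => exact CapProfile.isSmoothEmbeddingOn_param _ hε (sgn_sq _)

theorem isOpen_domain (i : LeafIndex 2) : IsOpen i.domain := by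
  match i with
  | .rigid _ _ => exact isOpen_univ
  | .cylinder _ => exact isOpen_compl_singleton
  | .plane _ _ => exact isOpen_univ

theorem leafSet_subset (hε : 0 < ε) (i : LeafIndex 2) : leafSet ε E i ⊆ regionS ε E :=
  fun _ hp => mem_regionS_iff.2 ⟨hp.1, OnLine.abs_le hε hp.2⟩

/-- The Hamiltonian flow is transverse to the leaves. -/
theorem hamVec_notMem_range (hε : 0 < ε) (hE : 1 / ε < E) (i : LeafIndex 2) {z : ℂ}
    (hz : z ∈ i.domain) :
    hamVec (starkH ε) (leafParam hε hE i z) ∉ range (fderiv ℝ (leafParam hε hE i) z) := by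
  have hmem : ∀ w ∈ i.domain, leafParam hε hE i w ∈ leafSet ε E i := fun w hw => by
    rw [← image_leafParam hε hE]; exact mem_image_of_mem _ hw
  have hp := hmem z hz
  obtain ⟨O, g, hg, hpO⟩ := exists_leafChart hε E (OnLine.abs_le hε hp.2)
    (OnLine.not_binding hp.2)
  rintro ⟨v, hv⟩
  have hf : DifferentiableAt ℝ (leafParam hε hE i) z :=
    ((isSmoothEmbeddingOn_leafParam hε hE i).1.contDiffAt
      ((isOpen_domain i).mem_nhds hz)).differentiableAt (by simp)
  have hgd : DifferentiableAt ℝ g (leafParam hε hE i z) :=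
    (hg.2.1.contDiffAt (hg.1.mem_nhds hpO)).differentiableAt (by simp)
  have h1 := hgd.hasFDerivAt.comp z hf.hasFDerivAt
  -- The chart is constant on the leaf, so its derivative kills tangent vectors of the leaf, but not
  -- the Hamiltonian vector.
  have h2 : HasFDerivAt (g ∘ leafParam hε hE i) (0 : ℂ →L[ℝ] ℝ) z := by
    refine (hasFDerivAt_const (g (leafParam hε hE i z)) z).congr_of_eventuallyEq ?_
    filter_upwards [(isOpen_domain i).mem_nhds hz,
      hf.continuousAt.preimage_mem_nhds (hg.1.mem_nhds hpO)] with w hw hwO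
    exact (hg.2.2.2 i i _ _ ⟨hwO, hmem w hw⟩ ⟨hpO, hp⟩).1 rfl
  have h3 := congrArg (fun L : ℂ →L[ℝ] ℝ => L v) (h1.unique h2)
  simp only [ContinuousLinearMap.comp_apply, zero_apply] at h3
  rw [hv] at h3
  exact hg.2.2.1 _ hpO h3

theorem trace_plane_profile (hε : 0 < ε) (hE : 1 / ε < E) (C : ℝ) :
    (Classical.choose (exists_planeProfile hε (energy_pos hε hE) C)).X 0 = 0 := by
  rw [Classical.choose_spec (exists_planeProfile hε (energy_pos hε hE) C)]
  simp [invW]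

theorem isAsymptotic_rigid (hε : 0 < ε) (hE : 1 / ε < E) (j b : Fin 2)
    {P : PeriodicOrbit (starkH ε) E} (hP : P.trace = fiber ε E (-sgn j * saddle ε)) :
    IsAsymptotic (leafParam hε hE (.rigid j b)) atTop P :=
  CapProfile.isAsymptotic_param _ hε _ (V₁_saddle_lt hε hE j) hP

theorem isAsymptotic_plane (hε : 0 < ε) (hE : 1 / ε < E) (j : Fin 2) (τ : Ioo (0 : ℝ) 1)
    {P : PeriodicOrbit (starkH ε) E} (hP : P.trace = fiber ε E 0) :
    IsAsymptotic (leafParam hε hE (.plane j τ)) atTop P := by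
  have h0 := trace_plane_profile hε hE (sgn j * lineParam τ)
  exact CapProfile.isAsymptotic_param _ hε _ ((V₁_le hε _).trans_lt hE) (by rw [h0]; exact hP)

theorem isAsymptotic_cylinder_zero (hε : 0 < ε) (hE : 1 / ε < E) (j : Fin 2)
    {P : PeriodicOrbit (starkH ε) E} (hP : P.trace = fiber ε E (-sgn j * saddle ε)) :
    IsAsymptotic (leafParam hε hE (.cylinder j)) (𝓝[>] 0) P := by
  refine isAsymptotic_cylinderParam hε hE (l := 𝓝[>] 0) self_mem_nhdsWithin ?_ hP
  have hc : ContinuousAt (fun r : ℝ => -sgn j / √(r ^ 2 + 2 * ε)) 0 := by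
    refine ContinuousAt.div (by fun_prop) (by fun_prop) ?_
    simp [Real.sqrt_ne_zero', hε]
  have := hc.tendsto.mono_left (nhdsWithin_le_nhds (s := Ioi 0))
  simpa [saddle, div_eq_mul_inv] using this

theorem isAsymptotic_cylinder_top (hε : 0 < ε) (hE : 1 / ε < E) (j : Fin 2)
    {P : PeriodicOrbit (starkH ε) E} (hP : P.trace = fiber ε E 0) :
    IsAsymptotic (leafParam hε hE (.cylinder j)) atTop P := by
  refine isAsymptotic_cylinderParam hε hE (eventually_gt_atTop 0) ?_ hP
  refine tendsto_const_nhds.div_atTop (Real.tendsto_sqrt_atTop.comp ?_)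
  exact tendsto_atTop_add_const_right _ _ (tendsto_pow_atTop two_ne_zero)

end

section
variable {ε E : ℝ}

/-! ### The Hill region -/

theorem potential_le_iff (hε : 0 < ε) {x : Plane} :
    potential ε x ≤ E ↔ coordQ ε (x 1) ^ 2 ≤ 2 * (E - V₁ ε (x 0)) := by
  rw [potential, V₂_eq_coordQ hε]
  constructor <;> intro h <;> linarith

theorem potential_eq_iff (hε : 0 < ε) {x : Plane} :
    potential ε x = E ↔ coordQ ε (x 1) ^ 2 = 2 * (E - V₁ ε (x 0)) := by
  rw [potential, V₂_eq_coordQ hε]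
  constructor <;> intro h <;> linarith

/-- The half-width of the Hill region in the coordinate `Q` over `x₁ = x`. -/
noncomputable def width (ε E x : ℝ) : ℝ := √(2 * (E - V₁ ε x))

theorem two_mul_pos (hε : 0 < ε) (hE : 1 / ε < E) (x : ℝ) : 0 < 2 * (E - V₁ ε x) := by
  linarith [V₁_le hε x]

theorem width_pos (hε : 0 < ε) (hE : 1 / ε < E) (x : ℝ) : 0 < width ε E x :=
  Real.sqrt_pos.2 (two_mul_pos hε hE x)

theorem width_sq (hε : 0 < ε) (hE : 1 / ε < E) (x : ℝ) : width ε E x ^ 2 = 2 * (E - V₁ ε x) :=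
  Real.sq_sqrt (two_mul_pos hε hE x).le

theorem contDiff_width (hε : 0 < ε) (hE : 1 / ε < E) : ContDiff ℝ ∞ (width ε E) :=
  (contDiff_const.mul (contDiff_const.sub (contDiff_V₁ ε))).sqrt fun x => (two_mul_pos hε hE x).ne'

/-- Straightening of the Hill region. -/
noncomputable def hillHomeomorph (hε : 0 < ε) (hE : 1 / ε < E) : Plane ≃ₜ ℂ where
  toFun x := ⟨x 0, coordQ ε (x 1) / width ε E (x 0)⟩
  invFun z := !₂[z.re, invQ ε (z.im * width ε E z.re)]
  left_inv x := by
    ext i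
    fin_cases i
    · rfl
    · simp [div_mul_cancel₀ _ (width_pos hε hE (x 0)).ne', invQ_coordQ hε]
  right_inv z := by
    apply Complex.ext
    · rfl
    · simp [coordQ_invQ hε, mul_div_cancel_right₀ _ (width_pos hε hE z.re).ne']
  continuous_toFun := by
    have h1 : Continuous fun x : Plane => coordQ ε (x 1) :=
      (continuous_coordQ hε).comp (by fun_prop)
    have h2 : Continuous fun x : Plane => width ε E (x 0) :=
      (contDiff_width hε hE).continuous.comp (by fun_prop)
    have h3 := h1.div h2 fun x => (width_pos hε hE (x 0)).ne'
    have h4 : Continuous fun x : Plane => (x 0, coordQ ε (x 1) / width ε E (x 0)) :=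
      (by fun_prop : Continuous fun x : Plane => x 0).prodMk h3
    exact Complex.equivRealProdCLM.symm.continuous.comp h4
  continuous_invFun := by
    have h2 : Continuous fun z : ℂ => width ε E z.re :=
      (contDiff_width hε hE).continuous.comp Complex.continuous_re
    have h1 : Continuous fun z : ℂ => invQ ε (z.im * width ε E z.re) :=
      (continuous_invQ hε).comp (Complex.continuous_im.mul h2)
    refine (PiLp.continuous_toLp 2 _).comp (continuous_pi fun i => ?_)
    fin_cases i
    · exact Complex.continuous_re
    · exact h1

/-- Dividing `Q` by its largest value over `x₁`, which never vanishes, straightens the Hill region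
to a rectangle. -/
theorem regionK_eq_preimage (hε : 0 < ε) (hE : 1 / ε < E) :
    regionK ε E = hillHomeomorph hε hE ⁻¹'
      (Icc (-saddle ε) (saddle ε) ×ℂ Icc (-1) 1) := by
  ext x
  have hw := width_pos hε hE (x 0)
  change potential ε x ≤ E ∧ |x 0| ≤ saddle ε ↔
    x 0 ∈ Icc (-saddle ε) (saddle ε) ∧ coordQ ε (x 1) / width ε E (x 0) ∈ Icc (-1 : ℝ) 1
  rw [potential_le_iff hε, ← width_sq hε hE, sq_le_sq, abs_of_pos hw, mem_Icc, mem_Icc, ← abs_le,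
    ← abs_le, abs_div, abs_of_pos hw, div_le_one hw, and_comm]

theorem regionK_homeomorph (hε : 0 < ε) (hE : 1 / ε < E) :
    Nonempty (regionK ε E ≃ₜ Metric.closedBall (0 : ℂ) 1) := by
  set s : Set ℂ := Icc (-saddle ε) (saddle ε) ×ℂ Icc (-1) 1 with hs
  have ha := saddle_pos hε
  have hclosed : IsClosed s := isClosed_Icc.reProdIm isClosed_Icc
  have hconv : Convex ℝ s := by
    have h : s = Complex.reCLM ⁻¹' Icc (-saddle ε) (saddle ε) ∩ Complex.imCLM ⁻¹' Icc (-1) 1 := rfl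
    rw [h]
    exact ((convex_Icc _ _).linear_preimage Complex.reCLM.toLinearMap).inter
      ((convex_Icc _ _).linear_preimage Complex.imCLM.toLinearMap)
  have hint : (interior s).Nonempty := by
    refine ⟨0, ?_⟩
    rw [hs, Complex.interior_reProdIm, interior_Icc, interior_Icc]
    exact ⟨by simpa using ha, by simp⟩
  have hbdd : Bornology.IsBounded s := (Metric.isBounded_Icc _ _).reProdIm (Metric.isBounded_Icc _ _)
  obtain ⟨h, -, hcl, -⟩ := exists_homeomorph_image_interior_closure_frontier_eq_unitBall hconv hint hbdd
  rw [hclosed.closure_eq] at hcl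
  have himg : ((hillHomeomorph hε hE).trans h) '' regionK ε E = Metric.closedBall 0 1 := by
    rw [← hcl, regionK_eq_preimage hε hE]
    change (h ∘ hillHomeomorph hε hE) '' _ = _
    rw [image_comp, image_preimage_eq _ (hillHomeomorph hε hE).surjective]
  exact ⟨(Homeomorph.image _ _).trans (Homeomorph.setCongr himg)⟩

theorem projX_image_fiber (s : ℝ) :
    projX '' fiber ε E s = {x | x 0 = s ∧ potential ε x ≤ E} := by
  ext x
  constructor
  · rintro ⟨p, ⟨h1, h2, h3⟩, rfl⟩
    refine ⟨h2, ?_⟩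
    rw [starkH_eq] at h1
    change V₁ ε (p 0) + V₂ ε (p 1) ≤ E
    nlinarith [sq_nonneg (p 2), sq_nonneg (p 3)]
  · rintro ⟨h1, h2⟩
    -- All kinetic energy goes into `y₂`.
    refine ⟨!₂[x 0, x 1, 0, √(2 * (E - potential ε x))], ⟨?_, h1, rfl⟩, ?_⟩
    · rw [starkH_eq]
      simp only [Matrix.cons_val_zero, Matrix.cons_val, Matrix.cons_val_one]
      rw [Real.sq_sqrt (by linarith), potential]; ring
    · ext i; fin_cases i <;> rfl

theorem projX_image_regionS : projX '' regionS ε E = regionK ε E := by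
  ext x
  constructor
  · rintro ⟨p, hp, rfl⟩
    exact hp.2
  · intro hx
    refine ⟨!₂[x 0, x 1, 0, √(2 * (E - potential ε x))], ⟨?_, ?_⟩, ?_⟩
    · rw [starkH_eq]
      simp only [Matrix.cons_val_zero, Matrix.cons_val, Matrix.cons_val_one]
      rw [Real.sq_sqrt (by linarith [hx.1]), potential]; ring
    · convert hx using 1
      ext i; fin_cases i <;> rfl
    · ext i; fin_cases i <;> rfl

theorem frontier_regionK (hε : 0 < ε) (hE : 1 / ε < E) :
    frontier (regionK ε E) = projX '' fiber ε E (-saddle ε) ∪ projX '' fiber ε E (saddle ε) ∪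
      {x | potential ε x = E ∧ |x 0| ≤ saddle ε} := by
  have ha := saddle_pos hε
  have ha' : -saddle ε ≤ saddle ε := by linarith
  rw [regionK_eq_preimage hε hE, ← Homeomorph.preimage_frontier, Complex.frontier_reProdIm,
    isClosed_Icc.closure_eq, isClosed_Icc.closure_eq, frontier_Icc ha', frontier_Icc (by norm_num),
    projX_image_fiber, projX_image_fiber]
  ext x
  have hw := width_pos hε hE (x 0)
  have e1 : coordQ ε (x 1) / width ε E (x 0) ∈ Icc (-1 : ℝ) 1 ↔ potential ε x ≤ E := by
    rw [potential_le_iff hε, ← width_sq hε hE, sq_le_sq, abs_of_pos hw, mem_Icc, ← abs_le,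
      abs_div, abs_of_pos hw, div_le_one hw]
  have e2 : coordQ ε (x 1) / width ε E (x 0) ∈ ({-1, 1} : Set ℝ) ↔ potential ε x = E := by
    rw [potential_eq_iff hε, ← width_sq hε hE, sq_eq_sq_iff_eq_or_eq_neg, mem_insert_iff,
      mem_singleton_iff, div_eq_iff hw.ne', div_eq_iff hw.ne', neg_one_mul, one_mul, or_comm]
  change (x 0 ∈ Icc (-saddle ε) (saddle ε) ∧
      coordQ ε (x 1) / width ε E (x 0) ∈ ({-1, 1} : Set ℝ)) ∨
    (x 0 ∈ ({-saddle ε, saddle ε} : Set ℝ) ∧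
      coordQ ε (x 1) / width ε E (x 0) ∈ Icc (-1 : ℝ) 1) ↔
    ((x 0 = -saddle ε ∧ potential ε x ≤ E) ∨ (x 0 = saddle ε ∧ potential ε x ≤ E)) ∨
      (potential ε x = E ∧ |x 0| ≤ saddle ε)
  rw [e1, e2, mem_Icc, ← abs_le, mem_insert_iff, mem_singleton_iff]
  tauto

/-! ### The region `S_E` -/

/-- A critical point has `x₂ = 0` and `y = 0`, hence energy `V₁ ≤ 1/ε < E`. -/
theorem gradient_ne_zero (hε : 0 < ε) (hE : 1 / ε < E) {p : Phase} (hp : p ∈ regionS ε E) :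
    gradient (starkH ε) p ≠ 0 := by
  intro h
  rw [gradient_starkH] at h
  have h1 : dV₂ ε (p 1) = 0 := congrArg (fun p : Phase => p 1) h
  have h2 : p 2 = 0 := congrArg (fun p : Phase => p 2) h
  have h3 : p 3 = 0 := congrArg (fun p : Phase => p 3) h
  have h4 : p 1 = 0 := by
    have : p 1 * (8 + 16 * ε * p 1 ^ 2) = 0 := by rw [← h1, dV₂]; ring
    exact (mul_eq_zero.1 this).resolve_right (by positivity)
  have h5 := (mem_regionS_iff.1 hp).1
  rw [starkH_eq, h2, h3, h4] at h5
  have h6 := V₁_le hε (p 0)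
  simp [V₂] at h5
  linarith

/-- The boundary of `S_E` in the energy surface lies over the saddles. -/
theorem regionS_inter_closure (hε : 0 < ε) (hE : 1 / ε < E) :
    regionS ε E ∩ closure (starkH ε ⁻¹' {E} \ regionS ε E) =
      {p | starkH ε p = E ∧ |p 0| = saddle ε} := by
  have ha := saddle_pos hε
  ext p
  constructor
  · rintro ⟨hp, hcl⟩
    have hp' := mem_regionS_iff.1 hp
    refine ⟨hp'.1, le_antisymm hp'.2 ?_⟩
    have hsub : starkH ε ⁻¹' {E} \ regionS ε E ⊆ {p | saddle ε ≤ |p 0|} := fun q hq => by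
      by_contra hcon
      exact hq.2 (mem_regionS_iff.2 ⟨hq.1, (not_le.1 hcon).le⟩)
    exact closure_minimal hsub (isClosed_le continuous_const (continuous_coord 0).abs) hcl
  · rintro ⟨h1, h2⟩
    refine ⟨mem_regionS_iff.2 ⟨h1, h2.le⟩, ?_⟩
    -- The point is pushed outward in `x₁`, and `(Q, y₁, y₂)` is scaled by the ratio of the radii of
    -- the slices to preserve the energy.
    let l : ℝ → ℝ := fun δ => width ε E ((1 + δ) * p 0) / width ε E (p 0)
    have hl : Continuous l := by
      refine Continuous.div_const ((contDiff_width hε hE).continuous.comp (by fun_prop)) _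
    let γ : ℝ → Phase := fun δ => mkPhase ε ((1 + δ) * p 0) (l δ * p 2) (l δ * coordQ ε (p 1))
      (l δ * p 3)
    have hγ : Continuous γ :=
      (continuous_mkPhase hε).comp (by fun_prop : Continuous fun δ : ℝ =>
        ((1 + δ) * p 0, l δ * p 2, l δ * coordQ ε (p 1), l δ * p 3))
    have hγ0 : γ 0 = p := by
      have : l 0 = 1 := by simp [l, (width_pos hε hE (p 0)).ne']
      simp only [γ, this, add_zero, one_mul, mkPhase_self hε]
    have ht : Tendsto γ (𝓝[>] 0) (𝓝 p) := by
      conv => rw [← hγ0]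
      exact (hγ.tendsto 0).mono_left nhdsWithin_le_nhds
    refine mem_closure_of_tendsto ht ?_
    filter_upwards [self_mem_nhdsWithin] with δ hδ
    have hδ' : 0 < δ := hδ
    refine ⟨?_, fun h => ?_⟩
    · change starkH ε (γ δ) = E
      have hl2 : l δ ^ 2 * (2 * (E - V₁ ε (p 0))) = 2 * (E - V₁ ε ((1 + δ) * p 0)) := by
        rw [div_pow, width_sq hε hE, width_sq hε hE]
        exact div_mul_cancel₀ _ (two_mul_pos hε hE (p 0)).ne'
      rw [starkH_eq_coordQ hε] at h1
      rw [starkH_mkPhase hε]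
      linear_combination (1 / 2 : ℝ) * hl2 + l δ ^ 2 * h1
    · have h3 := (mem_regionS_iff.1 h).2
      simp only [γ, mkPhase_zero] at h3
      rw [abs_mul, h2, abs_of_pos (by linarith)] at h3
      nlinarith

theorem isEmbeddedSphere_fiber (hε : 0 < ε) (hE : 1 / ε < E) (s : ℝ) :
    IsEmbeddedSphere {p | starkH ε p = E ∧ p 0 = s} := by
  set R := width ε E s with hRdef
  have hR := width_pos hε hE s
  have hR2 := width_sq hε hE s
  rw [← hRdef] at hR hR2
  let g : EuclideanSpace ℝ (Fin 3) → Phase := fun v => mkPhase ε s (R * v 0) (R * v 1) (R * v 2)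
  let G : Phase → EuclideanSpace ℝ (Fin 3) := fun p =>
    !₂[p 2 / R, coordQ ε (p 1) / R, p 3 / R]
  have hg : ContDiff ℝ ∞ g :=
    ContDiff.mkPhase hε contDiff_const (by fun_prop) (by fun_prop) (by fun_prop)
  have hGg : ∀ v, G (g v) = v := fun v => by
    ext i
    fin_cases i <;> simp [G, g, coordQ_invQ hε, hR.ne']
  have hG : Differentiable ℝ G := fun p => by
    rw [differentiableAt_euclidean]
    have h3 : DifferentiableAt ℝ (fun p : Phase => coordQ ε (p 1)) p :=
      ((contDiff_coordQ hε).differentiable (by simp) _).comp p (by fun_prop)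
    intro i
    fin_cases i
    · exact (by fun_prop : DifferentiableAt ℝ (fun p : Phase => p 2 / R) p)
    · exact (h3.mul_const R⁻¹ : DifferentiableAt ℝ (fun p : Phase => coordQ ε (p 1) * R⁻¹) p)
    · exact (by fun_prop : DifferentiableAt ℝ (fun p : Phase => p 3 / R) p)
  refine ⟨g, univ, isOpen_univ, subset_univ _, hg.contDiffOn,
    (Function.LeftInverse.injective hGg).injOn, fun p _ v _ hv => ?_, ?_⟩
  · have := injective_fderiv_of_leftInverse (hg.differentiable (by simp) p) (hG _)
      (Eventually.of_forall hGg)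
    exact this (by rw [hv, map_zero])
  · have hmem : ∀ v : EuclideanSpace ℝ (Fin 3),
        v ∈ Metric.sphere (0 : EuclideanSpace ℝ (Fin 3)) 1 ↔ v 0 ^ 2 + v 1 ^ 2 + v 2 ^ 2 = 1 :=
      fun v => by
        rw [mem_sphere_zero_iff_norm, ← sq_eq_sq₀ (norm_nonneg _) zero_le_one,
          EuclideanSpace.real_norm_sq_eq, Fin.sum_univ_three, one_pow]
    ext p
    constructor
    · rintro ⟨v, hv, rfl⟩
      rw [hmem] at hv
      refine ⟨?_, rfl⟩
      rw [starkH_mkPhase hε]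
      linear_combination (R ^ 2 / 2) * hv + (1 / 2 : ℝ) * hR2
    · rintro ⟨h1, h2⟩
      refine ⟨G p, ?_, ?_⟩
      · rw [hmem]
        rw [starkH_eq_coordQ hε, h2] at h1
        simp only [G, Matrix.cons_val_zero, Matrix.cons_val, Matrix.cons_val_one]
        field_simp
        linear_combination 2 * h1 - hR2
      · simp only [g, G, Matrix.cons_val_zero, Matrix.cons_val, Matrix.cons_val_one,
          mul_div_cancel₀ _ hR.ne']
        rw [← h2, mkPhase_self hε]

/-- The orbit over the origin bounds a hemisphere. -/
theorem isUnknottedIn_center (hε : 0 < ε) (hE : 1 / ε < E) {P : PeriodicOrbit (starkH ε) E}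
    (hP : P.trace = fiber ε E 0) : P.IsUnknottedIn (regionS ε E) := by
  set R := width ε E 0 with hRdef
  have hR := width_pos hε hE 0
  have hR2 := width_sq hε hE 0
  rw [← hRdef] at hR hR2
  have hV0 : V₁ ε 0 = 0 := by simp [V₁]
  rw [hV0, sub_zero] at hR2
  have hn : ∀ z : ℂ, 0 < 1 + Complex.normSq z := fun z => by linarith [Complex.normSq_nonneg z]
  -- Inverse stereographic projection onto the sphere over `x₁ = 0`: the unit disk covers the
  -- hemisphere `y₁ ≥ 0` and its boundary the orbit. `G` is the projection back.
  let f : ℂ → Phase := fun z => mkPhase ε 0 (R * (1 - Complex.normSq z) / (1 + Complex.normSq z))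
    (2 * R * z.re / (1 + Complex.normSq z)) (2 * R * z.im / (1 + Complex.normSq z))
  let G : Phase → ℂ := fun p => (((R + p 2)⁻¹ : ℝ) : ℂ) * ((coordQ ε (p 1) : ℂ) + p 3 * Complex.I)
  have hns := contDiff_normSq
  have hre : ContDiff ℝ ∞ fun z : ℂ => z.re := Complex.reCLM.contDiff
  have him : ContDiff ℝ ∞ fun z : ℂ => z.im := Complex.imCLM.contDiff
  have hd : ContDiff ℝ ∞ fun z : ℂ => 1 + Complex.normSq z := contDiff_const.add hns
  have hf : ContDiff ℝ ∞ f := ContDiff.mkPhase hε contDiff_const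
    ((contDiff_const.mul (contDiff_const.sub hns)).div hd fun z => (hn z).ne')
    ((contDiff_const.mul hre).div hd fun z => (hn z).ne')
    ((contDiff_const.mul him).div hd fun z => (hn z).ne')
  have hden : ∀ z, R + f z 2 = 2 * R / (1 + Complex.normSq z) := fun z => by
    have := (hn z).ne'
    simp only [f, mkPhase_two]
    field_simp
    ring
  have hdpos : ∀ z, 0 < 2 * R / (1 + Complex.normSq z) := fun z => div_pos (by linarith) (hn z)
  have hGf : ∀ z, G (f z) = z := fun z => by
    have := (hn z).ne'
    simp only [G]
    rw [hden]
    simp only [f, mkPhase_one, mkPhase_three, coordQ_invQ hε]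
    generalize 1 + Complex.normSq z = n at *
    apply Complex.ext
    · rw [Complex.re_ofReal_mul]; simp; field_simp
    · rw [Complex.im_ofReal_mul]; simp; field_simp
  have hG : ∀ z, DifferentiableAt ℝ G (f z) := fun z => by
    have h2 : DifferentiableAt ℝ (fun p : Phase => (R + p 2)⁻¹) (f z) := by
      refine DifferentiableAt.inv (by fun_prop) ?_
      rw [hden]; exact (hdpos z).ne'
    have h3 : DifferentiableAt ℝ (fun p : Phase => coordQ ε (p 1)) (f z) :=
      ((contDiff_coordQ hε).differentiable (by simp) _).comp _ (by fun_prop)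
    have h4 : DifferentiableAt ℝ (fun p : Phase => p 3) (f z) := by fun_prop
    exact (Complex.ofRealCLM.differentiableAt.comp _ h2).mul
      ((Complex.ofRealCLM.differentiableAt.comp _ h3).add
        ((Complex.ofRealCLM.differentiableAt.comp _ h4).mul_const Complex.I))
  have hH : ∀ z, starkH ε (f z) = E := fun z => by
    rw [starkH_mkPhase hε, hV0]
    have h := (hn z).ne'
    have h2 : z.re ^ 2 + z.im ^ 2 = Complex.normSq z := by rw [Complex.normSq_apply]; ring
    have : (2 * R * z.re / (1 + Complex.normSq z)) ^ 2 +
        (R * (1 - Complex.normSq z) / (1 + Complex.normSq z)) ^ 2 +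
        (2 * R * z.im / (1 + Complex.normSq z)) ^ 2 =
        R ^ 2 * (4 * (z.re ^ 2 + z.im ^ 2) + (1 - Complex.normSq z) ^ 2) /
          (1 + Complex.normSq z) ^ 2 := by
      field_simp; ring
    rw [this, h2, hR2]
    field_simp
    ring
  refine ⟨f, hf, (Function.LeftInverse.injective hGf).injOn, fun z _ =>
    injective_fderiv_of_leftInverse (hf.differentiable (by simp) z) (hG z)
      (Eventually.of_forall hGf), ?_, ?_⟩
  · rintro _ ⟨z, -, rfl⟩
    refine mem_regionS_iff.2 ⟨hH z, ?_⟩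
    simpa [f] using (saddle_pos hε).le
  · rw [hP]
    ext p
    constructor
    · rintro ⟨z, hz, rfl⟩
      have hz1 : Complex.normSq z = 1 := by
        rw [Complex.normSq_eq_norm_sq, mem_sphere_zero_iff_norm.1 hz, one_pow]
      exact ⟨hH z, rfl, by simp [f, hz1]⟩
    · rintro ⟨h1, h2, h3⟩
      rw [starkH_eq_coordQ hε, h2, h3, hV0] at h1
      have hz1 : Complex.normSq ⟨coordQ ε (p 1) / R, p 3 / R⟩ = 1 := by
        rw [Complex.normSq_mk]
        field_simp
        linear_combination 2 * h1 - hR2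
      refine ⟨⟨coordQ ε (p 1) / R, p 3 / R⟩, ?_, ?_⟩
      · rw [mem_sphere_zero_iff_norm, ← sq_eq_sq₀ (norm_nonneg _) zero_le_one,
          ← Complex.normSq_eq_norm_sq, hz1, one_pow]
      · simp only [f, hz1]
        have e : ∀ x : ℝ, 2 * R * (x / R) / (1 + 1) = x := fun x => by field_simp; ring
        rw [e, e, sub_self, mul_zero, zero_div]
        conv_rhs => rw [← mkPhase_self hε p]
        rw [h2, h3]

/-- With `q₀ = x₁/(2a)`, the slice over `x₁` is rescaled to radius `√(1 - q₀²)`. The saddles go to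
`q₀ = ±1/2`, which is where balls of radius `1` about the poles cut the sphere, as `dist² = 2 ∓
2q₀`. Using `2a` instead of `a` leaves room for smooth extensions. -/
theorem isPuncturedThreeSphere_regionS (hε : 0 < ε) (hE : 1 / ε < E) :
    IsPuncturedThreeSphere (regionS ε E) 2 := by
  have ha := saddle_pos hε
  have hsq : ∀ v : Phase, ‖v‖ ^ 2 = v 0 ^ 2 + v 1 ^ 2 + v 2 ^ 2 + v 3 ^ 2 := fun v => by
    rw [EuclideanSpace.real_norm_sq_eq, Fin.sum_univ_four]
  have hmem : ∀ v : Phase, v ∈ Metric.sphere (0 : Phase) 1 ↔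
      v 0 ^ 2 + v 1 ^ 2 + v 2 ^ 2 + v 3 ^ 2 = 1 := fun v => by
    rw [mem_sphere_zero_iff_norm, ← sq_eq_sq₀ (norm_nonneg _) zero_le_one, hsq, one_pow]
  have hdist : ∀ (j : Fin 2) (v : Phase), v ∈ Metric.sphere (0 : Phase) 1 →
      dist v !₂[sgn j, 0, 0, 0] ^ 2 = 2 - 2 * sgn j * v 0 := fun j v hv => by
    rw [hmem] at hv
    rw [dist_eq_norm, hsq]
    simp
    linear_combination hv + sgn_sq j
  have hball : ∀ (j : Fin 2) (v : Phase), v ∈ Metric.sphere (0 : Phase) 1 →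
      (v ∈ Metric.ball (!₂[sgn j, 0, 0, 0] : Phase) 1 ↔ 1 / 2 < sgn j * v 0) := fun j v hv => by
    rw [Metric.mem_ball, ← sq_lt_sq₀ dist_nonneg zero_le_one, hdist j v hv]
    constructor <;> intro h <;> linarith
  have hcball : ∀ (j : Fin 2) (v : Phase), v ∈ Metric.sphere (0 : Phase) 1 →
      v ∈ Metric.closedBall (!₂[sgn j, 0, 0, 0] : Phase) 1 → 1 / 2 ≤ sgn j * v 0 := fun j v hv h => by
    rw [Metric.mem_closedBall, ← sq_le_sq₀ dist_nonneg zero_le_one, hdist j v hv] at h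
    linarith
  refine ⟨fun j => !₂[sgn j, 0, 0, 0], fun _ => 1, fun j => ⟨?_, one_pos, one_lt_two⟩,
    fun i j hij => ?_, ?_⟩
  · rw [hmem]; simp [sgn_sq]
  · refine Set.disjoint_left.2 ?_
    rintro v ⟨hv, h1⟩ ⟨-, h2⟩
    have h3 := hcball i v hv h1
    have h4 := hcball j v hv h2
    exact hij (eq_of_sgn_mul_pos (by linarith : 0 < sgn i * v 0) (by linarith : 0 < sgn j * v 0))
  let m : ℝ → ℝ := fun x => √(1 - (x / (2 * saddle ε)) ^ 2) / width ε E x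
  have hq1 : ∀ {x : ℝ}, |x| < 2 * saddle ε → 0 < 1 - (x / (2 * saddle ε)) ^ 2 := fun {x} hx => by
    have : |x / (2 * saddle ε)| < 1 := by
      rw [abs_div, abs_of_pos (by positivity : 0 < 2 * saddle ε), div_lt_one (by positivity)]
      exact hx
    have := (sq_lt_one_iff_abs_lt_one _).2 this
    linarith
  have hmpos : ∀ {x : ℝ}, |x| < 2 * saddle ε → 0 < m x := fun hx =>
    div_pos (Real.sqrt_pos.2 (hq1 hx)) (width_pos hε hE _)
  have hmsm : ∀ {x : ℝ}, |x| < 2 * saddle ε → ContDiffAt ℝ ∞ m x := fun {x} hx =>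
    ContDiffAt.div (ContDiffAt.sqrt (by fun_prop) (hq1 hx).ne')
      (contDiff_width hε hE).contDiffAt (width_pos hε hE x).ne'
  have hm2 : ∀ {x : ℝ}, |x| < 2 * saddle ε →
      m x ^ 2 * (2 * (E - V₁ ε x)) = 1 - (x / (2 * saddle ε)) ^ 2 := fun {x} hx => by
    rw [div_pow, Real.sq_sqrt (hq1 hx).le, width_sq hε hE]
    exact div_mul_cancel₀ _ (two_mul_pos hε hE x).ne'
  have hbd : ∀ {q : ℝ}, |q| < 1 → |2 * saddle ε * q| < 2 * saddle ε := fun {q} hq => by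
    rw [abs_mul, abs_of_pos (by positivity : 0 < 2 * saddle ε)]
    nlinarith
  let f : Phase → Phase := fun p => !₂[p 0 / (2 * saddle ε), coordQ ε (p 1) * m (p 0),
    p 2 * m (p 0), p 3 * m (p 0)]
  let g : Phase → Phase := fun q => mkPhase ε (2 * saddle ε * q 0)
    (q 2 * (m (2 * saddle ε * q 0))⁻¹) (q 1 * (m (2 * saddle ε * q 0))⁻¹)
    (q 3 * (m (2 * saddle ε * q 0))⁻¹)
  have h2a : 2 * saddle ε ≠ 0 := by positivity
  have hgf : ∀ p : Phase, |p 0| < 2 * saddle ε → g (f p) = p := fun p hp => by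
    have e : 2 * saddle ε * (p 0 / (2 * saddle ε)) = p 0 := mul_div_cancel₀ _ h2a
    have e2 : ∀ y : ℝ, y * m (p 0) * (m (p 0))⁻¹ = y := fun y =>
      mul_inv_cancel_right₀ (hmpos hp).ne' y
    simp only [f, g, Matrix.cons_val_zero, Matrix.cons_val, Matrix.cons_val_one, e, e2,
      mkPhase_self hε]
  have hfg : ∀ q : Phase, |q 0| < 1 → f (g q) = q := fun q hq => by
    have hm0 := (hmpos (hbd hq)).ne'
    ext i
    fin_cases i <;> simp [f, g, coordQ_invQ hε, hm0, ha.ne']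
  have hfS : ∀ p : Phase, |p 0| < 2 * saddle ε → (f p ∈ Metric.sphere (0 : Phase) 1 ↔
      starkH ε p = E) := fun p hp => by
    rw [hmem, starkH_eq_coordQ hε]
    simp only [f, Matrix.cons_val_zero, Matrix.cons_val, Matrix.cons_val_one]
    have h1 := hm2 hp
    have h2 := pow_pos (hmpos hp) 2
    constructor
    · intro h
      have : m (p 0) ^ 2 * (V₁ ε (p 0) + (coordQ ε (p 1) ^ 2 + p 2 ^ 2 + p 3 ^ 2) / 2 - E) = 0 := by
        linear_combination (1 / 2 : ℝ) * h - (1 / 2 : ℝ) * h1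
      linarith [(mul_eq_zero.1 this).resolve_left h2.ne']
    · intro h
      linear_combination h1 + 2 * m (p 0) ^ 2 * h
  have hB : ∀ q : Phase, q ∈ Metric.sphere (0 : Phase) 1 \
      ⋃ j : Fin 2, Metric.ball (!₂[sgn j, 0, 0, 0] : Phase) 1 ↔
      q ∈ Metric.sphere (0 : Phase) 1 ∧ |q 0| ≤ 1 / 2 := fun q => by
    refine and_congr_right fun hq => ?_
    rw [mem_iUnion, not_exists, Fin.forall_fin_two, hball 0 q hq, hball 1 q hq, sgn_zero, sgn_one,
      not_lt, not_lt, abs_le]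
    constructor <;> rintro ⟨h1, h2⟩ <;> constructor <;> linarith
  refine ⟨f, g, {p | |p 0| < 2 * saddle ε}, {q | |q 0| < 1},
    isOpen_lt (continuous_coord 0).abs continuous_const,
    isOpen_lt (continuous_coord 0).abs continuous_const, fun p hp => ?_, fun q hq => ?_,
    ?_, ?_, fun p hp => ?_, fun q hq => ?_, fun p hp => ?_, fun q hq => ?_⟩
  · have := (mem_regionS_iff.1 hp).2
    change |p 0| < 2 * saddle ε
    linarith
  · have := ((hB q).1 hq).2
    change |q 0| < 1
    linarith
  · intro p hp
    refine ContDiffAt.contDiffWithinAt ?_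
    rw [contDiffAt_euclidean]
    have h1 : ContDiffAt ℝ ∞ (fun p : Phase => m (p 0)) p :=
      ContDiffAt.comp (g := m) p (hmsm hp) (contDiff_coord 0).contDiffAt
    have h2 : ContDiffAt ℝ ∞ (fun p : Phase => coordQ ε (p 1)) p :=
      ((contDiff_coordQ hε).comp (contDiff_coord 1)).contDiffAt
    intro i
    fin_cases i
    · exact (contDiff_coord 0).contDiffAt.div_const _
    · exact h2.mul h1
    · exact (contDiff_coord 2).contDiffAt.mul h1
    · exact (contDiff_coord 3).contDiffAt.mul h1
  · have h1 : ContDiffOn ℝ ∞ (fun q : Phase => (m (2 * saddle ε * q 0))⁻¹) {q | |q 0| < 1} := by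
      intro q hq
      refine ContDiffAt.contDiffWithinAt (ContDiffAt.inv ?_ (hmpos (hbd hq)).ne')
      exact ContDiffAt.comp q (hmsm (hbd hq)) (by fun_prop)
    exact ContDiffOn.mkPhase hε (by fun_prop)
      ((contDiff_coord 2).contDiffOn.mul h1) ((contDiff_coord 1).contDiffOn.mul h1)
      ((contDiff_coord 3).contDiffOn.mul h1)
  · obtain ⟨h1, h2⟩ := mem_regionS_iff.1 hp
    refine (hB _).2 ⟨(hfS p (by linarith)).2 h1, ?_⟩
    change |p 0 / (2 * saddle ε)| ≤ 1 / 2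
    rw [abs_div, abs_of_pos (by positivity : 0 < 2 * saddle ε), div_le_div_iff₀ (by positivity)
      (by norm_num)]
    linarith
  · obtain ⟨h1, h2⟩ := (hB q).1 hq
    have h3 : |g q 0| ≤ saddle ε := by
      change |2 * saddle ε * q 0| ≤ saddle ε
      rw [abs_mul, abs_of_pos (by positivity : 0 < 2 * saddle ε)]
      nlinarith
    refine mem_regionS_iff.2 ⟨(hfS (g q) (by linarith)).1 ?_, h3⟩
    rw [hfg q (by linarith)]
    exact h1
  · have := (mem_regionS_iff.1 hp).2
    exact hgf p (by linarith)
  · have := ((hB q).1 hq).2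
    exact hfg q (by linarith)

theorem isCompact_regionS (hε : 0 < ε) (hE : 1 / ε < E) : IsCompact (regionS ε E) := by
  obtain ⟨c, r, -, -, f, g, O, O', -, -, -, hBO, -, hg, hf', hg', hgf, -⟩ :=
    isPuncturedThreeSphere_regionS hε hE
  have hB : IsCompact (Metric.sphere (0 : Phase) 1 \ ⋃ j, Metric.ball (c j) (r j)) :=
    (isCompact_sphere 0 1).diff (isOpen_iUnion fun j => Metric.isOpen_ball)
  have himg : g '' (Metric.sphere (0 : Phase) 1 \ ⋃ j, Metric.ball (c j) (r j)) = regionS ε E :=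
    Subset.antisymm hg'.image_subset fun p hp => ⟨f p, hf' hp, hgf hp⟩
  rw [← himg]
  exact hB.image_of_continuousOn (hg.continuousOn.mono hBO)

end

/-! ### Breaking of the families of planes -/

/-- A criterion for Hausdorff convergence inside a compact set. -/
theorem eventually_hausdorffEDist_lt {X ι : Type*} [MetricSpace X] {l : Filter ι} {L : ι → Set X}
    {K S : Set X} (hS : IsCompact S) (hK : K ⊆ S) (hL : ∀ i, L i ⊆ S)
    (h1 : ∀ p ∈ S, p ∉ closure K → ∃ U ∈ 𝓝 p, ∀ᶠ i in l, Disjoint (L i) U)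
    (h2 : ∀ p ∈ K, ∃ q : ι → X, (∀ᶠ i in l, q i ∈ L i) ∧ Tendsto q l (𝓝 p))
    {η : ℝ} (hη : 0 < η) :
    ∀ᶠ i in l, Metric.hausdorffEDist (closure (L i)) (closure K) < ENNReal.ofReal η := by
  have hη2 : 0 < η / 2 := by positivity
  -- Compactness turns the pointwise `h1` into one inclusion in a thickening, and likewise `h2` into
  -- a uniform approximation of `closure K` below.
  have hA : ∀ᶠ i in l, Disjoint (L i) (S \ Metric.thickening (η / 2) K) := by
    refine (hS.diff Metric.isOpen_thickening).induction_on
      (p := fun s => ∀ᶠ i in l, Disjoint (L i) s) (by simp)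
      (fun s t hst ht => ht.mono fun i hi => hi.mono_right hst)
      (fun s t hs ht => (hs.and ht).mono fun i hi => hi.1.union_right hi.2) fun p hp => ?_
    obtain ⟨U, hU, hd⟩ := h1 p hp.1 fun h => hp.2 (Metric.closure_subset_thickening hη2 _ h)
    exact ⟨U, mem_nhdsWithin_of_mem_nhds hU, hd⟩
  have hB : ∀ᶠ i in l, ∀ p ∈ closure K, ∃ q ∈ L i, dist p q < η / 2 := by
    refine (hS.of_isClosed_subset isClosed_closure (closure_minimal hK hS.isClosed)).induction_on
      (p := fun s => ∀ᶠ i in l, ∀ p ∈ s, ∃ q ∈ L i, dist p q < η / 2) (by simp)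
      (fun s t hst ht => ht.mono fun i hi p hp => hi p (hst hp))
      (fun s t hs ht => (hs.and ht).mono fun i hi p hp => hp.elim (hi.1 p) (hi.2 p)) fun p hp => ?_
    have h8 : 0 < η / 8 := by positivity
    obtain ⟨p', hp', hd⟩ := Metric.mem_closure_iff.1 hp (η / 8) h8
    obtain ⟨q, hq, hqt⟩ := h2 p' hp'
    refine ⟨Metric.ball p (η / 8), mem_nhdsWithin_of_mem_nhds (Metric.ball_mem_nhds p h8), ?_⟩
    filter_upwards [hq, hqt (Metric.ball_mem_nhds p' h8)] with i hi hi' x hx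
    refine ⟨q i, hi, ?_⟩
    have e1 : dist x p < η / 8 := hx
    have e2 : dist (q i) p' < η / 8 := hi'
    have e3 := dist_triangle4 x p p' (q i)
    rw [dist_comm p' (q i)] at e3
    linarith
  filter_upwards [hA, hB] with i hi hi'
  rw [Metric.hausdorffEDist_closure]
  refine lt_of_le_of_lt (b := ENNReal.ofReal (η / 2))
    (Metric.hausdorffEDist_le_of_mem_edist (fun p hp => ?_) fun p hp => ?_)
    ((ENNReal.ofReal_lt_ofReal_iff hη).2 (by linarith))
  · have hpt : p ∈ Metric.thickening (η / 2) K := by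
      by_contra hcon
      exact Set.disjoint_left.1 hi hp ⟨hL i hp, hcon⟩
    obtain ⟨z, hz, hd⟩ := Metric.mem_thickening_iff.1 hpt
    exact ⟨z, hz, by rw [edist_dist]; exact ENNReal.ofReal_le_ofReal hd.le⟩
  · obtain ⟨q, hq, hd⟩ := hi' p (subset_closure hp)
    exact ⟨q, hq, by rw [edist_dist]; exact ENNReal.ofReal_le_ofReal hd.le⟩

section
variable {ε E : ℝ}

/-- The point of the energy surface over `(x, y)` in the direction `t` of the `(Q, y₂)`-plane. -/
noncomputable def surfacePoint (ε E t : ℝ) (z : ℝ × ℝ) : Phase :=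
  mkPhase ε z.1 z.2 (√(2 * (E - V₁ ε z.1) - z.2 ^ 2) * Real.cos (2 * Real.pi * t))
    (√(2 * (E - V₁ ε z.1) - z.2 ^ 2) * Real.sin (2 * Real.pi * t))

theorem continuous_surfacePoint (hε : 0 < ε) (t : ℝ) : Continuous (surfacePoint ε E t) := by
  have h1 : Continuous fun z : ℝ × ℝ => √(2 * (E - V₁ ε z.1) - z.2 ^ 2) := by
    have : Continuous fun z : ℝ × ℝ => V₁ ε z.1 := (continuous_V₁ ε).comp continuous_fst
    fun_prop
  exact (continuous_mkPhase hε).comp (continuous_fst.prodMk (continuous_snd.prodMk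
    ((h1.mul continuous_const).prodMk (h1.mul continuous_const))))

theorem starkH_surfacePoint (hε : 0 < ε) (t : ℝ) {z : ℝ × ℝ}
    (hz : 0 ≤ 2 * (E - V₁ ε z.1) - z.2 ^ 2) : starkH ε (surfacePoint ε E t z) = E := by
  have := Real.sq_sqrt hz
  rw [surfacePoint, starkH_mkPhase hε]
  linear_combination (1 / 2 : ℝ) * this + (√(2 * (E - V₁ ε z.1) - z.2 ^ 2) ^ 2 / 2) *
    Real.sin_sq_add_cos_sq (2 * Real.pi * t)

theorem exists_surfacePoint_eq (hε : 0 < ε) {p : Phase} (hp : starkH ε p = E) :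
    ∃ t, surfacePoint ε E t (p 0, p 2) = p := by
  rw [starkH_eq_coordQ hε] at hp
  have h : 0 ≤ 2 * (E - V₁ ε (p 0)) - p 2 ^ 2 := by
    nlinarith [sq_nonneg (coordQ ε (p 1)), sq_nonneg (p 3)]
  obtain ⟨t, h1, h2⟩ := exists_polar (Real.sqrt_nonneg (2 * (E - V₁ ε (p 0)) - p 2 ^ 2))
    (u := coordQ ε (p 1)) (v := p 3) (by rw [Real.sq_sqrt h]; linarith)
  refine ⟨t, ?_⟩
  rw [surfacePoint]
  simp only [← h1, ← h2, mkPhase_self hε]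

/-- The part of the energy surface over `{W = -sgn k * c * y⁸}`, for `sgn j * y > 0`. -/
def planeSet (ε E : ℝ) (k j : Fin 2) (c : ℝ) : Set Phase :=
  {p | starkH ε p = E ∧ |p 0| < saddle ε ∧ 0 < sgn j * p 2 ∧
    coordW ε (p 0) = -sgn k * c * p 2 ^ 8}

/-- The union of a rigid plane and a rigid cylinder. -/
def brokenSet (ε E : ℝ) (k j : Fin 2) : Set Phase :=
  {p | starkH ε p = E ∧ ((p 0 = -sgn k * saddle ε ∧ 0 < sgn j * p 2) ∨
    (p 2 = 0 ∧ 0 < -sgn k * p 0 ∧ |p 0| < saddle ε))}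

/-- The boundary circles of the cylinder are included: moving `x₁` toward the midpoint `-sgn k * a /
2`, with the direction in the `(Q, y₂)`-plane fixed, enters the cylinder. -/
theorem mem_closure_brokenSet (hε : 0 < ε) (hE : 1 / ε < E) (k j : Fin 2) {p : Phase}
    (hp : starkH ε p = E) (h2 : p 2 = 0) (h0 : 0 ≤ -sgn k * p 0) (ha : |p 0| ≤ saddle ε) :
    p ∈ closure (brokenSet ε E k j) := by
  have hsa := saddle_pos hε
  obtain ⟨t, ht⟩ := exists_surfacePoint_eq hε hp
  let x : ℝ → ℝ := fun δ => (1 - δ) * p 0 + δ * (-sgn k * saddle ε / 2)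
  have hc : Continuous fun δ => surfacePoint ε E t (x δ, 0) :=
    (continuous_surfacePoint hε t).comp (by fun_prop)
  have hlim : Tendsto (fun δ => surfacePoint ε E t (x δ, 0)) (𝓝[>] 0) (𝓝 p) := by
    have h := (hc.tendsto 0).mono_left (nhdsWithin_le_nhds (s := Ioi 0))
    have hx0 : x 0 = p 0 := by simp [x]
    rw [hx0, ← h2, ht] at h
    rw [h2] at h
    exact h
  refine mem_closure_of_tendsto hlim ?_
  filter_upwards [Ioo_mem_nhdsGT (show (0 : ℝ) < 1 by norm_num)] with δ hδ
  have hsx : -sgn k * x δ = (1 - δ) * (-sgn k * p 0) + δ * (saddle ε / 2) := by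
    simp only [x]
    linear_combination (δ * saddle ε / 2) * sgn_mul_self k
  have habs : ∀ y : ℝ, |(-sgn k * y)| = |y| := fun y => by
    rw [abs_mul, abs_neg, abs_sgn, one_mul]
  have ha' : -sgn k * p 0 ≤ saddle ε := (le_abs_self _).trans (by rw [habs]; exact ha)
  have hpos : 0 < -sgn k * x δ := by
    rw [hsx]
    have := mul_nonneg (sub_nonneg.2 hδ.2.le) h0
    have := mul_pos hδ.1 hsa
    linarith
  refine ⟨starkH_surfacePoint hε t ?_, Or.inr ⟨rfl, hpos, ?_⟩⟩
  · have := V₁_le hε (x δ)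
    simp only []
    nlinarith
  · change |x δ| < saddle ε
    rw [← habs, abs_of_pos hpos, hsx]
    nlinarith [mul_le_mul_of_nonneg_left ha' (sub_nonneg.2 hδ.2.le), mul_pos hδ.1 hsa]

theorem tendsto_invW_saddle (hε : 0 < ε) (k : Fin 2) :
    Tendsto (fun w => invW ε (-sgn k * w)) atTop (𝓝 (-sgn k * saddle ε)) := by
  have h1 : Tendsto (fun w : ℝ => -sgn k * (√((w ^ 2)⁻¹ + 2 * ε))⁻¹) atTop
      (𝓝 (-sgn k * (√(0 + 2 * ε))⁻¹)) := by
    have h2 : Tendsto (fun w : ℝ => (w ^ 2)⁻¹) atTop (𝓝 0) :=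
      tendsto_inv_atTop_zero.comp (tendsto_pow_atTop two_ne_zero)
    refine Tendsto.const_mul _ (Tendsto.inv₀ ((h2.add_const _).sqrt) ?_)
    rw [zero_add]
    positivity
  rw [zero_add] at h1
  refine h1.congr' ?_
  filter_upwards [eventually_gt_atTop 0] with w hw
  have h3 : 1 + 2 * ε * (-sgn k * w) ^ 2 = w ^ 2 * ((w ^ 2)⁻¹ + 2 * ε) := by
    rw [mul_pow, neg_sq, sgn_sq]
    field_simp
  rw [invW, h3, Real.sqrt_mul (by positivity), Real.sqrt_sq hw.le]
  field_simp

/-- On `planeSet` one has `(1 - 2εx₁²) y₁¹⁶ = x₁²/c² < a²/c²`, so the planes eventually avoid a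
neighbourhood of any point off the broken leaf. Conversely, points of the rigid plane are approached
by keeping `y₁` and solving for `x₁`, points of the cylinder by keeping `x₁` and solving for `y₁`.
-/
theorem planeSet_tendsto (hε : 0 < ε) (hE : 1 / ε < E) (k j : Fin 2) {η : ℝ} (hη : 0 < η) :
    ∀ᶠ c in atTop, Metric.hausdorffEDist (closure (planeSet ε E k j c))
      (closure (brokenSet ε E k j)) < ENNReal.ofReal η := by
  have hsa := saddle_pos hε
  have hka : |(-sgn k * saddle ε)| = saddle ε := abs_sgn_mul_saddle hε k
  refine eventually_hausdorffEDist_lt (isCompact_regionS hε hE) ?_ ?_ ?_ ?_ hη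
  · rintro p ⟨h1, (h2 | h2)⟩
    · exact mem_regionS_iff.2 ⟨h1, by rw [h2.1, hka]⟩
    · exact mem_regionS_iff.2 ⟨h1, h2.2.2.le⟩
  · exact fun c p hp => mem_regionS_iff.2 ⟨hp.1, hp.2.1.le⟩
  · intro p hp hcl
    obtain ⟨hpE, hpa⟩ := mem_regionS_iff.1 hp
    rcases lt_or_ge (sgn j * p 2) 0 with hy | hy
    · refine ⟨{q | sgn j * q 2 < 0}, (isOpen_lt (continuous_const.mul (continuous_coord 2))
        continuous_const).mem_nhds hy, Eventually.of_forall fun c => ?_⟩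
      exact Set.disjoint_left.2 fun q hq hq' => lt_asymm hq.2.2.1 hq'
    rcases lt_or_ge (-sgn k * p 0) 0 with hx | hx
    · refine ⟨{q | -sgn k * q 0 < 0}, (isOpen_lt (continuous_const.mul (continuous_coord 0))
        continuous_const).mem_nhds hx, ?_⟩
      filter_upwards [eventually_gt_atTop 0] with c hc
      refine Set.disjoint_left.2 fun q hq hq' => ?_
      have hq'' : -sgn k * q 0 < 0 := hq'
      refine lt_asymm (?_ : 0 < -sgn k * q 0) hq''
      refine (coordW_mul_self_pos hε hq.2.1).1 ?_
      have hq2 : q 2 ≠ 0 := fun h => by simpa [h] using hq.2.2.1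
      have : -sgn k * coordW ε (q 0) = c * q 2 ^ 8 := by
        rw [hq.2.2.2]
        linear_combination (c * q 2 ^ 8) * sgn_mul_self k
      rw [this]
      positivity
    have hy0 : p 2 ≠ 0 := fun h => hcl (mem_closure_brokenSet hε hE k j hpE h hx hpa)
    have hy' : 0 < sgn j * p 2 := lt_of_le_of_ne hy fun h =>
      hy0 ((mul_eq_zero.1 h.symm).resolve_left (sgn_ne_zero j))
    have hxa : |p 0| < saddle ε := by
      refine lt_of_le_of_ne hpa fun h => hcl (subset_closure ⟨hpE, Or.inl ⟨?_, hy'⟩⟩)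
      have h3 : |(-sgn k * p 0)| = saddle ε := by rw [abs_mul, abs_neg, abs_sgn, one_mul, h]
      rw [abs_of_nonneg hx] at h3
      linear_combination (-sgn k) * h3 - (p 0) * sgn_mul_self k
    have hpos : 0 < (1 - 2 * ε * p 0 ^ 2) * p 2 ^ 16 :=
      mul_pos (one_sub_pos hε hxa) (by positivity)
    set m := (1 - 2 * ε * p 0 ^ 2) * p 2 ^ 16 / 2 with hm
    have hm0 : 0 < m := by positivity
    have hcont : Continuous fun q : Phase => (1 - 2 * ε * q 0 ^ 2) * q 2 ^ 16 := by fun_prop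
    refine ⟨{q | m < (1 - 2 * ε * q 0 ^ 2) * q 2 ^ 16},
      (isOpen_lt continuous_const hcont).mem_nhds (by change m < _; rw [hm]; linarith), ?_⟩
    have hbig : Tendsto (fun c : ℝ => m * c ^ 2) atTop atTop :=
      (tendsto_pow_atTop two_ne_zero).const_mul_atTop hm0
    filter_upwards [hbig.eventually_gt_atTop (saddle ε ^ 2), eventually_gt_atTop 0] with c hc hc0
    refine Set.disjoint_left.2 fun q hq hq' => ?_
    have h1 := one_sub_pos hε hq.2.1
    have hq'' : m < (1 - 2 * ε * q 0 ^ 2) * q 2 ^ 16 := hq'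
    have hW : coordW ε (q 0) ^ 2 * (1 - 2 * ε * q 0 ^ 2) = q 0 ^ 2 := by
      rw [coordW, div_pow, Real.sq_sqrt h1.le, div_mul_cancel₀ _ h1.ne']
    rw [hq.2.2.2] at hW
    have hs := sgn_sq k
    have h2 : q 0 ^ 2 = (1 - 2 * ε * q 0 ^ 2) * q 2 ^ 16 * c ^ 2 := by
      linear_combination -hW + (c ^ 2 * q 2 ^ 16 * (1 - 2 * ε * q 0 ^ 2)) * hs
    have h3 : q 0 ^ 2 < saddle ε ^ 2 := sq_lt_sq' (abs_lt.1 hq.2.1).1 (abs_lt.1 hq.2.1).2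
    have h4 : m * c ^ 2 < (1 - 2 * ε * q 0 ^ 2) * q 2 ^ 16 * c ^ 2 :=
      mul_lt_mul_of_pos_right hq'' (by positivity)
    linarith
  · rintro p ⟨hpE, h⟩
    obtain ⟨t, ht⟩ := exists_surfacePoint_eq hε hpE
    have hen : p 2 ^ 2 ≤ 2 * (E - V₁ ε (p 0)) := by
      rw [starkH_eq_coordQ hε] at hpE
      nlinarith [sq_nonneg (coordQ ε (p 1)), sq_nonneg (p 3)]
    rcases h with ⟨hx, hy⟩ | ⟨hy, hx, hxa⟩
    · have hy0 : p 2 ≠ 0 := fun h => by simp [h] at hy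
      have hy8 : 0 < p 2 ^ 8 := by positivity
      let x : ℝ → ℝ := fun c => invW ε (-sgn k * (c * p 2 ^ 8))
      have hxt : Tendsto x atTop (𝓝 (p 0)) := by
        rw [hx]
        exact (tendsto_invW_saddle hε k).comp (tendsto_id.atTop_mul_const hy8)
      refine ⟨fun c => surfacePoint ε E t (x c, p 2), Eventually.of_forall fun c => ?_, ?_⟩
      · refine ⟨starkH_surfacePoint hε t ?_, abs_invW_lt hε _, hy, ?_⟩
        · have h1 := V₁_le hε (x c)
          -- `V₁` is maximal at the saddle, so changing `x₁` with `y₁` fixed keeps `H₁ ≤ E`.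
          rw [V₁_saddle hε (by rw [hx, mul_pow, neg_sq, sgn_sq, one_mul])] at hen
          simp only []
          linarith
        · change coordW ε (x c) = -sgn k * c * p 2 ^ 8
          simp only [x]
          rw [coordW_invW hε, mul_assoc]
      · have := ((continuous_surfacePoint (E := E) hε t).tendsto (p 0, p 2)).comp
          (hxt.prodMk_nhds tendsto_const_nhds)
        rw [ht] at this
        exact this
    · have hW : 0 < -sgn k * coordW ε (p 0) := (coordW_mul_self_pos hε hxa).2 hx
      let y : ℝ → ℝ := fun c => sgn j * (-sgn k * coordW ε (p 0) / c) ^ ((8 : ℕ) : ℝ)⁻¹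
      have hyt : Tendsto y atTop (𝓝 (p 2)) := by
        have h1 : Tendsto (fun c : ℝ => -sgn k * coordW ε (p 0) / c) atTop (𝓝 0) :=
          tendsto_const_nhds.div_atTop tendsto_id
        have h2 := (h1.rpow_const (p := ((8 : ℕ) : ℝ)⁻¹) (Or.inr (by positivity))).const_mul (sgn j)
        rw [Real.zero_rpow (by norm_num), mul_zero] at h2
        rw [hy]
        exact h2
      have hsm : ∀ᶠ c in atTop, 0 < 2 * (E - V₁ ε (p 0)) - y c ^ 2 := by
        have h1 : Tendsto (fun c => 2 * (E - V₁ ε (p 0)) - y c ^ 2) atTop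
          (𝓝 (2 * (E - V₁ ε (p 0)) - p 2 ^ 2)) := (hyt.pow 2).const_sub _
        refine h1.eventually_const_lt ?_
        rw [hy]
        have := two_mul_pos hε hE (p 0)
        linarith
      refine ⟨fun c => surfacePoint ε E t (p 0, y c), ?_, ?_⟩
      · filter_upwards [hsm, eventually_gt_atTop 0] with c hc hc0
        have hWc : 0 < -sgn k * coordW ε (p 0) / c := div_pos hW hc0
        refine ⟨starkH_surfacePoint hε t hc.le, hxa, ?_, ?_⟩
        · change 0 < sgn j * (sgn j * _)
          rw [← mul_assoc, sgn_mul_self, one_mul]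
          exact Real.rpow_pos_of_pos hWc _
        · change coordW ε (p 0) = -sgn k * c * y c ^ 8
          simp only [y]
          rw [mul_pow, Real.rpow_inv_natCast_pow hWc.le (by norm_num),
            show sgn j ^ 8 = (sgn j ^ 2) ^ 4 by ring, sgn_sq]
          field_simp
          linear_combination -coordW ε (p 0) * sgn_sq k
      · have := ((continuous_surfacePoint (E := E) hε t).tendsto (p 0, p 2)).comp
          (tendsto_const_nhds.prodMk_nhds hyt)
        rw [ht] at this
        exact this

theorem lineLabel_strictMono : StrictMono lineLabel := fun c c' h => by
  have := div_lt_div_of_pos_right (Real.arctan_strictMono h) Real.pi_pos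
  simp only [lineLabel]
  linarith

theorem leafSet_plane_eq (k j : Fin 2) (τ : Ioo (0 : ℝ) 1) {c : ℝ}
    (h : -sgn k * c = sgn j * lineParam τ) :
    leafSet ε E (.plane j τ) = planeSet ε E k j c := by
  ext p
  simp only [leafSet, OnLine, planeSet, h]

theorem leafSet_union_eq {k j : Fin 2} {b : Fin 2} (h : sgn (k + b) = sgn j) :
    leafSet ε E (.rigid k b) ∪ leafSet ε E (.cylinder k) = brokenSet ε E k j := by
  ext p
  simp only [leafSet, OnLine, brokenSet, h, mem_union, mem_ofPred_eq]
  tauto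

theorem leafSet_breaks_zero (hε : 0 < ε) (hE : 1 / ε < E) (j : Fin 2) {η : ℝ} (hη : 0 < η) :
    ∃ δ > (0 : ℝ), ∀ τ : Ioo (0 : ℝ) 1, (τ : ℝ) < δ →
      Metric.hausdorffEDist (closure (leafSet ε E (.plane j τ)))
        (closure (leafSet ε E (.rigid j 0) ∪ leafSet ε E (.cylinder j))) < ENNReal.ofReal η := by
  obtain ⟨M, hM⟩ := eventually_atTop.1 (planeSet_tendsto hε hE j j hη)
  refine ⟨lineLabel (-M), (lineLabel_mem _).1, fun τ hτ => ?_⟩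
  rw [← lineLabel_lineParam τ.2, lineLabel_strictMono.lt_iff_lt] at hτ
  rw [leafSet_plane_eq j j τ (c := -lineParam τ) (by ring), leafSet_union_eq (j := j) (by simp)]
  exact hM _ (by linarith)

theorem leafSet_breaks_one (hε : 0 < ε) (hE : 1 / ε < E) (j : Fin 2) {η : ℝ} (hη : 0 < η) :
    ∃ δ > (0 : ℝ), ∀ τ : Ioo (0 : ℝ) 1, 1 - δ < (τ : ℝ) →
      Metric.hausdorffEDist (closure (leafSet ε E (.plane j τ)))
        (closure (leafSet ε E (.rigid (j + 1) 1) ∪ leafSet ε E (.cylinder (j + 1)))) <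
          ENNReal.ofReal η := by
  obtain ⟨M, hM⟩ := eventually_atTop.1 (planeSet_tendsto hε hE (j + 1) j hη)
  refine ⟨1 - lineLabel M, sub_pos.2 (lineLabel_mem _).2, fun τ hτ => ?_⟩
  rw [sub_sub_cancel, ← lineLabel_lineParam τ.2, lineLabel_strictMono.lt_iff_lt] at hτ
  rw [leafSet_plane_eq (j + 1) j τ (c := lineParam τ) (by rw [sgn_add_one]; ring),
    leafSet_union_eq (j := j) (by rw [sgn_add_one, sgn_add_one, neg_neg])]
  exact hM _ hτ.le

end

section
variable {ε E : ℝ}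

/-! ### The flow through the boundary spheres -/

theorem eventually_starkH_eq {c : ℝ → Phase}
    (hc : ∀ᶠ t in 𝓝 (0 : ℝ), HasDerivAt c (hamVec (starkH ε) (c t)) t) :
    ∀ᶠ t in 𝓝 (0 : ℝ), starkH ε (c t) = starkH ε (c 0) := by
  obtain ⟨r, hr, hball⟩ := Metric.eventually_nhds_iff_ball.1 hc
  have hd : ∀ t ∈ Metric.ball (0 : ℝ) r, HasDerivAt (fun t => starkH ε (c t)) 0 t := fun t ht => by
    have h1 : HasFDerivAt (starkH ε) (fderiv ℝ (starkH ε) (c t)) (c t) :=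
      (hasGradientAt_iff_hasFDerivAt.1 (hasGradientAt_starkH ε (c t))).differentiableAt.hasFDerivAt
    exact (h1.comp_hasDerivAt t (hball t ht)).congr_deriv (fderiv_starkH_hamVec ε (c t))
  filter_upwards [Metric.ball_mem_nhds 0 hr] with t ht
  exact Metric.isOpen_ball.is_const_of_deriv_eq_zero (convex_ball 0 r).isPreconnected
    (fun s hs => (hd s hs).differentiableAt.differentiableWithinAt) (fun s hs => (hd s hs).deriv)
    ht (Metric.mem_ball_self hr)

theorem eventually_lt_of_hasDerivAt_neg {f : ℝ → ℝ} {d : ℝ} (hf : HasDerivAt f d 0) (hd : d < 0) :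
    (∀ᶠ t in 𝓝[>] (0 : ℝ), f t < f 0) ∧ ∀ᶠ t in 𝓝[<] (0 : ℝ), f 0 < f t := by
  have h := (hasDerivAt_iff_tendsto_slope.1 hf).eventually_lt_const hd
  constructor
  · filter_upwards [h.filter_mono (nhdsWithin_mono _ fun t (ht : 0 < t) => ht.ne'),
      self_mem_nhdsWithin] with t ht (ht0 : 0 < t)
    rw [slope_def_field, sub_zero, div_lt_iff₀ ht0, zero_mul] at ht
    linarith
  · filter_upwards [h.filter_mono (nhdsWithin_mono _ fun t (ht : t < 0) => ht.ne),
      self_mem_nhdsWithin] with t ht (ht0 : t < 0)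
    rw [slope_def_field, sub_zero, div_lt_iff_of_neg ht0, zero_mul] at ht
    linarith

/-- By energy conservation only the outward coordinate `-sgn j * x₁` decides membership near saddle
`j`, and its derivative is `-sgn j * y₁`. -/
theorem mem_regionS_flow (hε : 0 < ε) {j : Fin 2} {p : Phase} (hp : starkH ε p = E)
    (h0 : p 0 = -sgn j * saddle ε) {c : ℝ → Phase}
    (hc : ∀ᶠ t in 𝓝 (0 : ℝ), HasDerivAt c (hamVec (starkH ε) (c t)) t) (hc0 : c 0 = p) :
    HasDerivAt (fun t => -sgn j * c t 0) (-(sgn j * p 2)) 0 ∧ -sgn j * c 0 0 = saddle ε ∧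
      ∀ᶠ t in 𝓝 (0 : ℝ), c t ∈ regionS ε E ↔ -sgn j * c t 0 ≤ saddle ε := by
  have hd : HasDerivAt (fun t => -sgn j * c t 0) (-(sgn j * p 2)) 0 := by
    have h1 := hasDerivAt_phase.1 hc.self_of_nhds 0
    rw [hamVec_starkH, hc0] at h1
    exact (h1.const_mul (-sgn j)).congr_deriv (by simp)
  have h00 : -sgn j * c 0 0 = saddle ε := by
    rw [hc0, h0]
    linear_combination saddle ε * sgn_mul_self j
  refine ⟨hd, h00, ?_⟩
  have hpos : ∀ᶠ t in 𝓝 (0 : ℝ), 0 < -sgn j * c t 0 :=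
    hd.continuousAt.eventually_const_lt (by simp only []; rw [h00]; exact saddle_pos hε)
  filter_upwards [hpos, eventually_starkH_eq hc] with t ht hH
  rw [mem_regionS_iff, hH, hc0]
  have : |c t 0| = -sgn j * c t 0 := by
    rw [← abs_of_pos ht, abs_mul, abs_neg, abs_sgn, one_mul]
  rw [this]
  exact and_iff_right hp

theorem entersAt_rigid (hε : 0 < ε) {j : Fin 2} {p : Phase}
    (hp : p ∈ leafSet ε E (.rigid j 0)) : EntersAt (starkH ε) (regionS ε E) p := by
  obtain ⟨hpE, h0, hy⟩ := hp
  rw [add_zero] at hy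
  intro c hc hc0
  obtain ⟨hd, h00, hmem⟩ := mem_regionS_flow hε hpE h0 hc hc0
  obtain ⟨h1, h2⟩ := eventually_lt_of_hasDerivAt_neg hd (neg_neg_of_pos hy)
  simp only [h00] at h1 h2
  constructor
  · filter_upwards [h1, hmem.filter_mono nhdsWithin_le_nhds] with t ht hm
    exact hm.2 ht.le
  · filter_upwards [h2, hmem.filter_mono nhdsWithin_le_nhds] with t ht hm h
    exact absurd (hm.1 h) (not_le.2 ht)

theorem leavesAt_rigid (hε : 0 < ε) {j : Fin 2} {p : Phase}
    (hp : p ∈ leafSet ε E (.rigid j 1)) : LeavesAt (starkH ε) (regionS ε E) p := by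
  obtain ⟨hpE, h0, hy⟩ := hp
  rw [sgn_add_one] at hy
  intro c hc hc0
  obtain ⟨hd, h00, hmem⟩ := mem_regionS_flow hε hpE h0 hc hc0
  obtain ⟨h1, h2⟩ := eventually_lt_of_hasDerivAt_neg hd.neg (by linarith)
  simp only [Pi.neg_apply, h00, neg_lt_neg_iff] at h1 h2
  constructor
  · filter_upwards [h1, hmem.filter_mono nhdsWithin_le_nhds] with t ht hm h
    exact absurd (hm.1 h) (not_le.2 ht)
  · filter_upwards [h2, hmem.filter_mono nhdsWithin_le_nhds] with t ht hm
    exact hm.2 ht.le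

/-! ### The foliation -/

theorem dV₁_critical (hε : 0 < ε) (j : Fin 2) : dV₁ ε (-sgn j * saddle ε) = 0 := by
  rw [dV₁_eq hε, mul_pow, neg_sq, sgn_sq]; ring

/-- The Lyapunov orbits. -/
noncomputable def lyapunovOrbit (hε : 0 < ε) (hE : 1 / ε < E) (j : Fin 2) :
    PeriodicOrbit (starkH ε) E :=
  Classical.choose (exists_orbit hε (dV₁_critical hε j) (V₁_saddle_lt hε hE j))

theorem lyapunovOrbit_spec (hε : 0 < ε) (hE : 1 / ε < E) (j : Fin 2) :
    (lyapunovOrbit hε hE j).trace = fiber ε E (-sgn j * saddle ε) ∧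
      (∀ t, (lyapunovOrbit hε hE j).w t 0 = -sgn j * saddle ε ∧ (lyapunovOrbit hε hE j).w t 2 = 0) ∧
      ∃ χ N, HasFrameTurn (lyapunovOrbit hε hE j) χ N := by
  obtain ⟨h1, -, h2, h3⟩ :=
    Classical.choose_spec (exists_orbit hε (dV₁_critical hε j) (V₁_saddle_lt hε hE j))
  exact ⟨h1, h2, h3⟩

theorem exists_centerOrbit (hε : 0 < ε) (hE : 1 / ε < E) :
    ∃ P : PeriodicOrbit (starkH ε) E, P.trace = fiber ε E 0 ∧ P.T ≤ 2 * Real.pi / √8 ∧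
      (∀ t, P.w t 0 = 0 ∧ P.w t 2 = 0) ∧ ∃ χ N, HasFrameTurn P χ N :=
  exists_orbit hε (by simp [dV₁]) ((V₁_le hε 0).trans_lt hE)

/-- The orbit over the origin of the `x₁y₁`-plane. -/
noncomputable def centerOrbit (hε : 0 < ε) (hE : 1 / ε < E) : PeriodicOrbit (starkH ε) E :=
  Classical.choose (exists_centerOrbit hε hE)

/-- The foliation of `S_E` by the preimages of the gradient lines of `H₁`. -/
noncomputable def foliation (hε : 0 < ε) (hE : 1 / ε < E) : FoliationData (starkH ε) E 2 where
  P₂ := lyapunovOrbit hε hE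
  P₃ := centerOrbit hε hE
  param := leafParam hε hE

theorem leaf_foliation (hε : 0 < ε) (hE : 1 / ε < E) (i : LeafIndex 2) :
    (foliation hε hE).leaf i = leafSet ε E i := image_leafParam hε hE i

theorem mem_binding (hε : 0 < ε) (hE : 1 / ε < E) {p : Phase} :
    p ∈ (foliation hε hE).binding ↔
      starkH ε p = E ∧ p 2 = 0 ∧ (p 0 = 0 ∨ |p 0| = saddle ε) := by
  have h3 : (foliation hε hE).P₃.trace = fiber ε E 0 :=
    (Classical.choose_spec (exists_centerOrbit hε hE)).1
  have h2 : ∀ j, ((foliation hε hE).P₂ j).trace = fiber ε E (-sgn j * saddle ε) := fun j =>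
    (lyapunovOrbit_spec hε hE j).1
  rw [FoliationData.binding, mem_union, mem_iUnion, h3]
  simp only [h2, fiber, mem_ofPred_eq, Fin.exists_fin_two, sgn_zero, sgn_one,
    abs_eq (saddle_pos hε).le]
  simp only [neg_mul, one_mul, neg_neg]
  tauto

theorem sphere_foliation (hε : 0 < ε) (hE : 1 / ε < E) (j : Fin 2) :
    (foliation hε hE).sphere j = {p | starkH ε p = E ∧ p 0 = -sgn j * saddle ε} := by
  have h2 : ((foliation hε hE).P₂ j).trace = fiber ε E (-sgn j * saddle ε) :=
    (lyapunovOrbit_spec hε hE j).1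
  rw [FoliationData.sphere, leaf_foliation, leaf_foliation, h2]
  ext p
  simp only [leafSet, OnLine, fiber, mem_union, mem_ofPred_eq, add_zero, sgn_add_one]
  constructor
  · rintro ((h | h) | h)
    · exact ⟨h.1, h.2.1⟩
    · exact ⟨h.1, h.2.1⟩
    · exact ⟨h.1, h.2.1⟩
  · rintro ⟨h, h'⟩
    rcases lt_trichotomy (sgn j * p 2) 0 with h3 | h3 | h3
    · exact Or.inl (Or.inr ⟨h, h', by linarith⟩)
    · exact Or.inr ⟨h, h', (mul_eq_zero.1 h3).resolve_left (sgn_ne_zero j)⟩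
    · exact Or.inl (Or.inl ⟨h, h', h3⟩)

theorem family_foliation (hε : 0 < ε) (E : ℝ) (j : Fin 2) :
    ∃ (O : Set Phase) (G : Phase → ℝ), IsOpen O ∧
      O ∩ regionS ε E = ⋃ τ, leafSet ε E (.plane j τ) ∧ ContDiffOn ℝ ∞ G O ∧
      (∀ τ : Ioo (0 : ℝ) 1, ∀ p ∈ leafSet ε E (.plane j τ), G p = τ) ∧
      ∀ q ∈ O ∩ regionS ε E, ∃ v, fderiv ℝ (starkH ε) q v = 0 ∧ fderiv ℝ G q v ≠ 0 := by
  obtain ⟨hO, hg, hX, -⟩ := isLeafChart_planes hε E j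
  set O : Set Phase := {p | |p 0| < saddle ε ∧ 0 < sgn j * p 2} with hOdef
  set g : Phase → ℝ := fun p => coordW ε (p 0) * (p 2 ^ 8)⁻¹ with hgdef
  refine ⟨O, fun p => lineLabel (sgn j * g p), hO, ?_, ?_, ?_, ?_⟩
  · ext p
    rw [mem_iUnion]
    constructor
    · rintro ⟨⟨h1, h2⟩, hS⟩
      obtain ⟨i, hi⟩ := exists_onLine hε h1.le (y := p 2) (by rintro ⟨h, -⟩; simp [h] at h2)
      match i, hi with
      | .rigid k b, hi => rw [hi.1, abs_sgn_mul_saddle hε] at h1; exact absurd h1 (lt_irrefl _)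
      | .cylinder k, hi => simp [hi.1] at h2
      | .plane k τ, hi =>
        obtain rfl := eq_of_sgn_mul_pos hi.2.1 h2
        exact ⟨τ, (mem_regionS_iff.1 hS).1, hi⟩
    · rintro ⟨τ, hp⟩
      exact ⟨⟨hp.2.1, hp.2.2.1⟩, leafSet_subset hε _ hp⟩
  · have h1 : ContDiff ℝ ∞ lineLabel :=
      contDiff_const.add (Real.contDiff_arctan.div_const _)
    exact h1.comp_contDiffOn (contDiffOn_const.mul hg)
  · rintro τ p ⟨-, hp⟩
    have hy : p 2 ≠ 0 := fun h => by simpa [h] using hp.2.1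
    have : sgn j * g p = lineParam τ := by
      simp only [hgdef]
      rw [hp.2.2]
      field_simp
      linear_combination lineParam τ * sgn_mul_self j
    simp only [this]
    exact lineLabel_lineParam τ.2
  · rintro q ⟨hq, -⟩
    -- The Hamiltonian vector itself is a tangent direction in which the label varies.
    refine ⟨_, fderiv_starkH_hamVec ε q, ?_⟩
    have hgd : HasFDerivAt g (fderiv ℝ g q) q :=
      ((hg.contDiffAt (hO.mem_nhds hq)).differentiableAt (by simp)).hasFDerivAt
    have hl : HasDerivAt lineLabel ((1 / (1 + (sgn j * g q) ^ 2)) / Real.pi) (sgn j * g q) :=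
      ((Real.hasDerivAt_arctan _).div_const Real.pi).const_add (1 / 2)
    have h := (hl.comp_hasFDerivAt q (hgd.const_mul (sgn j))).fderiv
    have h' : fderiv ℝ (fun p => lineLabel (sgn j * g p)) q = _ := h
    rw [h']
    simp only [_root_.smul_apply, smul_eq_mul]
    refine mul_ne_zero ?_ (mul_ne_zero (sgn_ne_zero j) (hX q hq))
    positivity

theorem isWeaklyConvexFoliation (hε : 0 < ε) (hE : 1 / ε < E) :
    IsWeaklyConvexFoliation (foliation hε hE) (regionS ε E) := by
  have hsa := saddle_pos hε
  obtain ⟨hP3, hT, hw3, χ, N, hF⟩ := Classical.choose_spec (exists_centerOrbit hε hE)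
  change (foliation hε hE).P₃.trace = fiber ε E 0 at hP3
  have hP2 : ∀ j, ((foliation hε hE).P₂ j).trace = fiber ε E (-sgn j * saddle ε) := fun j =>
    (lyapunovOrbit_spec hε hE j).1
  have hsq : ∀ j, (-sgn j * saddle ε) ^ 2 = saddle ε ^ 2 := fun j => by
    rw [mul_pow, neg_sq, sgn_sq, one_mul]
  have hnb : ∀ {p}, p ∈ regionS ε E \ (foliation hε hE).binding →
      ¬ (p 2 = 0 ∧ (p 0 = 0 ∨ |p 0| = saddle ε)) := fun {p} hp h =>
    hp.2 ((mem_binding hε hE).2 ⟨(mem_regionS_iff.1 hp.1).1, h⟩)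
  have hunion : ⋃ i, (foliation hε hE).leaf i = regionS ε E \ (foliation hε hE).binding := by
    ext p
    simp only [mem_iUnion, leaf_foliation]
    constructor
    · rintro ⟨i, hi⟩
      exact ⟨leafSet_subset hε i hi, fun h =>
        OnLine.not_binding hi.2 ((mem_binding hε hE).1 h).2⟩
    · intro hp
      obtain ⟨h1, h2⟩ := mem_regionS_iff.1 hp.1
      obtain ⟨i, hi⟩ := exists_onLine hε h2 (hnb hp)
      exact ⟨i, h1, hi⟩
  have hchart : ∀ p ∈ regionS ε E \ (foliation hε hE).binding,
      ∃ O g, IsLeafChart ε E O g ∧ p ∈ O := fun p hp =>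
    exists_leafChart hε E (mem_regionS_iff.1 hp.1).2 (hnb hp)
  refine
    { subset_energy := fun p hp => (mem_regionS_iff.1 hp).1
      regular := fun p hp => gradient_ne_zero hε hE hp
      compact := isCompact_regionS hε hE
      punctured := isPuncturedThreeSphere_regionS hε hE
      boundary := ?_
      sphere_embedded := fun j => by
        rw [sphere_foliation]; exact isEmbeddedSphere_fiber hε hE _
      opposite := fun j => Or.inl ⟨fun p hp => ?_, fun p hp => ?_⟩
      index_two := fun j => ?_
      hyperbolic := fun j => ?_
      index_three := hasIndex_three_center hw3 hT hF
      unknotted := isUnknottedIn_center hε hE hP3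
      binding_subset := fun p hp => ?_
      disjoint_two := fun i j hij => ?_
      disjoint_three := fun j => ?_
      union_leaf := hunion
      disjoint_leaf := fun i i' hii' => ?_
      chart := fun p hp => ?_
      embedded := isSmoothEmbeddingOn_leafParam hε hE
      proper := fun i p hp => ?_
      asymptotic_rigid := fun j b => isAsymptotic_rigid hε hE j b (hP2 j)
      asymptotic_cylinder_three := fun j => isAsymptotic_cylinder_top hε hE j hP3
      asymptotic_cylinder_two := fun j => isAsymptotic_cylinder_zero hε hE j (hP2 j)
      asymptotic_plane := fun j τ => isAsymptotic_plane hε hE j τ hP3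
      family := fun j => ?_
      breaks_zero := fun j η hη => ?_
      breaks_one := fun j η hη => ?_
      transverse := fun i z hz => hamVec_notMem_range hε hE i hz }
  · rw [regionS_inter_closure hε hE]
    ext p
    simp only [mem_iUnion, sphere_foliation, mem_ofPred_eq, Fin.exists_fin_two, sgn_zero, sgn_one,
      abs_eq hsa.le, neg_mul, one_mul, neg_neg]
    tauto
  · rw [leaf_foliation] at hp
    exact entersAt_rigid hε hp
  · rw [leaf_foliation] at hp
    exact leavesAt_rigid hε hp
  · obtain ⟨-, h2, χ, N, hF⟩ := lyapunovOrbit_spec hε hE j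
    exact hasIndex_two_saddle hε (hsq j) h2 hF
  · obtain ⟨-, h2, χ, N, hF⟩ := lyapunovOrbit_spec hε hE j
    exact isHyperbolic_saddle hε (hsq j) h2 hF
  · obtain ⟨h1, -, h2⟩ := (mem_binding hε hE).1 hp
    refine mem_regionS_iff.2 ⟨h1, ?_⟩
    rcases h2 with h2 | h2
    · rw [h2, abs_zero]; exact hsa.le
    · exact h2.le
  · change Disjoint _ _
    rw [hP2, hP2]
    refine Set.disjoint_left.2 fun p hp hp' => hij ?_
    have h : sgn i * saddle ε = sgn j * saddle ε := by linarith [hp.2.1, hp'.2.1]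
    refine eq_of_sgn_mul_pos (x := sgn i) (by rw [sgn_mul_self]; exact one_pos) ?_
    rw [mul_right_cancel₀ hsa.ne' h, sgn_mul_self]; exact one_pos
  · rw [hP2, hP3]
    refine Set.disjoint_left.2 fun p hp hp' => ?_
    have h := hp.2.1.symm.trans hp'.2.1
    simp [sgn_ne_zero, hsa.ne'] at h
  · change Disjoint _ _
    rw [leaf_foliation, leaf_foliation]
    exact Set.disjoint_left.2 fun p hp hp' => hii' (OnLine.unique hε hp.2 hp'.2)
  · obtain ⟨O, g, ⟨hO, hg, hX, hlev⟩, hpO⟩ := hchart p hp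
    refine ⟨O, g, hO, hpO, hg, fun q hq => ⟨_, fderiv_starkH_hamVec ε q, hX q hq.1⟩, ?_⟩
    simp only [leaf_foliation]
    exact hlev
  · obtain ⟨hcl, hpS⟩ := hp
    obtain ⟨i', hi'⟩ := mem_iUnion.1 (hunion.symm ▸ hpS)
    obtain ⟨O, g, ⟨hO, hg, -, hlev⟩, hpO⟩ := hchart p hpS
    rw [leaf_foliation] at hcl hi' ⊢
    have hgc : ContinuousAt g p := hg.continuousOn.continuousAt (hO.mem_nhds hpO)
    have hcl' : p ∈ closure (O ∩ leafSet ε E i) := by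
      rw [mem_closure_iff_nhds] at hcl ⊢
      intro t ht
      obtain ⟨q, hq, hqi⟩ := hcl (t ∩ O) (inter_mem ht (hO.mem_nhds hpO))
      exact ⟨q, hq.1, hq.2, hqi⟩
    obtain ⟨q, hqO⟩ := closure_nonempty_iff.1 ⟨p, hcl'⟩
    -- The chart is constant on the leaf, hence by continuity also at the limit point `p`, which
    -- therefore carries the same label.
    have hgp : g p = g q := by
      have hsub : g '' (O ∩ leafSet ε E i) ⊆ {g q} := by
        rintro _ ⟨q', hq', rfl⟩
        exact (hlev i i q' q hq' hqO).1 rfl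
      have h1 : g p ∈ closure (g '' (O ∩ leafSet ε E i)) :=
        mem_closure_image hgc hcl'
      exact closure_minimal hsub isClosed_singleton h1
    rw [(hlev i i' q p hqO ⟨hpO, hi'⟩).2 hgp.symm]
    exact hi'
  · simp only [leaf_foliation]
    exact family_foliation hε E j
  · simp only [leaf_foliation]
    exact leafSet_breaks_zero hε hE j hη
  · simp only [leaf_foliation]
    exact leafSet_breaks_one hε hE j hη

theorem projOne_image_leafSet (hε : 0 < ε) (i : LeafIndex 2) :
    projOne '' leafSet ε E i = range (lineCurve ε i) ∩ {z | H₁ ε z ≤ E} := by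
  have hH : ∀ p : Phase, H₁ ε (projOne p) = p 2 ^ 2 / 2 + V₁ ε (p 0) := fun p => rfl
  ext z
  constructor
  · rintro ⟨p, ⟨hp, hl⟩, rfl⟩
    refine ⟨(mem_range_lineCurve hε).2 hl, ?_⟩
    rw [starkH_eq_coordQ hε] at hp
    rw [mem_ofPred_eq, hH]
    nlinarith [sq_nonneg (coordQ ε (p 1)), sq_nonneg (p 3)]
  · rintro ⟨hz, hzE⟩
    have hzE' : z 1 ^ 2 / 2 + V₁ ε (z 0) ≤ E := hzE
    refine ⟨surfacePoint ε E 0 (z 0, z 1), ⟨starkH_surfacePoint hε 0 ?_, ?_⟩, ?_⟩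
    · simp only []
      linarith
    · exact (mem_range_lineCurve hε).1 hz
    · ext k; fin_cases k <;> rfl

end

end Stark

theorem mainTheorem9 (ε E : ℝ) (hε : 0 < ε) (hE : 1 / ε < E) :
    -- `K_E` is a disk bounded by the projections of the Lyapunov orbits and by arcs of `{V = E}`
    Nonempty (Stark.regionK ε E ≃ₜ Metric.closedBall (0 : ℂ) 1) ∧
    frontier (Stark.regionK ε E) =
      Stark.projX '' Stark.fiber ε E (-Stark.saddle ε) ∪
      Stark.projX '' Stark.fiber ε E (Stark.saddle ε) ∪
      {x | Stark.potential ε x = E ∧ |x 0| ≤ Stark.saddle ε} ∧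
    Stark.projX '' Stark.regionS ε E = Stark.regionK ε E ∧
    ∃ F : Stark.FoliationData (Stark.starkH ε) E 2,
      Stark.IsWeaklyConvexFoliation F (Stark.regionS ε E) ∧
      (F.P₂ 0).trace = Stark.fiber ε E (-Stark.saddle ε) ∧
      (F.P₂ 1).trace = Stark.fiber ε E (Stark.saddle ε) ∧
      F.P₃.trace = Stark.fiber ε E 0 ∧
      Stark.projX '' F.P₃.trace ⊆ Stark.regionK ε E ∧
      ∀ i, ∃ c : ℝ → Stark.Plane, Stark.IsGradientFlowLine (Stark.H₁ ε) c ∧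
        F.leaf i = {p ∈ Stark.regionS ε E | Stark.projOne p ∈ Set.range c} ∧
        Stark.projOne '' F.leaf i = Set.range c ∩ {z | Stark.H₁ ε z ≤ E} := by
  have hfol := Stark.isWeaklyConvexFoliation hε hE
  refine ⟨Stark.regionK_homeomorph hε hE, Stark.frontier_regionK hε hE,
    Stark.projX_image_regionS, Stark.foliation hε hE, hfol, ?_, ?_, ?_, ?_, fun i =>
      ⟨Stark.lineCurve ε i, Stark.isGradientFlowLine_lineCurve hε i, ?_, ?_⟩⟩
  · exact (Stark.lyapunovOrbit_spec hε hE 0).1.trans (by simp [Stark.sgn])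
  · exact (Stark.lyapunovOrbit_spec hε hE 1).1.trans (by simp [Stark.sgn])
  · exact (Classical.choose_spec (Stark.exists_centerOrbit hε hE)).1
  · rintro _ ⟨p, hp, rfl⟩
    exact (hfol.binding_subset (Or.inl hp)).2
  · rw [Stark.leaf_foliation]
    ext p
    constructor
    · intro hp
      exact ⟨Stark.leafSet_subset hε i hp, (Stark.mem_range_lineCurve hε).2 hp.2⟩
    · rintro ⟨hS, hp⟩
      exact ⟨(Stark.mem_regionS_iff.1 hS).1, (Stark.mem_range_lineCurve hε).1 hp⟩
  · rw [Stark.leaf_foliation]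
    exact Stark.projOne_image_leafSet hε i
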